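/- Let $\mathbb H$ be the quaternions, $\mathbb S=\{I\in\mathbb H:\ \mathrm{Re}\,I=0,\ |I|=1\}$ and $L_I=\mathbb R+I\mathbb R$. A function $f$ is (slice left) regular on an open set $\Omega\subseteq\mathbb H$ if it is real differentiable there and $\frac12(\partial_x+I\partial_y)f(x+Iy)=0$ for all $I\in\mathbb S$ and $x+Iy\in\Omega$; it is regular at $\infty$ if it is regular on $\{|q|>r\}$ for some $r$ and $f(\infty):=\lim_{q\to\infty}f(q)$ exists in $\mathbb H$; it is regular on $W\cup\partial W$ if it is regular on an open set containing $\overline W$. Let $V$ be a two-sided quaternionic Banach space and $\mathcal B(V)$ the space of bounded right linear operators on $V$, with $(aT)(v)=aT(v)$ and $(Ta)(v)=T(av)$ for $a\in\mathbb H$. Let $T:\mathcal D(T)\subseteq V\to V$ be a closed right linear operator such that $\mathcal D(T)$ and $\mathcal D(T^2)$ are dense in $V$. Its $S$-resolvent set $\rho_S(T)$ consists of the $s\in\mathbb H$ for which $T^2-2\mathrm{Re}[s]T+|s|^2\mathcal I:\mathcal D(T^2)\to V$ is bijective and $-(T^2-2\mathrm{Re}[s]T+|s|^2\mathcal I)^{-1}(T-\overline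 s\mathcal I)$ extends from $\mathcal D(T)$ to an operator $S^{-1}(s,T)\in\mathcal B(V)$; put $\sigma_S(T)=\mathbb H\setminus\rho_S(T)$. For $A\in\mathcal B(V)$, $\sigma_S(A)$ is the set of $s$ for which $A^2-2\mathrm{Re}[s]A+|s|^2\mathcal I$ is not invertible in $\mathcal B(V)$, and $S^{-1}(s,A)=-(A^2-2\mathrm{Re}[s]A+|s|^2\mathcal I)^{-1}(A-\overline s\mathcal I)$ for $s\notin\sigma_S(A)$. Below, $ds_I=-I\,ds$ on $L_I$, and a boundary $\partial(W\cap L_I)$ (taken in $L_I\cong\mathbb C$) is called good if it is the union of finitely many rectifiable Jordan curves, oriented so that their total winding number is a constant $c$ off the closure of $W\cap L_I$ and $c+1$ on $W\cap L_I$ (positive orientation). Assume $\rho_S(T)\cap\mathbb R\neq\emptyset$, and let $f$ be regular at $\infty$ and on an open set $U\supseteq\sigma_S(T)$. For real $k$ put $\phi_k(p)=f(p^{-1}+k)$ for $p\ne0$ and $\phi_k(0)=f(\infty)$. Then there is a family of operators $F_I\in\mathcal B(V)$ ($I\in\mathbb S$) with the following properties. 1. (Independence of $k$.) For every $I\in\mathbb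 S$ and every $k\in\rho_S(T)\cap\mathbb R$, the operator $A=(T-k\mathcal I)^{-1}$ exists in $\mathcal B(V)$ and $F_I=\phi_k(A)$ computed on $L_I$. That is, there are bounded open sets $U'\supseteq\sigma_S(A)$ such that $\phi_k$ is regular on $U'\cup\partial U'$ and $\partial(U'\cap L_J)$ can be made good for every $J\in\mathbb S$; and for every bounded open $U'\supseteq\sigma_S(A)$ such that $\phi_k$ is regular on $U'\cup\partial U'$ and $\partial (U'\cap L_I)$ is good, $$F_I=\frac1{2\pi}\int_{\partial(U'\cap L_I)}S^{-1}(p,A)\,dp_I\,\phi_k(p).$$ 2. (Cauchy formula.) For every $I\in\mathbb S$ and every open $W\subseteq\mathbb H$ with $\sigma_S(T)\subseteq W$ that contains $\{|q|>r\}$ for some $r$, such that $f$ is regular on $W\cup\partial W$ and $\partial(W\cap L_I)$ is good, $$F_I=f(\infty)\mathcal I+\frac1{2\pi}\int_{\partial(W\cap L_I)}S^{-1}(s,T)\,ds_I\,f(s).$$ 3. (Independence of $I$.) If $U$ contains the circularization $\bigcup_{x+yJ\in\sigma_S(T)}\{x+yu:\ u\in\mathbb H,\ |u|=1\}$ of $\sigma_S(T)$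 (where $x,y\in\mathbb R$, $J\in\mathbb S$), then $F_I$ is the same operator $f(T)$ for all $I\in\mathbb S$. -/

import Mathlib

open scoped Quaternion Topology MulOpposite

noncomputable section

namespace SCalc

/-! ### Quaternions, slices, slice regular functions -/

/-- The sphere of purely imaginary unit quaternions. -/
def imUnits : Set ℍ[ℝ] := {q | q.re = 0 ∧ ‖q‖ = 1}

/-- The parametrization `x + iy ↦ x + I y` of the complex line `L_I = ℝ + Iℝ` by `ℂ`. -/
def slice (I : ℍ[ℝ]) (z : ℂ) : ℍ[ℝ] := (z.re : ℍ[ℝ]) + z.im • I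

/-- `f` is slice left regular on the set `Ω` (used for open `Ω`): it is real differentiable and
`½ (∂/∂x + I ∂/∂y) f_I (x + I y) = 0` for every imaginary unit `I` and `x + I y ∈ Ω`. The partial
derivatives of `f_I` are the derivatives of `f` in the directions `1` and `I`. -/
def SliceRegularOn (f : ℍ[ℝ] → ℍ[ℝ]) (Ω : Set ℍ[ℝ]) : Prop :=
  (∀ q ∈ Ω, DifferentiableAt ℝ f q) ∧
  ∀ I ∈ imUnits, ∀ z : ℂ, slice I z ∈ Ω →
    (1 / 2 : ℝ) • (fderiv ℝ f (slice I z) 1 + I * fderiv ℝ f (slice I z) I) = 0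

/-- `f` is regular on `W ∪ ∂W`: it is regular on an open set that contains the closure of `W`. -/
def SliceRegularOnClosure (f : ℍ[ℝ] → ℍ[ℝ]) (W : Set ℍ[ℝ]) : Prop :=
  ∃ Ω : Set ℍ[ℝ], IsOpen Ω ∧ closure W ⊆ Ω ∧ SliceRegularOn f Ω

/-- `f` is regular at infinity and `c` is its value `f(∞)` there. -/
def RegularAtInfty (f : ℍ[ℝ] → ℍ[ℝ]) (c : ℍ[ℝ]) : Prop :=
  (∃ r : ℝ, SliceRegularOn f {q | r < ‖q‖}) ∧ Filter.Tendsto f (Bornology.cobounded ℍ[ℝ]) (𝓝 c)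

/-- The circularization `⋃_{x + y I ∈ A} (x + y S³)`, where `S³` is the unit sphere of `ℍ`. -/
def circ (A : Set ℍ[ℝ]) : Set ℍ[ℝ] :=
  {q | ∃ x y : ℝ, ∃ I ∈ imUnits, (x : ℍ[ℝ]) + y • I ∈ A ∧
    ∃ u : ℍ[ℝ], ‖u‖ = 1 ∧ q = (x : ℍ[ℝ]) + y • u}

/-! ### Positively oriented boundaries made of rectifiable Jordan curves -/

/-- A closed rectifiable Jordan curve in the plane, in a Lipschitz parametrization by `[0, 1]`
(for instance the one proportional to arc length, which every such curve has). -/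
structure JordanCurve where
  toFun : ℝ → ℂ
  lipschitz : ∃ K : NNReal, LipschitzOnWith K toFun (Set.Icc 0 1)
  closed : toFun 0 = toFun 1
  simple : Set.InjOn toFun (Set.Ico 0 1)

/-- The trace of the curve. -/
def JordanCurve.trace (γ : JordanCurve) : Set ℂ := γ.toFun '' Set.Icc 0 1

/-- The winding number of the curve about a point `z` off its trace. A Lipschitz curve is
differentiable almost everywhere and the contour integral is the integral against its derivative. -/
def JordanCurve.index (γ : JordanCurve) (z : ℂ) : ℂ :=
  (2 * (Real.pi : ℂ) * Complex.I)⁻¹ * ∫ t in (0 : ℝ)..1, deriv γ.toFun t / (γ.toFun t - z)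

/-- The boundary of the plane open set `D` consists of finitely many rectifiable Jordan curves and
is positively oriented, that is, `D` lies on the left of it: the total winding number is a constant
`c` outside the closure of `D` and `c + 1` in `D`. (If `D` is bounded, this forces `c = 0`; if `D`
is a neighbourhood of infinity that is not dense, it forces `c = -1`.) -/
structure PositiveBoundary (D : Set ℂ) where
  n : ℕ
  curve : Fin n → JordanCurve
  trace_eq : ⋃ j, (curve j).trace = frontier D
  oriented : ∃ c : ℂ, (∀ z ∈ D, ∑ j, (curve j).index z = c + 1) ∧
    ∀ z ∉ closure D, ∑ j, (curve j).index z = c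

/-! ### Operators on a two-sided quaternionic Banach space

Right linear maps are the `ℍᵐᵒᵖ`-linear ones; `V →L[ℍ[ℝ]ᵐᵒᵖ] V` is the space `B(V)`. -/

section operators

variable {V : Type*} [NormedAddCommGroup V] [NormedSpace ℝ V]
  [Module ℍ[ℝ] V] [Module ℍ[ℝ]ᵐᵒᵖ V] [SMulCommClass ℍ[ℝ] ℍ[ℝ]ᵐᵒᵖ V]
  [IsScalarTower ℝ ℍ[ℝ] V] [IsScalarTower ℝ ℍ[ℝ]ᵐᵒᵖ V]
  [IsBoundedSMul ℍ[ℝ] V] [IsBoundedSMul ℍ[ℝ]ᵐᵒᵖ V]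

/-- The operator `a 𝓘 : v ↦ a v`. In `B(V)`, the scalar products are
`a T = (a 𝓘) ∘ T` and `T a = T ∘ (a 𝓘)`. -/
def lmul (a : ℍ[ℝ]) : V →L[ℍ[ℝ]ᵐᵒᵖ] V where
  toFun v := a • v
  map_add' := smul_add a
  map_smul' b v := smul_comm a b v
  cont := continuous_const_smul a

/-! #### Bounded operators -/

/-- `A² - 2 Re[s] A + |s|² 𝓘`. -/
def bddPencil (A : V →L[ℍ[ℝ]ᵐᵒᵖ] V) (s : ℍ[ℝ]) : V →L[ℍ[ℝ]ᵐᵒᵖ] V :=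
  A * A - lmul ((2 * s.re : ℝ) : ℍ[ℝ]) * A + lmul ((‖s‖ ^ 2 : ℝ) : ℍ[ℝ])

/-- The S-spectrum of a bounded operator. -/
def bddSpectrum (A : V →L[ℍ[ℝ]ᵐᵒᵖ] V) : Set ℍ[ℝ] := {s | ¬ IsUnit (bddPencil A s)}

/-- The S-resolvent operator `-(A² - 2 Re[s] A + |s|² 𝓘)⁻¹ (A - s̄ 𝓘)` of a bounded operator. -/
def bddResolvent (A : V →L[ℍ[ℝ]ᵐᵒᵖ] V) (s : ℍ[ℝ]) : V →L[ℍ[ℝ]ᵐᵒᵖ] V :=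
  -(Ring.inverse (bddPencil A s) * (A - lmul (star s)))

/-! #### Unbounded operators -/

/-- The domain of `T²`. -/
def sqDomain (T : V →ₗ.[ℍ[ℝ]ᵐᵒᵖ] V) : Set V :=
  {x | ∃ h : x ∈ T.domain, T ⟨x, h⟩ ∈ T.domain}

/-- A closed right linear operator with dense domain whose square has dense domain. -/
structure IsAdmissible (T : V →ₗ.[ℍ[ℝ]ᵐᵒᵖ] V) : Prop where
  closed : IsClosed (T.graph : Set (V × V))
  dense : Dense (T.domain : Set V)
  dense_sq : Dense (sqDomain T)

/-- `T² - 2 Re[s] T + |s|² 𝓘` on the domain of `T²`. -/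
def pencil (T : V →ₗ.[ℍ[ℝ]ᵐᵒᵖ] V) (s : ℍ[ℝ]) (x : sqDomain T) : V :=
  T ⟨T ⟨x, x.2.choose⟩, x.2.choose_spec⟩ - (2 * s.re) • T ⟨x, x.2.choose⟩ + (‖s‖ ^ 2) • (x : V)

/-- `T² - 2 Re[s] T + |s|² 𝓘` is one-to-one with range `V` and `B` is a bounded operator which on
the domain of `T` is `-(T² - 2 Re[s] T + |s|² 𝓘)⁻¹ (T - s̄ 𝓘)`. -/
def IsSResolvent (T : V →ₗ.[ℍ[ℝ]ᵐᵒᵖ] V) (s : ℍ[ℝ]) (B : V →L[ℍ[ℝ]ᵐᵒᵖ] V) : Prop :=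
  Function.Bijective (pencil T s) ∧
  ∀ x : T.domain, ∃ y : sqDomain T, pencil T s y = T x - star s • (x : V) ∧ B x = -(y : V)

/-- The S-resolvent set. -/
def resolventSet (T : V →ₗ.[ℍ[ℝ]ᵐᵒᵖ] V) : Set ℍ[ℝ] := {s | ∃ B, IsSResolvent T s B}

/-- The S-spectrum. -/
def spectrum (T : V →ₗ.[ℍ[ℝ]ᵐᵒᵖ] V) : Set ℍ[ℝ] := (resolventSet T)ᶜ

open Classical in
/-- The S-resolvent operator `S⁻¹(s, T)` (zero when `s` is not in the S-resolvent set). -/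
def sResolvent (T : V →ₗ.[ℍ[ℝ]ᵐᵒᵖ] V) (s : ℍ[ℝ]) : V →L[ℍ[ℝ]ᵐᵒᵖ] V :=
  if h : ∃ B, IsSResolvent T s B then h.choose else 0

/-- `A = (T - k 𝓘)⁻¹` as a bounded operator. -/
def IsShiftInverse (T : V →ₗ.[ℍ[ℝ]ᵐᵒᵖ] V) (k : ℝ) (A : V →L[ℍ[ℝ]ᵐᵒᵖ] V) : Prop :=
  (∀ v : V, ∃ h : A v ∈ T.domain, T ⟨A v, h⟩ - k • A v = v) ∧
  ∀ x : T.domain, A (T x - k • (x : V)) = x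

/-! #### The integrals and the functional calculus -/

/-- `∫_Γ R(s) ds_I f(s)` for a contour `Γ` in the line `L_I` (read in the coordinate `x + iy`),
with `ds_I = -I ds`. The integral is taken in the Banach space of bounded real linear operators. -/
def contourIntegral (I : ℍ[ℝ]) {D : Set ℂ} (Γ : PositiveBoundary D)
    (R : ℍ[ℝ] → (V →L[ℍ[ℝ]ᵐᵒᵖ] V)) (f : ℍ[ℝ] → ℍ[ℝ]) : V →L[ℝ] V :=
  ∑ j, ∫ t in (0 : ℝ)..1,
    (R (slice I ((Γ.curve j).toFun t)) *
      lmul (-I * slice I (deriv (Γ.curve j).toFun t) * f (slice I ((Γ.curve j).toFun t)))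
        ).restrictScalars ℝ

/-- `F = φ(A)` for a bounded operator `A`, computed on the line `L_I`: there are bounded open sets
`U ⊇ σ_S(A)` on whose closure `φ` is regular and whose slices have boundaries made of finitely many
rectifiable Jordan curves, and for all of them
`F = (1/2π) ∫_{∂(U ∩ L_I)} S⁻¹(p, A) dp_I φ(p)`. -/
def HasCalculus (I : ℍ[ℝ]) (A : V →L[ℍ[ℝ]ᵐᵒᵖ] V) (φ : ℍ[ℝ] → ℍ[ℝ])
    (F : V →L[ℍ[ℝ]ᵐᵒᵖ] V) : Prop :=
  (∃ U : Set ℍ[ℝ], IsOpen U ∧ Bornology.IsBounded U ∧ bddSpectrum A ⊆ U ∧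
    SliceRegularOnClosure φ U ∧ ∀ J ∈ imUnits, Nonempty (PositiveBoundary (slice J ⁻¹' U))) ∧
  ∀ U : Set ℍ[ℝ], IsOpen U → Bornology.IsBounded U → bddSpectrum A ⊆ U →
    SliceRegularOnClosure φ U → ∀ Γ : PositiveBoundary (slice I ⁻¹' U),
    F.restrictScalars ℝ = (2 * Real.pi)⁻¹ • contourIntegral I Γ (bddResolvent A) φ

end operators

/-- The function `φ(p) = f(Φ⁻¹(p))` where `Φ(s) = (s - k)⁻¹`, `Φ(∞) = 0` and `c = f(∞)`. -/
def transport (f : ℍ[ℝ] → ℍ[ℝ]) (c : ℍ[ℝ]) (k : ℝ) (p : ℍ[ℝ]) : ℍ[ℝ] :=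
  open Classical in if p = 0 then c else f (p⁻¹ + (k : ℍ[ℝ]))

end SCalc

end

set_option linter.unusedSectionVars false

noncomputable section

namespace SCalc

open Complex MeasureTheory

/-! ### Integrals along segments and around squares -/

/-! Fix a real `k` in the S-resolvent set. There `T² - 2kT + k²` is `(T - k)²`, and its bijectivity
together with closedness and density produces the bounded inverse `A = (T - k)⁻¹`
(`exists_isShiftInverse`). The substitution `p = (s - k)⁻¹` preserves every line `L_I`, carries the
spectrum of `T` into that of `A` and `∞` to `0`, and turns `f` into `φ_k`. The function `φ_k` is
regular at `0` because the singularity is removable on each slice with an error bound uniform in the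
slice (`hasFDerivAt_of_slices`).

The core is the identity `S⁻¹(p⁻¹ + k, T) = p - S⁻¹(p, A) p²` (`resolventForm_inv`). Together with
`ds = -p⁻² dp` it says that the Cauchy integral of `T` over the image of a contour `γ` around
`σ_S(A) ∪ {0}` equals the integral of `A` over `γ` minus `∫ p⁻¹ dp_I φ_k(p)`, and the latter is `2π
f(∞)` by Cauchy's formula (`sliceIntegral_invAdd`). This is the Cauchy formula. As the integral of
`T` does not mention `k`, independence of `k` follows.

Independence of the contour is Cauchy's theorem. In `R(s) ds_I f(s)` the left factor is holomorphic
for right multiplication by `I` and the right factor for left multiplication by `I`. A real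
functional of the product is therefore the real part of an ordinary holomorphic integrand
(`differentiableOn_scalarForm`). The homology form needed, for contours known only through their
winding numbers, is `Chain.integral_eq_zero`: Cauchy's formula holds on the boundary of a union of
small grid squares, and Fubini turns the integral into one of winding numbers. Unions of grid
squares also supply the required domains, since their boundary edges form a balanced directed graph
and split into simple polygons (`PositiveBoundary.ofGridDomain`). Symmetry under conjugation makes
one plane domain serve all slices.

For independence of `I`, the circularization uses all unit quaternions, so it contains the full
circle in each slice through a spectral point, centred at its real part. This circle meets the real
axis, and the identity principle propagates `f(x + Iy) = α + Iβ` from there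
(`mem_interior_affineSet`). For such `f` the sum of the integrals over `L_I` and `L_{-I}` is free of
`I` (`opIntegral_add_neg_eq`), and the two summands agree because a symmetric contour may be
replaced by its reversed conjugate. -/

/-- The integral of `g` along the segment from `a` to `b`. -/
def edgeInt (g : ℂ → ℂ) (a b : ℂ) : ℂ := ∫ θ in (0 : ℝ)..1, (b - a) * g (a + θ * (b - a))

theorem edgeInt_swap (g : ℂ → ℂ) (a b : ℂ) : edgeInt g b a = -edgeInt g a b := by
  have h := intervalIntegral.integral_comp_sub_left (a := 0) (b := 1)
    (fun θ : ℝ => (b - a) * g (a + θ * (b - a))) 1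
  simp only [sub_self, sub_zero] at h
  rw [edgeInt, edgeInt, ← h, ← intervalIntegral.integral_neg]
  congr 1
  ext θ
  push_cast
  rw [show a + (1 - (θ : ℂ)) * (b - a) = b + θ * (a - b) by ring]
  ring

theorem edgeInt_horizontal (g : ℂ → ℂ) (a : ℂ) (δ : ℝ) :
    edgeInt g a (a + δ) = ∫ x in a.re..a.re + δ, g (x + a.im * I) := by
  have h := intervalIntegral.smul_integral_comp_mul_add (a := 0) (b := 1)
    (fun x : ℝ => g (x + a.im * I)) δ a.re
  simp only [mul_zero, zero_add, mul_one, add_comm δ] at h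
  rw [← h, edgeInt, ← intervalIntegral.integral_smul]
  congr 1
  ext θ
  rw [Complex.real_smul]
  push_cast
  congr 2
  · ring
  · conv_lhs => rw [← Complex.re_add_im a]
    ring

theorem edgeInt_vertical (g : ℂ → ℂ) (a : ℂ) (δ : ℝ) :
    edgeInt g a (a + δ * I) = I • ∫ y in a.im..a.im + δ, g (a.re + y * I) := by
  have h := intervalIntegral.smul_integral_comp_mul_add (a := 0) (b := 1)
    (fun x : ℝ => g (a.re + x * I)) δ a.im
  simp only [mul_zero, zero_add, mul_one, add_comm δ] at h
  rw [← h, edgeInt, ← intervalIntegral.integral_smul, ← intervalIntegral.integral_smul]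
  congr 1
  ext θ
  rw [Complex.real_smul, smul_eq_mul]
  push_cast
  rw [show a + θ * (a + δ * I - a) = a.re + (δ * θ + a.im) * I by
    conv_lhs => rw [← Complex.re_add_im a]
    ring]
  ring

/-- The integral of `g` around the square with lower left corner `a` and side `δ`. -/
def squareInt (g : ℂ → ℂ) (a : ℂ) (δ : ℝ) : ℂ :=
  edgeInt g a (a + δ) + edgeInt g (a + δ) (a + δ + δ * I) +
    edgeInt g (a + δ + δ * I) (a + δ * I) + edgeInt g (a + δ * I) a

/-- The closed square with lower left corner `a` and side `δ`. -/
def closedSquare (a : ℂ) (δ : ℝ) : Set ℂ := Set.Icc a.re (a.re + δ) ×ℂ Set.Icc a.im (a.im + δ)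

/-- The open square with lower left corner `a` and side `δ`. -/
def openSquare (a : ℂ) (δ : ℝ) : Set ℂ := Set.Ioo a.re (a.re + δ) ×ℂ Set.Ioo a.im (a.im + δ)

theorem squareInt_eq_zero {g : ℂ → ℂ} {a : ℂ} {δ : ℝ} (hδ : 0 < δ)
    (hg : DifferentiableOn ℂ g (closedSquare a δ)) : squareInt g a δ = 0 := by
  have h := Complex.integral_boundary_rect_eq_zero_of_differentiableOn g a (a + δ + δ * I) (by
    simpa [Set.uIcc_of_le, hδ.le, closedSquare] using hg)
  rw [squareInt, edgeInt_swap g (a + δ * I) (a + δ + δ * I), edgeInt_swap g a (a + δ * I),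
    edgeInt_vertical, edgeInt_vertical, edgeInt_horizontal,
    show a + δ + δ * I = a + δ * I + δ by ring, edgeInt_horizontal]
  rw [← h]
  simp
  ring

/-- The half plane `Re (uζ) > 0` is convex and contains the whole segment, so `log (uζ)` is a
primitive of `ζ⁻¹` there. The factor `u` rotates the branch cut out of the way. -/
theorem edgeInt_inv {a b u : ℂ} (ha : 0 < (u * a).re) (hb : 0 < (u * b).re) :
    edgeInt (fun ζ => ζ⁻¹) a b = log (u * b) - log (u * a) := by
  have hu : u ≠ 0 := by rintro rfl; simp at ha
  have key : ∀ θ ∈ Set.uIcc (0 : ℝ) 1, u * (a + θ * (b - a)) ∈ slitPlane := by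
    intro θ hθ
    rw [Set.uIcc_of_le zero_le_one] at hθ
    left
    have : (u * (a + θ * (b - a))).re = (1 - θ) * (u * a).re + θ * (u * b).re := by
      simp [Complex.mul_re, Complex.mul_im]; ring
    rw [this]
    rcases hθ.1.eq_or_lt with h | h
    · simpa [← h] using ha
    · have := mul_pos h hb
      have := mul_nonneg (sub_nonneg.2 hθ.2) ha.le
      linarith
  have hd : ∀ θ ∈ Set.uIcc (0 : ℝ) 1,
      HasDerivAt (fun θ : ℝ => log (u * (a + θ * (b - a)))) ((b - a) * (a + θ * (b - a))⁻¹) θ := by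
    intro θ hθ
    have h1 : HasDerivAt (fun θ : ℝ => u * (a + (θ : ℂ) * (b - a))) (u * (1 * (b - a))) θ :=
      (((Complex.ofRealCLM.hasDerivAt (x := θ)).mul_const (b - a)).const_add a).const_mul u
    convert h1.clog_real (key θ hθ) using 1
    rw [one_mul, mul_div_mul_left _ _ hu, div_eq_mul_inv]
  rw [edgeInt, intervalIntegral.integral_eq_sub_of_hasDerivAt hd]
  · simp
  · apply ContinuousOn.intervalIntegrable
    refine continuousOn_const.mul (ContinuousOn.inv₀ (by fun_prop) ?_)
    intro θ hθ h0
    have := slitPlane_ne_zero (key θ hθ)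
    simp [h0] at this

/-- Turning a point of the open first quadrant by `-π/2` does not cross the branch cut. This is the
jump between the two logarithms used at a corner of a square. -/
theorem log_sub_log_neg_I_mul {z : ℂ} (h1 : 0 < z.re) (h2 : 0 < z.im) :
    log z - log (-I * z) = Real.pi / 2 * I := by
  have hz : z ≠ 0 := by rintro rfl; simp at h1
  have h3 : 0 < z.arg ∧ z.arg ≤ Real.pi / 2 := by
    refine ⟨lt_of_le_of_ne (Complex.arg_nonneg_iff.2 h2.le) ?_,
      (Complex.abs_arg_le_pi_div_two_iff.2 h1.le |> abs_le.1).2⟩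
    intro h
    have := (Complex.arg_eq_zero_iff (z := z)).1 h.symm
    linarith [this.2]
  have := Real.pi_pos
  rw [Complex.log_mul (by simp) hz, Complex.log_neg_I]
  · ring
  · rw [Complex.arg_neg_I]
    constructor <;> linarith [h3.1, h3.2]

theorem edgeInt_comp_sub (g : ℂ → ℂ) (a b w : ℂ) :
    edgeInt (fun ζ => g (ζ - w)) a b = edgeInt g (a - w) (b - w) := by
  simp only [edgeInt, sub_sub_sub_cancel_right]
  congr 1
  ext θ
  congr 2
  ring

/-- Seen from `w`, each side lies in one half plane and has its own rotated logarithm as primitive.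
At each of the four corners consecutive branches differ by `πi/2`, and these jumps add up to `2πi`.
-/
theorem squareInt_inv_sub {a w : ℂ} {δ : ℝ} (hw : w ∈ openSquare a δ) :
    squareInt (fun ζ => (ζ - w)⁻¹) a δ = 2 * Real.pi * I := by
  obtain ⟨⟨h1, h2⟩, h3, h4⟩ := hw
  have e := fun p q => edgeInt_comp_sub (fun ζ => ζ⁻¹) p q w
  rw [squareInt, e, e, e, e]
  rw [edgeInt_inv (u := I) (by simp; linarith) (by simp; linarith),
    edgeInt_inv (u := 1) (by simp; linarith) (by simp; linarith),
    edgeInt_inv (u := -I) (by simp; linarith) (by simp; linarith),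
    edgeInt_inv (u := -1) (by simp; linarith) (by simp; linarith)]
  have c1 := log_sub_log_neg_I_mul (z := I * (a + δ - w)) (by simp; linarith) (by simp; linarith)
  have c2 := log_sub_log_neg_I_mul (z := 1 * (a + δ + δ * I - w)) (by simp; linarith)
    (by simp; linarith)
  have c3 := log_sub_log_neg_I_mul (z := -I * (a + δ * I - w)) (by simp; linarith)
    (by simp; linarith)
  have c4 := log_sub_log_neg_I_mul (z := -1 * (a - w)) (by simp; linarith) (by simp; linarith)
  rw [show -I * (I * (a + δ - w)) = 1 * (a + δ - w) by rw [← mul_assoc]; simp] at c1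
  rw [show -I * (1 * (a + δ + δ * I - w)) = -I * (a + δ + δ * I - w) by ring] at c2
  rw [show -I * (-I * (a + δ * I - w)) = -1 * (a + δ * I - w) by rw [← mul_assoc]; simp] at c3
  rw [show -I * (-1 * (a - w)) = I * (a - w) by ring] at c4
  linear_combination c1 + c2 + c3 + c4

theorem edgeInt_sub {g h : ℂ → ℂ} {a b : ℂ} (hg : ContinuousOn g (segment ℝ a b))
    (hh : ContinuousOn h (segment ℝ a b)) :
    edgeInt (fun ζ => g ζ - h ζ) a b = edgeInt g a b - edgeInt h a b := by
  have key : ∀ {g : ℂ → ℂ}, ContinuousOn g (segment ℝ a b) →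
      IntervalIntegrable (fun θ : ℝ => (b - a) * g (a + θ * (b - a))) volume 0 1 := by
    intro g hg
    apply ContinuousOn.intervalIntegrable
    refine continuousOn_const.mul (hg.comp (by fun_prop) ?_)
    intro θ hθ
    rw [Set.uIcc_of_le zero_le_one] at hθ
    rw [segment_eq_image']
    exact ⟨θ, hθ, by simp⟩
  rw [edgeInt, edgeInt, edgeInt, ← intervalIntegral.integral_sub (key hg) (key hh)]
  congr 1
  ext θ
  ring

theorem edgeInt_const_mul (k : ℂ) (g : ℂ → ℂ) (a b : ℂ) :
    edgeInt (fun ζ => k * g ζ) a b = k * edgeInt g a b := by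
  rw [edgeInt, edgeInt, ← intervalIntegral.integral_const_mul]
  congr 1
  ext θ
  ring

end SCalc

namespace SCalc

open Complex MeasureTheory

/-! ### Cauchy's formula on a grid -/

theorem edgeInt_congr {g h : ℂ → ℂ} {a b : ℂ} (H : Set.EqOn g h (segment ℝ a b)) :
    edgeInt g a b = edgeInt h a b := by
  apply intervalIntegral.integral_congr
  intro θ hθ
  rw [Set.uIcc_of_le zero_le_one] at hθ
  simp only
  rw [H (by rw [segment_eq_image']; exact ⟨θ, hθ, by simp⟩)]

/-- Dominated convergence: points near `w` stay at distance at least `ε/2` from the segment. Needed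
to reach points on grid lines and to integrate in `w`. -/
theorem continuousAt_edgeInt {h : ℂ → ℂ} {a b w : ℂ} (hh : ContinuousOn h (segment ℝ a b))
    (hw : w ∉ segment ℝ a b) :
    ContinuousAt (fun w => edgeInt (fun ζ => h ζ * (ζ - w)⁻¹) a b) w := by
  have hseg : ∀ θ ∈ Set.Icc (0 : ℝ) 1, a + θ * (b - a) ∈ segment ℝ a b := fun θ hθ => by
    rw [segment_eq_image']; exact ⟨θ, hθ, by simp⟩
  have hcomp : IsCompact (segment ℝ a b) := by
    rw [segment_eq_image']
    exact isCompact_Icc.image (by fun_prop)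
  obtain ⟨M, hM⟩ := hcomp.exists_bound_of_continuousOn hh
  obtain ⟨ε, hε, hball⟩ := Metric.isOpen_iff.1 hcomp.isClosed.isOpen_compl w hw
  have hfar : ∀ w' ∈ Metric.ball w (ε / 2), ∀ ζ ∈ segment ℝ a b, ε / 2 ≤ ‖ζ - w'‖ := by
    intro w' hw' ζ hζ
    by_contra hlt
    push Not at hlt
    refine hball (a := ζ) ?_ hζ
    rw [Metric.mem_ball] at hw' ⊢
    rw [← dist_eq_norm] at hlt
    linarith [dist_triangle ζ w' w]
  have hne : ∀ w' ∈ Metric.ball w (ε / 2), ∀ ζ ∈ segment ℝ a b, ζ - w' ≠ 0 := by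
    intro w' hw' ζ hζ h0
    have := hfar w' hw' ζ hζ
    rw [h0, norm_zero] at this
    linarith
  refine intervalIntegral.continuousAt_of_dominated_interval
    (bound := fun _ => ‖b - a‖ * (M * (ε / 2)⁻¹)) ?_ ?_ ?_ ?_
  · filter_upwards [Metric.ball_mem_nhds w (half_pos hε)] with w' hw'
    refine ContinuousOn.aestronglyMeasurable ?_ measurableSet_uIoc
    rw [Set.uIoc_of_le zero_le_one]
    have hm : Set.MapsTo (fun θ : ℝ => a + (θ : ℂ) * (b - a)) (Set.Ioc 0 1) (segment ℝ a b) :=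
      fun θ hθ => hseg θ (Set.Ioc_subset_Icc_self hθ)
    refine continuousOn_const.mul ((hh.comp (by fun_prop) hm).mul
      (ContinuousOn.inv₀ (by fun_prop) ?_))
    intro θ hθ
    exact hne w' hw' _ (hm hθ)
  · filter_upwards [Metric.ball_mem_nhds w (half_pos hε)] with w' hw'
    refine Filter.Eventually.of_forall fun θ hθ => ?_
    rw [Set.uIoc_of_le zero_le_one] at hθ
    have hm := hseg θ (Set.Ioc_subset_Icc_self hθ)
    rw [norm_mul, norm_mul, norm_inv]
    have h1 := hM _ hm
    have h2 := inv_anti₀ (half_pos hε) (hfar w' hw' _ hm)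
    gcongr
    exact (norm_nonneg _).trans h1
  · exact intervalIntegrable_const
  · refine Filter.Eventually.of_forall fun θ hθ => ?_
    rw [Set.uIoc_of_le zero_le_one] at hθ
    have hm := hseg θ (Set.Ioc_subset_Icc_self hθ)
    refine continuousAt_const.mul (continuousAt_const.mul (ContinuousAt.inv₀ (by fun_prop) ?_))
    exact hne w (Metric.mem_ball_self (half_pos hε)) _ hm

/-- The point of the grid of mesh `δ` with integer coordinates `P`. -/
def gridPt (δ : ℝ) (P : ℤ × ℤ) : ℂ := ⟨δ * P.1, δ * P.2⟩

/-- The closed square of the grid of mesh `δ` with lower left corner `P`. -/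
def gridSquare (δ : ℝ) (P : ℤ × ℤ) : Set ℂ := closedSquare (gridPt δ P) δ

theorem mem_gridSquare {δ : ℝ} {P : ℤ × ℤ} {z : ℂ} : z ∈ gridSquare δ P ↔
    (δ * P.1 ≤ z.re ∧ z.re ≤ δ * P.1 + δ) ∧ (δ * P.2 ≤ z.im ∧ z.im ≤ δ * P.2 + δ) := Iff.rfl

theorem mem_openSquare_gridPt {δ : ℝ} {P : ℤ × ℤ} {z : ℂ} : z ∈ openSquare (gridPt δ P) δ ↔
    (δ * P.1 < z.re ∧ z.re < δ * P.1 + δ) ∧ (δ * P.2 < z.im ∧ z.im < δ * P.2 + δ) := Iff.rfl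

/-- The sides of a grid square, directed counterclockwise. -/
def ccwEdges (P : ℤ × ℤ) : Finset ((ℤ × ℤ) × (ℤ × ℤ)) :=
  {((P.1, P.2), (P.1 + 1, P.2)), ((P.1 + 1, P.2), (P.1 + 1, P.2 + 1)),
    ((P.1 + 1, P.2 + 1), (P.1, P.2 + 1)), ((P.1, P.2 + 1), (P.1, P.2))}

theorem mem_ccwEdges {P : ℤ × ℤ} {e : (ℤ × ℤ) × (ℤ × ℤ)} : e ∈ ccwEdges P ↔
    e = ((P.1, P.2), (P.1 + 1, P.2)) ∨ e = ((P.1 + 1, P.2), (P.1 + 1, P.2 + 1)) ∨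
    e = ((P.1 + 1, P.2 + 1), (P.1, P.2 + 1)) ∨ e = ((P.1, P.2 + 1), (P.1, P.2)) := by
  simp [ccwEdges]

theorem sum_ccwEdges {M : Type*} [AddCommMonoid M] (G : (ℤ × ℤ) × (ℤ × ℤ) → M) (P : ℤ × ℤ) :
    ∑ e ∈ ccwEdges P, G e = G ((P.1, P.2), (P.1 + 1, P.2)) +
      G ((P.1 + 1, P.2), (P.1 + 1, P.2 + 1)) + G ((P.1 + 1, P.2 + 1), (P.1, P.2 + 1)) +
      G ((P.1, P.2 + 1), (P.1, P.2)) := by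
  obtain ⟨p, p'⟩ := P
  rw [ccwEdges, Finset.sum_insert (by simp), Finset.sum_insert (by simp),
    Finset.sum_insert (by simp), Finset.sum_singleton]
  abel

/-- A directed edge has exactly one square on its left, so a sum over squares of their sides is a
sum over edges without repetition. -/
theorem ccwEdges_disjoint {P Q : ℤ × ℤ} {e : (ℤ × ℤ) × (ℤ × ℤ)} (hP : e ∈ ccwEdges P)
    (hQ : e ∈ ccwEdges Q) : P = Q := by
  obtain ⟨⟨a, b⟩, c, d⟩ := e
  obtain ⟨p, p'⟩ := P
  obtain ⟨q, q'⟩ := Q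
  simp only [mem_ccwEdges, Prod.mk.injEq] at *
  omega

theorem exists_swap_mem_ccwEdges {P : ℤ × ℤ} {e : (ℤ × ℤ) × (ℤ × ℤ)} (hP : e ∈ ccwEdges P) :
    ∃ Q, e.swap ∈ ccwEdges Q := by
  obtain ⟨p, p'⟩ := P
  rcases mem_ccwEdges.1 hP with rfl | rfl | rfl | rfl
  · exact ⟨(p, p' - 1), by simp [mem_ccwEdges]⟩
  · exact ⟨(p + 1, p'), by simp [mem_ccwEdges]⟩
  · exact ⟨(p, p' + 1), by simp [mem_ccwEdges]⟩
  · exact ⟨(p - 1, p'), by simp [mem_ccwEdges]⟩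

/-- All sides of the squares in `S`, directed counterclockwise. -/
def allEdges (S : Finset (ℤ × ℤ)) : Finset ((ℤ × ℤ) × (ℤ × ℤ)) := S.biUnion ccwEdges

/-- The directed boundary edges of the union of the squares in `S`. -/
def bdryEdges (S : Finset (ℤ × ℤ)) : Finset ((ℤ × ℤ) × (ℤ × ℤ)) :=
  (allEdges S).filter fun e => e.swap ∉ allEdges S

/-- A side shared by two squares of `S` occurs in both directions, and the two contributions cancel
under the involution `swap`. -/
theorem sum_bdryEdges {M : Type*} [AddCommGroup M] (S : Finset (ℤ × ℤ))
    (G : (ℤ × ℤ) × (ℤ × ℤ) → M) (hG : ∀ e, G e.swap = -G e) :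
    ∑ e ∈ bdryEdges S, G e = ∑ P ∈ S, ∑ e ∈ ccwEdges P, G e := by
  rw [← Finset.sum_biUnion (fun P _ Q _ hPQ => Finset.disjoint_left.2 fun e he he' =>
    hPQ (ccwEdges_disjoint he he'))]
  change _ = ∑ e ∈ allEdges S, G e
  rw [← Finset.sum_filter_add_sum_filter_not (allEdges S) (fun e => e.swap ∉ allEdges S)]
  rw [bdryEdges, left_eq_add]
  refine Finset.sum_involution (fun e _ => e.swap) ?_ ?_ ?_ ?_
  · intro e _
    rw [hG]; abel
  · intro e he _ h
    simp only [Finset.mem_filter, allEdges, Finset.mem_biUnion] at he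
    obtain ⟨⟨P, -, hP⟩, -⟩ := he
    obtain ⟨p, p'⟩ := P
    rcases mem_ccwEdges.1 hP with rfl | rfl | rfl | rfl <;> simp at h
  · intro e he
    simp only [Finset.mem_filter, not_not, Prod.swap_swap] at he ⊢
    exact he.symm
  · intro e _
    simp

theorem exists_of_mem_bdryEdges {S : Finset (ℤ × ℤ)} {e : (ℤ × ℤ) × (ℤ × ℤ)}
    (he : e ∈ bdryEdges S) :
    (∃ P ∈ S, e ∈ ccwEdges P) ∧ ∃ Q ∉ S, e.swap ∈ ccwEdges Q := by
  simp only [bdryEdges, Finset.mem_filter, allEdges, Finset.mem_biUnion, not_exists, not_and] at he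
  obtain ⟨⟨P, hP, heP⟩, h⟩ := he
  obtain ⟨Q, hQ⟩ := exists_swap_mem_ccwEdges heP
  exact ⟨⟨P, hP, heP⟩, Q, fun hQS => h Q hQS hQ, hQ⟩

theorem mem_bdryEdges_of {S : Finset (ℤ × ℤ)} {e : (ℤ × ℤ) × (ℤ × ℤ)} {P Q : ℤ × ℤ}
    (hP : P ∈ S) (hQ : Q ∉ S) (heP : e ∈ ccwEdges P) (heQ : e.swap ∈ ccwEdges Q) :
    e ∈ bdryEdges S := by
  simp only [bdryEdges, Finset.mem_filter, allEdges, Finset.mem_biUnion, not_exists, not_and]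
  exact ⟨⟨P, hP, heP⟩, fun R hR h => hQ (ccwEdges_disjoint heQ h ▸ hR)⟩

/-- The segment of the plane that belongs to a grid edge. -/
def gridSeg (δ : ℝ) (e : (ℤ × ℤ) × (ℤ × ℤ)) : Set ℂ := segment ℝ (gridPt δ e.1) (gridPt δ e.2)

theorem gridSeg_swap (δ : ℝ) (e : (ℤ × ℤ) × (ℤ × ℤ)) : gridSeg δ e.swap = gridSeg δ e :=
  segment_symm _ _ _

theorem convex_closedSquare (a : ℂ) (δ : ℝ) : Convex ℝ (closedSquare a δ) :=
  ((convex_Icc _ _).linear_preimage reLm).inter ((convex_Icc _ _).linear_preimage imLm)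

theorem gridSeg_subset {δ : ℝ} (hδ : 0 < δ) {P : ℤ × ℤ} {e : (ℤ × ℤ) × (ℤ × ℤ)}
    (he : e ∈ ccwEdges P) : gridSeg δ e ⊆ gridSquare δ P := by
  refine (convex_closedSquare _ _).segment_subset ?_ ?_ <;>
  · change _ ∈ gridSquare δ P
    rcases mem_ccwEdges.1 he with rfl | rfl | rfl | rfl <;>
    · simp only [mem_gridSquare, gridPt]
      push_cast
      constructor <;> constructor <;> linarith

theorem eq_of_mem_open_closed {δ : ℝ} (hδ : 0 < δ) {P Q : ℤ × ℤ} {z : ℂ}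
    (h1 : z ∈ openSquare (gridPt δ P) δ) (h2 : z ∈ gridSquare δ Q) : P = Q := by
  rw [mem_openSquare_gridPt] at h1
  rw [mem_gridSquare] at h2
  obtain ⟨⟨a1, a2⟩, a3, a4⟩ := h1
  obtain ⟨⟨b1, b2⟩, b3, b4⟩ := h2
  have key : ∀ m n : ℤ, δ * m < δ * n + δ → m ≤ n := by
    intro m n h
    have : (m : ℝ) < n + 1 := by
      by_contra hc
      push Not at hc
      nlinarith
    have : m < n + 1 := by exact_mod_cast this
    omega
  have k1 := key P.1 Q.1 (by linarith)
  have k2 := key Q.1 P.1 (by linarith)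
  have k3 := key P.2 Q.2 (by linarith)
  have k4 := key Q.2 P.2 (by linarith)
  ext <;> omega

theorem exists_gridSquare {δ : ℝ} (hδ : 0 < δ) (z : ℂ) : ∃ P, z ∈ gridSquare δ P := by
  refine ⟨(⌊z.re / δ⌋, ⌊z.im / δ⌋), ?_⟩
  rw [mem_gridSquare]
  have key : ∀ x : ℝ, δ * ⌊x / δ⌋ ≤ x ∧ x ≤ δ * ⌊x / δ⌋ + δ := by
    intro x
    have h1 := Int.floor_le (x / δ)
    have h2 := Int.lt_floor_add_one (x / δ)
    rw [le_div_iff₀ hδ] at h1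
    rw [div_lt_iff₀ hδ] at h2
    constructor <;> linarith
  exact ⟨key _, key _⟩

theorem squareInt_grid (g : ℂ → ℂ) (δ : ℝ) (P : ℤ × ℤ) :
    ∑ e ∈ ccwEdges P, edgeInt g (gridPt δ e.1) (gridPt δ e.2) = squareInt g (gridPt δ P) δ := by
  rw [sum_ccwEdges, squareInt]
  have e0 : gridPt δ (P.1, P.2) = gridPt δ P := rfl
  have e1 : gridPt δ (P.1 + 1, P.2) = gridPt δ P + δ := by
    apply Complex.ext <;> simp [gridPt]; ring
  have e2 : gridPt δ (P.1 + 1, P.2 + 1) = gridPt δ P + δ + δ * I := by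
    apply Complex.ext <;> simp [gridPt] <;> ring
  have e3 : gridPt δ (P.1, P.2 + 1) = gridPt δ P + δ * I := by
    apply Complex.ext <;> simp [gridPt]; ring
  rw [e0, e1, e2, e3]

/-- The interior of the union of the closed squares in `S`. -/
def gridDomain (δ : ℝ) (S : Finset (ℤ × ℤ)) : Set ℂ := {z | ∀ P, z ∈ gridSquare δ P → P ∈ S}

theorem gridSeg_disjoint_gridDomain {δ : ℝ} (hδ : 0 < δ) {S : Finset (ℤ × ℤ)}
    {e : (ℤ × ℤ) × (ℤ × ℤ)} (he : e ∈ bdryEdges S) {z : ℂ} (hz : z ∈ gridSeg δ e) :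
    z ∉ gridDomain δ S := by
  obtain ⟨-, Q, hQ, heQ⟩ := exists_of_mem_bdryEdges he
  intro h
  refine hQ (h Q (gridSeg_subset hδ heQ ?_))
  rwa [gridSeg_swap]

/-- The difference quotient `dslope h w` is holomorphic also at `w`, so its integral vanishes.
Splitting it on the sides, which avoid `w`, leaves `h w` times the winding integral. -/
theorem squareInt_cauchy {a w : ℂ} {δ : ℝ} (hδ : 0 < δ) (hw : w ∈ openSquare a δ) {Ω : Set ℂ}
    (hΩ : IsOpen Ω) (hs : closedSquare a δ ⊆ Ω) {h : ℂ → ℂ} (hh : DifferentiableOn ℂ h Ω) :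
    squareInt (fun ζ => h ζ * (ζ - w)⁻¹) a δ = 2 * Real.pi * I * h w := by
  have hwc : w ∈ closedSquare a δ :=
    ⟨Set.Ioo_subset_Icc_self hw.1, Set.Ioo_subset_Icc_self hw.2⟩
  have hd : DifferentiableOn ℂ (dslope h w) (closedSquare a δ) :=
    ((Complex.differentiableOn_dslope (hΩ.mem_nhds (hs hwc))).2 hh).mono hs
  have h0 := squareInt_eq_zero hδ hd
  have key : ∀ p ∈ closedSquare a δ, ∀ q ∈ closedSquare a δ, w ∉ segment ℝ p q →
      edgeInt (dslope h w) p q = edgeInt (fun ζ => h ζ * (ζ - w)⁻¹) p q -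
        h w * edgeInt (fun ζ => (ζ - w)⁻¹) p q := by
    intro p hp q hq hwpq
    have hsub := (convex_closedSquare a δ).segment_subset hp hq
    have hinv : ContinuousOn (fun ζ => (ζ - w)⁻¹) (segment ℝ p q) :=
      ContinuousOn.inv₀ (by fun_prop) fun ζ hζ h0 => hwpq (by rwa [sub_eq_zero.1 h0] at hζ)
    have hsub := edgeInt_sub (g := fun ζ => h ζ * (ζ - w)⁻¹) (h := fun ζ => h w * (ζ - w)⁻¹)
      ((hh.continuousOn.mono (hsub.trans hs)).mul hinv) (continuousOn_const.mul hinv)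
    rw [← edgeInt_const_mul, ← hsub]
    refine edgeInt_congr fun ζ hζ => ?_
    have hne : ζ ≠ w := by rintro rfl; exact hwpq hζ
    rw [dslope_of_ne _ hne, slope_def_field]
    ring
  obtain ⟨⟨w1, w2⟩, w3, w4⟩ := hw
  -- A side is contained in a level line of `re` or `im`, which the interior point `w` misses.
  have side : ∀ (p q : ℂ) (l : ℂ →ₗ[ℝ] ℝ), l p = l q → l w ≠ l p → w ∉ segment ℝ p q := by
    rintro p q l h1 h2 ⟨s, t, hs, ht, hst, rfl⟩
    apply h2
    rw [map_add, map_smul, map_smul, ← h1, ← add_smul, hst, one_smul]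
  have hm0 : a ∈ closedSquare a δ := by
    refine ⟨?_, ?_⟩ <;> simp [hδ.le]
  have hm1 : a + δ ∈ closedSquare a δ := by
    refine ⟨?_, ?_⟩ <;> simp [hδ.le]
  have hm2 : a + δ + δ * I ∈ closedSquare a δ := by
    refine ⟨?_, ?_⟩ <;> simp [hδ.le]
  have hm3 : a + δ * I ∈ closedSquare a δ := by
    refine ⟨?_, ?_⟩ <;> simp [hδ.le]
  have hidx := squareInt_inv_sub ⟨⟨w1, w2⟩, w3, w4⟩
  rw [squareInt] at h0 hidx ⊢
  rw [key _ hm0 _ hm1 (side _ _ imLm (by simp) (by simp; linarith)),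
    key _ hm1 _ hm2 (side _ _ reLm (by simp) (by simp; linarith)),
    key _ hm2 _ hm3 (side _ _ imLm (by simp) (by simp; linarith)),
    key _ hm3 _ hm0 (side _ _ reLm (by simp) (by simp; linarith))] at h0
  linear_combination h0 + h w * hidx

theorem sum_edgeInt_eq_zero {δ : ℝ} (hδ : 0 < δ) {S : Finset (ℤ × ℤ)} {g : ℂ → ℂ}
    (hg : ∀ P ∈ S, DifferentiableOn ℂ g (gridSquare δ P)) :
    ∑ e ∈ bdryEdges S, edgeInt g (gridPt δ e.1) (gridPt δ e.2) = 0 := by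
  rw [sum_bdryEdges S (fun e => edgeInt g (gridPt δ e.1) (gridPt δ e.2))
    (fun e => edgeInt_swap _ _ _)]
  refine Finset.sum_eq_zero fun P hP => ?_
  rw [squareInt_grid]
  exact squareInt_eq_zero hδ (hg P hP)

/-- **Cauchy's formula** for the boundary of a union of grid squares. -/
theorem sum_edgeInt_cauchy {δ : ℝ} (hδ : 0 < δ) {S : Finset (ℤ × ℤ)} {Ω : Set ℂ}
    (hΩ : IsOpen Ω) (hs : ∀ P ∈ S, gridSquare δ P ⊆ Ω) {h : ℂ → ℂ} (hh : DifferentiableOn ℂ h Ω)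
    {w : ℂ} (hw : w ∈ gridDomain δ S) :
    ∑ e ∈ bdryEdges S, edgeInt (fun ζ => h ζ * (ζ - w)⁻¹) (gridPt δ e.1) (gridPt δ e.2) =
      2 * Real.pi * I * h w := by
  have hopen : ∀ P ∈ S, ∀ w ∈ openSquare (gridPt δ P) δ,
      ∑ e ∈ bdryEdges S, edgeInt (fun ζ => h ζ * (ζ - w)⁻¹) (gridPt δ e.1) (gridPt δ e.2) =
      2 * Real.pi * I * h w := by
    intro P hP w hw
    rw [sum_bdryEdges S (fun e => edgeInt (fun ζ => h ζ * (ζ - w)⁻¹) (gridPt δ e.1) (gridPt δ e.2))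
      (fun e => edgeInt_swap _ _ _), Finset.sum_eq_single P]
    · rw [squareInt_grid, squareInt_cauchy hδ hw hΩ (hs P hP) hh]
    · intro Q hQ hQP
      rw [squareInt_grid]
      refine squareInt_eq_zero hδ ((hh.mono (hs Q hQ)).mul (DifferentiableOn.inv (by fun_prop) ?_))
      intro ζ hζ h0
      rw [sub_eq_zero.1 h0] at hζ
      exact hQP (eq_of_mem_open_closed hδ hw hζ).symm
    · exact fun h => absurd hP h
  obtain ⟨P, hwP⟩ := exists_gridSquare hδ w
  have hP := hw P hwP
  -- A point of the domain may lie on an inner grid line. The centre `c` of an adjoining square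
  -- gives a path `w + t(c - w)` inside the open square, along which the formula passes to the
  -- limit.
  set c : ℂ := ⟨δ * P.1 + δ / 2, δ * P.2 + δ / 2⟩ with hc
  set u : ℝ → ℂ := fun t => w + t * (c - w) with hu
  have hut : Filter.Tendsto u (𝓝[>] 0) (𝓝 w) := by
    have : ContinuousAt u 0 := by fun_prop
    have h2 := this.tendsto
    simp only [hu, ofReal_zero, zero_mul, add_zero] at h2
    exact h2.mono_left nhdsWithin_le_nhds
  have huo : ∀ᶠ t in 𝓝[>] (0 : ℝ), u t ∈ openSquare (gridPt δ P) δ := by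
    filter_upwards [Ioo_mem_nhdsGT (zero_lt_one)] with t ht
    rw [mem_openSquare_gridPt]
    rw [mem_gridSquare] at hwP
    obtain ⟨⟨a1, a2⟩, a3, a4⟩ := hwP
    simp only [hu, hc, add_re, mul_re, sub_re, ofReal_re, ofReal_im, zero_mul, sub_zero, add_im,
      mul_im, add_zero, sub_im]
    obtain ⟨t0, t1⟩ := ht
    refine ⟨⟨?_, ?_⟩, ?_, ?_⟩ <;> nlinarith
  have hcont : ContinuousAt (fun w => ∑ e ∈ bdryEdges S,
      edgeInt (fun ζ => h ζ * (ζ - w)⁻¹) (gridPt δ e.1) (gridPt δ e.2)) w := by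
    refine tendsto_finsetSum _ fun e he => ?_
    refine (continuousAt_edgeInt (hh.continuousOn.mono ?_)
      fun hwe => gridSeg_disjoint_gridDomain hδ he hwe hw).tendsto
    obtain ⟨⟨Q, hQ, heQ⟩, -⟩ := exists_of_mem_bdryEdges he
    exact (gridSeg_subset hδ heQ).trans (hs Q hQ)
  have hcont2 : ContinuousAt (fun w => 2 * Real.pi * I * h w) w :=
    continuousAt_const.mul (hh.continuousOn.continuousAt (hΩ.mem_nhds (hs P hP hwP)))
  refine tendsto_nhds_unique (hcont.tendsto.comp hut) ((hcont2.tendsto.comp hut).congr' ?_)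
  filter_upwards [huo] with t ht
  exact (hopen P hP _ ht).symm

end SCalc

namespace SCalc

open Complex MeasureTheory

/-! ### Grids adapted to a compact set -/

theorem finite_gridSquare_inter {δ : ℝ} (hδ : 0 < δ) {L : Set ℂ} (hL : Bornology.IsBounded L) :
    {P : ℤ × ℤ | (gridSquare δ P ∩ L).Nonempty}.Finite := by
  obtain ⟨M, hM⟩ := hL.exists_norm_le
  set N : ℤ := ⌈(M + δ) / δ⌉ with hN
  have hN' : M + δ ≤ δ * N := by
    have := Int.le_ceil ((M + δ) / δ)
    rw [div_le_iff₀ hδ] at this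
    linarith
  refine (Set.finite_Icc ((-N, -N) : ℤ × ℤ) (N, N)).subset ?_
  rintro P ⟨z, hz, hzL⟩
  have h1 := (abs_le.1 ((Complex.abs_re_le_norm z).trans (hM z hzL)))
  have h2 := (abs_le.1 ((Complex.abs_im_le_norm z).trans (hM z hzL)))
  rw [mem_gridSquare] at hz
  obtain ⟨⟨a1, a2⟩, a3, a4⟩ := hz
  have key : ∀ m n : ℤ, δ * m ≤ δ * n → m ≤ n := by
    intro m n h
    have := le_of_mul_le_mul_left h hδ
    exact_mod_cast this
  refine ⟨⟨key _ _ ?_, key _ _ ?_⟩, key _ _ ?_, key _ _ ?_⟩ <;> push_cast <;> linarith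

theorem exists_grid {L Ω : Set ℂ} (hL : IsCompact L) (hΩ : IsOpen Ω) (hLΩ : L ⊆ Ω) :
    ∃ δ : ℝ, 0 < δ ∧ ∃ S : Finset (ℤ × ℤ), (∀ P, P ∈ S ↔ (gridSquare δ P ∩ L).Nonempty) ∧
      ∀ P ∈ S, gridSquare δ P ⊆ Ω := by
  obtain ⟨ε, hε, hth⟩ := hL.exists_thickening_subset_open hΩ hLΩ
  -- Two points of one square differ by at most `δ` in each coordinate, hence by at most `2δ < ε` in
  -- norm.
  set δ := ε / 3 with hδdef
  have hδ : 0 < δ := by positivity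
  refine ⟨δ, hδ, (finite_gridSquare_inter hδ hL.isBounded).toFinset, fun P => by simp, ?_⟩
  intro P hP w hw
  simp only [Set.Finite.mem_toFinset, Set.mem_ofPred_eq] at hP
  obtain ⟨z, hz, hzL⟩ := hP
  apply hth
  rw [Metric.mem_thickening_iff]
  refine ⟨z, hzL, ?_⟩
  rw [dist_eq_norm]
  refine (Complex.norm_le_abs_re_add_abs_im _).trans_lt ?_
  rw [mem_gridSquare] at hz hw
  have h1 : |(w - z).re| ≤ δ := by
    rw [abs_le, sub_re]; constructor <;> linarith [hz.1.1, hz.1.2, hw.1.1, hw.1.2]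
  have h2 : |(w - z).im| ≤ δ := by
    rw [abs_le, sub_im]; constructor <;> linarith [hz.2.1, hz.2.2, hw.2.1, hw.2.2]
  linarith

/-! ### Chains and the homology version of Cauchy's theorem -/

/-- A finite family of continuous paths on `[0, 1]` together with bounded measurable densities
`vel` against which functions on the paths are integrated. For a family of Lipschitz curves, `vel`
is the derivative. -/
structure Chain where
  ι : Type
  [fintype : Fintype ι]
  pos : ι → ℝ → ℂ
  vel : ι → ℝ → ℂ
  continuousOn_pos : ∀ j, ContinuousOn (pos j) (Set.Icc 0 1)
  aestronglyMeasurable_vel : ∀ j,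
    AEStronglyMeasurable (vel j) (volume.restrict (Set.Ioo (0 : ℝ) 1))
  bounded_vel : ∀ j, ∃ M, ∀ t ∈ Set.Ioo (0 : ℝ) 1, ‖vel j t‖ ≤ M

attribute [instance] Chain.fintype

namespace Chain

/-- The integral of a function along a chain. -/
def integral (c : Chain) (g : ℂ → ℂ) : ℂ := ∑ j, ∫ t in (0 : ℝ)..1, g (c.pos j t) * c.vel j t

/-- The set of points on a chain. -/
def trace (c : Chain) : Set ℂ := {z | ∃ j, ∃ t ∈ Set.Icc (0 : ℝ) 1, c.pos j t = z}

/-- The difference of two chains. -/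
def sub (c d : Chain) : Chain where
  ι := c.ι ⊕ d.ι
  pos := Sum.elim c.pos d.pos
  vel := Sum.elim c.vel fun j t => -d.vel j t
  continuousOn_pos := by
    rintro (j | j)
    exacts [c.continuousOn_pos j, d.continuousOn_pos j]
  aestronglyMeasurable_vel := by
    rintro (j | j)
    exacts [c.aestronglyMeasurable_vel j, (d.aestronglyMeasurable_vel j).neg]
  bounded_vel := by
    rintro (j | j)
    · exact c.bounded_vel j
    · simpa using d.bounded_vel j

theorem integral_sub (c d : Chain) (g : ℂ → ℂ) :
    (c.sub d).integral g = c.integral g - d.integral g := by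
  have h : (c.sub d).integral g =
      ∑ j : c.ι ⊕ d.ι, ∫ t in (0 : ℝ)..1, g ((c.sub d).pos j t) * (c.sub d).vel j t := rfl
  rw [h, Fintype.sum_sum_type]
  simp [integral, sub, sub_eq_add_neg]

theorem mem_trace (c : Chain) (j : c.ι) {t : ℝ} (ht : t ∈ Set.Icc (0 : ℝ) 1) :
    c.pos j t ∈ c.trace := ⟨j, t, ht, rfl⟩

theorem integral_congr (c : Chain) {g h : ℂ → ℂ} (H : Set.EqOn g h c.trace) :
    c.integral g = c.integral h := by
  refine Finset.sum_congr rfl fun j _ => intervalIntegral.integral_congr fun t ht => ?_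
  rw [Set.uIcc_of_le zero_le_one] at ht
  rw [H (c.mem_trace j ht)]

theorem integrable_vel (c : Chain) (j : c.ι) :
    Integrable (c.vel j) (volume.restrict (Set.Ioo (0 : ℝ) 1)) := by
  obtain ⟨M, hM⟩ := c.bounded_vel j
  exact Integrable.of_bound (c.aestronglyMeasurable_vel j) M
    ((ae_restrict_iff' measurableSet_Ioo).2 (Filter.Eventually.of_forall hM))

theorem intervalIntegrable (c : Chain) {g : ℂ → ℂ} (hg : ContinuousOn g c.trace) (j : c.ι) :
    IntervalIntegrable (fun t => g (c.pos j t) * c.vel j t) volume 0 1 := by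
  rw [intervalIntegrable_iff_integrableOn_Ioo_of_le zero_le_one]
  have hcont : ContinuousOn (fun t => g (c.pos j t)) (Set.Icc 0 1) :=
    hg.comp (c.continuousOn_pos j) fun t ht => c.mem_trace j ht
  obtain ⟨M, hM⟩ := isCompact_Icc.exists_bound_of_continuousOn hcont
  refine (c.integrable_vel j).bdd_mul (c := M)
    ((hcont.mono Set.Ioo_subset_Icc_self).aestronglyMeasurable measurableSet_Ioo) ?_
  exact (ae_restrict_iff' measurableSet_Ioo).2
    (Filter.Eventually.of_forall fun t ht => hM t (Set.Ioo_subset_Icc_self ht))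

theorem integral_fun_sub (c : Chain) {g h : ℂ → ℂ} (hg : ContinuousOn g c.trace)
    (hh : ContinuousOn h c.trace) :
    c.integral (fun z => g z - h z) = c.integral g - c.integral h := by
  rw [integral, integral, integral, ← Finset.sum_sub_distrib]
  refine Finset.sum_congr rfl fun j _ => ?_
  rw [← intervalIntegral.integral_sub (c.intervalIntegrable hg j) (c.intervalIntegrable hh j)]
  simp only [sub_mul]

theorem integral_const_mul (c : Chain) (k : ℂ) (g : ℂ → ℂ) :
    c.integral (fun z => k * g z) = k * c.integral g := by
  rw [integral, integral, Finset.mul_sum]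
  refine Finset.sum_congr rfl fun j _ => ?_
  rw [← intervalIntegral.integral_const_mul]
  simp only [mul_assoc]

theorem isCompact_image_pos (c : Chain) (j : c.ι) : IsCompact (c.pos j '' Set.Icc 0 1) :=
  isCompact_Icc.image_of_continuousOn (c.continuousOn_pos j)

/-- Off a compact trace the kernel is at most `(‖z‖ - R)⁻¹` while the density is bounded. This decay
fixes the constant in the orientation condition of a good boundary. -/
theorem tendsto_integral_inv_sub (c : Chain) :
    Filter.Tendsto (fun z => c.integral fun ζ => (ζ - z)⁻¹) (Bornology.cobounded ℂ) (𝓝 0) := by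
  rw [show (0 : ℂ) = ∑ _j : c.ι, 0 by simp]
  refine tendsto_finsetSum _ fun j _ => ?_
  obtain ⟨M, hM⟩ := c.bounded_vel j
  obtain ⟨R, hR⟩ := (c.isCompact_image_pos j).isBounded.exists_norm_le
  have hlim : Filter.Tendsto (fun z : ℂ => (‖z‖ - R)⁻¹ * |M| * |(1 : ℝ) - 0|)
      (Bornology.cobounded ℂ) (𝓝 0) := by
    have h1 : Filter.Tendsto (fun z : ℂ => ‖z‖ - R) (Bornology.cobounded ℂ) Filter.atTop :=
      Filter.tendsto_atTop_add_const_right _ _ tendsto_norm_cobounded_atTop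
    have h2 := (tendsto_inv_atTop_zero.comp h1).mul_const (|M| * |(1 : ℝ) - 0|)
    simpa [mul_assoc] using h2
  refine squeeze_zero_norm' ?_ hlim
  filter_upwards [Filter.tendsto_atTop.1 (tendsto_norm_cobounded_atTop (E := ℂ)) (R + 1)] with z hz
  have hae : ∀ᵐ t : ℝ, t ∈ Set.uIoc (0 : ℝ) 1 →
      ‖(c.pos j t - z)⁻¹ * c.vel j t‖ ≤ (‖z‖ - R)⁻¹ * |M| := by
    have h1 : ∀ᵐ t : ℝ, t ≠ 1 := by simp [ae_iff, measure_singleton]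
    filter_upwards [h1] with t ht1 ht
    rw [Set.uIoc_of_le zero_le_one] at ht
    have htI : t ∈ Set.Ioo (0 : ℝ) 1 := ⟨ht.1, lt_of_le_of_ne ht.2 ht1⟩
    rw [norm_mul, norm_inv]
    have h2 := hR _ ⟨t, Set.Ioo_subset_Icc_self htI, rfl⟩
    have h3 : ‖z‖ - R ≤ ‖c.pos j t - z‖ := by
      have := norm_sub_norm_le z (c.pos j t)
      rw [norm_sub_rev] at this
      linarith
    have h4 := (hM t htI).trans (le_abs_self M)
    have h5 : 0 < ‖z‖ - R := by linarith
    exact mul_le_mul (inv_anti₀ h5 h3) h4 (norm_nonneg _) (inv_nonneg.2 h5.le)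
  exact intervalIntegral.norm_integral_le_of_norm_le_const_ae hae

/-- Fubini for the continuous kernel on disjoint compact sets times the bounded density. The sign
comes from `(ζ - w)⁻¹ = -(w - ζ)⁻¹`. -/
theorem integral_edgeInt (c : Chain) {h : ℂ → ℂ} {a b : ℂ} (hh : ContinuousOn h (segment ℝ a b))
    (hab : ∀ z ∈ segment ℝ a b, z ∉ c.trace) :
    c.integral (fun w => edgeInt (fun ζ => h ζ * (ζ - w)⁻¹) a b) =
      -edgeInt (fun ζ => h ζ * c.integral fun w => (w - ζ)⁻¹) a b := by
  have hseg : ∀ θ ∈ Set.Icc (0 : ℝ) 1, a + θ * (b - a) ∈ segment ℝ a b := fun θ hθ => by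
    rw [segment_eq_image']; exact ⟨θ, hθ, by simp⟩
  set s : Set ℝ := Set.Ioo (0 : ℝ) 1 with hs
  have hsI : s ⊆ Set.Icc 0 1 := Set.Ioo_subset_Icc_self
  have toIoo : ∀ F : ℝ → ℂ, ∫ t in (0 : ℝ)..1, F t = ∫ t in s, F t := fun F => by
    rw [intervalIntegral.integral_of_le zero_le_one, integral_Ioc_eq_integral_Ioo]
  set k : c.ι → ℝ → ℝ → ℂ := fun j t θ =>
    ((b - a) * (h (a + θ * (b - a)) * ((a + θ * (b - a)) - c.pos j t)⁻¹)) * c.vel j t with hk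
  have hcont : ∀ j, ContinuousOn (fun p : ℝ × ℝ =>
      (b - a) * (h (a + p.2 * (b - a)) * ((a + p.2 * (b - a)) - c.pos j p.1)⁻¹))
      (Set.Icc 0 1 ×ˢ Set.Icc 0 1) := by
    intro j
    refine continuousOn_const.mul ((hh.comp (by fun_prop) fun p hp => hseg _ hp.2).mul
      (ContinuousOn.inv₀ (ContinuousOn.sub (by fun_prop)
        ((c.continuousOn_pos j).comp continuousOn_fst fun p hp => hp.1)) ?_))
    intro p hp h0
    refine hab _ (hseg _ hp.2) ?_
    rw [sub_eq_zero.1 h0]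
    exact c.mem_trace j hp.1
  have hint : ∀ j, Integrable (Function.uncurry (k j))
      ((volume.restrict s).prod (volume.restrict s)) := by
    intro j
    have hvel : Integrable (fun p : ℝ × ℝ => c.vel j p.1)
        ((volume.restrict s).prod (volume.restrict s)) :=
      (c.integrable_vel j).comp_fst _
    obtain ⟨M, hM⟩ := (isCompact_Icc.prod isCompact_Icc).exists_bound_of_continuousOn (hcont j)
    have hss : s ×ˢ s ⊆ Set.Icc (0 : ℝ) 1 ×ˢ Set.Icc (0 : ℝ) 1 := Set.prod_mono hsI hsI
    have hms : MeasurableSet (s ×ˢ s) := measurableSet_Ioo.prod measurableSet_Ioo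
    rw [Measure.prod_restrict] at hvel ⊢
    exact hvel.bdd_mul (c := M) (((hcont j).mono hss).aestronglyMeasurable hms)
      ((ae_restrict_iff' hms).2 (Filter.Eventually.of_forall fun p hp => hM p (hss hp)))
  have lhs : ∀ j, ∫ t in (0 : ℝ)..1, edgeInt (fun ζ => h ζ * (ζ - c.pos j t)⁻¹) a b * c.vel j t =
      ∫ t in s, ∫ θ in s, k j t θ := by
    intro j
    rw [toIoo]
    congr 1
    ext t
    rw [edgeInt, toIoo, ← integral_mul_const]
  have rhs : ∀ θ : ℝ, (b - a) * (h (a + θ * (b - a)) *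
      c.integral fun w => (w - (a + θ * (b - a)))⁻¹) = -∑ j, ∫ t in s, k j t θ := by
    intro θ
    rw [Chain.integral, Finset.mul_sum, Finset.mul_sum, ← Finset.sum_neg_distrib]
    refine Finset.sum_congr rfl fun j _ => ?_
    rw [toIoo, ← MeasureTheory.integral_const_mul, ← MeasureTheory.integral_const_mul,
      ← MeasureTheory.integral_neg]
    congr 1
    ext t
    rw [hk, ← neg_sub (a + θ * (b - a)) (c.pos j t), inv_neg]
    ring
  rw [Chain.integral, edgeInt, toIoo]
  simp_rw [lhs, rhs]
  rw [MeasureTheory.integral_neg, neg_neg, MeasureTheory.integral_finsetSum (f := fun j θ => ∫ t in s, k j t θ) _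
    fun j _ => (hint j).integral_prod_right]
  exact Finset.sum_congr rfl fun j _ => integral_integral_swap (hint j)

/-- **Cauchy's theorem**, homology version. -/
theorem integral_eq_zero (c : Chain) {L Ω : Set ℂ} (hL : IsCompact L) (hΩ : IsOpen Ω)
    (hLΩ : L ⊆ Ω) (hc : c.trace ⊆ L)
    (hind : ∀ z ∉ L, c.integral (fun ζ => (ζ - z)⁻¹) = 0) {h : ℂ → ℂ}
    (hh : DifferentiableOn ℂ h Ω) : c.integral h = 0 := by
  -- The squares meeting `L` form a region between `L` and `Ω` whose boundary edges avoid `L`. On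
  -- `L`, `h` is the Cauchy integral over these edges.
  obtain ⟨δ, hδ, S, hS, hSΩ⟩ := exists_grid hL hΩ hLΩ
  have hLD : L ⊆ gridDomain δ S := fun z hz P hP => (hS P).2 ⟨z, hP, hz⟩
  have hsub : ∀ e ∈ bdryEdges S, gridSeg δ e ⊆ Ω := fun e he => by
    obtain ⟨⟨Q, hQ, heQ⟩, -⟩ := exists_of_mem_bdryEdges he
    exact (gridSeg_subset hδ heQ).trans (hSΩ Q hQ)
  have hnL : ∀ e ∈ bdryEdges S, ∀ z ∈ gridSeg δ e, z ∉ L := fun e he z hz hzL =>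
    gridSeg_disjoint_gridDomain hδ he hz (hLD hzL)
  have hpi : (2 * Real.pi * I : ℂ) ≠ 0 := by simp [Real.pi_ne_zero]
  have h1 : c.integral (fun w => 2 * Real.pi * I * h w) =
      c.integral (fun w => ∑ e ∈ bdryEdges S,
        edgeInt (fun ζ => h ζ * (ζ - w)⁻¹) (gridPt δ e.1) (gridPt δ e.2)) :=
    c.integral_congr fun w hw => (sum_edgeInt_cauchy hδ hΩ hSΩ hh (hLD (hc hw))).symm
  have h2 : c.integral (fun w => ∑ e ∈ bdryEdges S,
      edgeInt (fun ζ => h ζ * (ζ - w)⁻¹) (gridPt δ e.1) (gridPt δ e.2)) =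
      ∑ e ∈ bdryEdges S, c.integral (fun w =>
        edgeInt (fun ζ => h ζ * (ζ - w)⁻¹) (gridPt δ e.1) (gridPt δ e.2)) := by
    simp only [Chain.integral]
    rw [Finset.sum_comm]
    refine Finset.sum_congr rfl fun j _ => ?_
    rw [← intervalIntegral.integral_finsetSum]
    · simp only [Finset.sum_mul]
    · intro e he
      refine c.intervalIntegrable
        (g := fun w => edgeInt (fun ζ => h ζ * (ζ - w)⁻¹) (gridPt δ e.1) (gridPt δ e.2)) ?_ j
      intro w hw
      exact (continuousAt_edgeInt (hh.continuousOn.mono (hsub e he))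
        fun hwe => hnL e he w hwe (hc hw)).continuousWithinAt
  rw [integral_const_mul, h2] at h1
  refine (mul_eq_zero.1 (h1.trans ?_)).resolve_left hpi
  refine Finset.sum_eq_zero fun e he => ?_
  -- After the exchange the inner integral is the winding integral of `c` about a point of a
  -- boundary edge, which lies off `L`, so it is `0`.
  rw [integral_edgeInt c (hh.continuousOn.mono (hsub e he)) fun z hz hzc => hnL e he z hz (hc hzc)]
  rw [edgeInt_congr (h := fun _ => 0)]
  · simp [edgeInt]
  · intro ζ hζ
    simp only
    rw [hind ζ (hnL e he ζ hζ), mul_zero]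

/-- The chain lies in `C \ W` and its winding number is `a + 1` in the open set `W` and `a` off the
closed set `C`. -/
structure Encloses (c : Chain) (a : ℂ) (W C : Set ℂ) : Prop where
  isOpen : IsOpen W
  isClosed : IsClosed C
  subset : W ⊆ C
  trace_subset : c.trace ⊆ C \ W
  inside : ∀ z ∈ W, c.integral (fun ζ => (ζ - z)⁻¹) = 2 * Real.pi * I * (a + 1)
  outside : ∀ z ∉ C, c.integral (fun ζ => (ζ - z)⁻¹) = 2 * Real.pi * I * a

/-- The difference chain lies in `(C₁ ∪ C₂) \ (W₁ ∩ W₂)`. Off this set a point is in both `W`s,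
where the winding numbers `a + 1` cancel, or outside both `C`s, where the values `a` cancel. Only
this difference has to be bounded, so neighbourhoods of infinity are covered as well. -/
theorem Encloses.integral_sub_eq_zero {c d : Chain} {a : ℂ} {W₁ C₁ W₂ C₂ K Ω : Set ℂ}
    (hc : c.Encloses a W₁ C₁) (hd : d.Encloses a W₂ C₂) (hK : IsClosed K) (hΩ : IsOpen Ω)
    (hK₁ : K ⊆ W₁) (hK₂ : K ⊆ W₂) (hC₁ : C₁ ⊆ Ω) (hC₂ : C₂ ⊆ Ω)
    (hb : Bornology.IsBounded ((C₁ ∪ C₂) \ (W₁ ∩ W₂))) {h : ℂ → ℂ}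
    (hh : DifferentiableOn ℂ h (Ω \ K)) : (c.sub d).integral h = 0 := by
  refine (c.sub d).integral_eq_zero (L := (C₁ ∪ C₂) \ (W₁ ∩ W₂)) (Ω := Ω \ K)
    (Metric.isCompact_of_isClosed_isBounded
      ((hc.isClosed.union hd.isClosed).sdiff (hc.isOpen.inter hd.isOpen)) hb)
    (hΩ.sdiff hK) ?_ ?_ ?_ hh
  · rintro z ⟨hz1, hz2⟩
    exact ⟨hz1.elim (fun h => hC₁ h) fun h => hC₂ h, fun hzK => hz2 ⟨hK₁ hzK, hK₂ hzK⟩⟩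
  · rintro z ⟨j | j, t, ht, rfl⟩
    · have := hc.trace_subset (c.mem_trace j ht)
      exact ⟨Or.inl this.1, fun h => this.2 h.1⟩
    · have := hd.trace_subset (d.mem_trace j ht)
      exact ⟨Or.inr this.1, fun h => this.2 h.2⟩
  · intro z hz
    rw [integral_sub]
    by_cases h : z ∈ C₁ ∨ z ∈ C₂
    · obtain ⟨h1, h2⟩ : z ∈ W₁ ∩ W₂ := by
        by_contra h3
        exact hz ⟨h, h3⟩
      rw [hc.inside z h1, hd.inside z h2, sub_self]
    · push Not at h
      rw [hc.outside z h.1, hd.outside z h.2, sub_self]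

/-- **Cauchy's formula** for chains that enclose a bounded set. -/
theorem Encloses.cauchy {c : Chain} {W C Ω : Set ℂ} (hc : c.Encloses 0 W C)
    (hb : Bornology.IsBounded C) (hΩ : IsOpen Ω) (hC : C ⊆ Ω) {h : ℂ → ℂ}
    (hh : DifferentiableOn ℂ h Ω) {w : ℂ} (hw : w ∈ W) :
    c.integral (fun ζ => (ζ - w)⁻¹ * h ζ) = 2 * Real.pi * I * h w := by
  have hne : ∀ ζ ∈ c.trace, ζ ≠ w := by
    rintro ζ hζ rfl
    exact (hc.trace_subset hζ).2 hw
  have hinv : ContinuousOn (fun ζ => (ζ - w)⁻¹) c.trace :=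
    ContinuousOn.inv₀ (by fun_prop) fun ζ hζ => sub_ne_zero.2 (hne ζ hζ)
  have hcΩ : c.trace ⊆ Ω := fun ζ hζ => hC (hc.trace_subset hζ).1
  -- Cauchy's theorem for the difference quotient, whose singularity at `w` is removable.
  have h0 : c.integral (dslope h w) = 0 :=
    c.integral_eq_zero (Metric.isCompact_of_isClosed_isBounded hc.isClosed hb) hΩ hC
      (fun ζ hζ => (hc.trace_subset hζ).1) (fun z hz => by rw [hc.outside z hz, mul_zero])
      ((Complex.differentiableOn_dslope (hΩ.mem_nhds (hC (hc.subset hw)))).2 hh)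
  rw [c.integral_congr (h := fun ζ => (ζ - w)⁻¹ * h ζ - h w * (ζ - w)⁻¹)
    (fun ζ hζ => by simp only; rw [dslope_of_ne _ (hne ζ hζ), slope_def_field]; ring),
    c.integral_fun_sub (g := fun ζ => (ζ - w)⁻¹ * h ζ) (h := fun ζ => h w * (ζ - w)⁻¹)
      (hinv.mul (hh.continuousOn.mono hcΩ)) (continuousOn_const.mul hinv),
    c.integral_const_mul, hc.inside w hw] at h0
  linear_combination h0

end Chain

/-! ### Positively oriented boundaries as chains -/

/-- The boundary of a plane open set as a chain. -/
def PositiveBoundary.chain {D : Set ℂ} (Γ : PositiveBoundary D) : Chain where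
  ι := Fin Γ.n
  pos j := (Γ.curve j).toFun
  vel j := deriv (Γ.curve j).toFun
  continuousOn_pos j := (Γ.curve j).lipschitz.choose_spec.continuousOn
  aestronglyMeasurable_vel j := (measurable_deriv _).aestronglyMeasurable
  bounded_vel j := by
    obtain ⟨K, hK⟩ := (Γ.curve j).lipschitz
    exact ⟨K, fun t ht => norm_deriv_le_of_lipschitzOn (Icc_mem_nhds ht.1 ht.2) hK⟩

theorem PositiveBoundary.trace_chain {D : Set ℂ} (Γ : PositiveBoundary D) :
    Γ.chain.trace = frontier D := by
  rw [← Γ.trace_eq]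
  ext z
  simp [Chain.trace, JordanCurve.trace, PositiveBoundary.chain]

theorem PositiveBoundary.sum_index {D : Set ℂ} (Γ : PositiveBoundary D) (z : ℂ) :
    Γ.chain.integral (fun ζ => (ζ - z)⁻¹) = 2 * Real.pi * I * ∑ j, (Γ.curve j).index z := by
  have hpi : (2 * Real.pi * I : ℂ) ≠ 0 := by simp [Real.pi_ne_zero]
  simp only [Chain.integral, JordanCurve.index]
  rw [← Finset.mul_sum, mul_inv_cancel_left₀ hpi]
  simp only [PositiveBoundary.chain, div_eq_inv_mul]
  rfl

theorem PositiveBoundary.exists_encloses {D : Set ℂ} (hD : IsOpen D) (Γ : PositiveBoundary D) :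
    ∃ a, Γ.chain.Encloses a D (closure D) := by
  obtain ⟨a, ha1, ha2⟩ := Γ.oriented
  refine ⟨a, hD, isClosed_closure, subset_closure, ?_, fun z hz => ?_, fun z hz => ?_⟩
  · rw [Γ.trace_chain, hD.frontier_eq]
  · rw [Γ.sum_index, ha1 z hz]
  · rw [Γ.sum_index, ha2 z hz]

/-- A winding integral tends to `0` at infinity. Hence a constant value near infinity is `0`:
outside a bounded domain this gives `a = 0`, inside a neighbourhood of infinity `a + 1 = 0`. -/
theorem eq_zero_of_index_cobounded {c : Chain} {a : ℂ} {s : Set ℂ}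
    (hs : s ∈ Bornology.cobounded ℂ)
    (h : ∀ z ∈ s, c.integral (fun ζ => (ζ - z)⁻¹) = 2 * Real.pi * I * a) : a = 0 := by
  have hpi : (2 * Real.pi * I : ℂ) ≠ 0 := by simp [Real.pi_ne_zero]
  have h1 := c.tendsto_integral_inv_sub.congr' (f₂ := fun _ => 2 * Real.pi * I * a)
    (by filter_upwards [hs] with z hz using h z hz)
  exact (mul_eq_zero.1 (tendsto_nhds_unique tendsto_const_nhds h1)).resolve_left hpi

theorem PositiveBoundary.encloses_of_isBounded {D : Set ℂ} (hD : IsOpen D)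
    (hb : Bornology.IsBounded D) (Γ : PositiveBoundary D) :
    Γ.chain.Encloses 0 D (closure D) := by
  obtain ⟨a, ha⟩ := Γ.exists_encloses hD
  have : a = 0 := eq_zero_of_index_cobounded (s := (closure D)ᶜ)
    (Bornology.isBounded_def.1 hb.closure) ha.outside
  rwa [this] at ha

theorem PositiveBoundary.encloses_of_cobounded {D : Set ℂ} (hD : IsOpen D)
    (hb : D ∈ Bornology.cobounded ℂ) (Γ : PositiveBoundary D) :
    Γ.chain.Encloses (-1) D (closure D) := by
  obtain ⟨a, ha⟩ := Γ.exists_encloses hD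
  have : a = -1 := eq_neg_of_add_eq_zero_left (eq_zero_of_index_cobounded hb ha.inside)
  rwa [this] at ha

end SCalc

namespace SCalc

open Complex MeasureTheory

/-! ### Decomposition of balanced directed graphs into simple cycles -/

/-- The hypothesis, tested on indicators, says that in-degree equals out-degree. So an edge can
always be continued, the walk along a chosen successor repeats in the finite graph, and an orbit of
minimal period is a simple cycle. -/
theorem exists_simple_cycle {α : Type*} [DecidableEq α] {E : Finset (α × α)} (hne : E.Nonempty)
    (hE : ∀ F : α → ℤ, ∑ e ∈ E, (F e.2 - F e.1) = 0) :
    ∃ m : ℕ, 0 < m ∧ ∃ c : ℕ → α, c m = c 0 ∧ Set.InjOn c (Set.Iio m) ∧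
      ∀ i, (c i, c (i + 1)) ∈ E := by
  classical
  set s : α → α := fun v => if h : ∃ w, (v, w) ∈ E then h.choose else v with hs
  have hsE : ∀ v, (∃ w, (v, w) ∈ E) → (v, s v) ∈ E := by
    intro v h
    simp only [hs, dif_pos h]
    exact h.choose_spec
  have hsX : ∀ v, (∃ w, (v, w) ∈ E) → ∃ w, (s v, w) ∈ E := by
    intro v h
    by_contra hc
    push Not at hc
    -- The balance is tested on the indicator of `s v`. If no edge left `s v`, all terms would be
    -- nonnegative and the edge from `v` to `s v` would contribute `1`.
    have h1 := hE (Pi.single (s v) 1)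
    have h2 : ∑ e ∈ E, (Pi.single (s v) (1 : ℤ) : α → ℤ) e.2 = 0 := by
      rw [← h1]
      refine Finset.sum_congr rfl fun e he => ?_
      have h3 : e.1 ≠ s v := fun h3 => hc e.2 (h3 ▸ he)
      rw [Pi.single_eq_of_ne (i' := e.1) h3, sub_zero]
    rw [Finset.sum_eq_zero_iff_of_nonneg] at h2
    · have := h2 _ (hsE v h)
      simp at this
    · intro e _
      by_cases h4 : e.2 = s v
      · rw [h4]; simp
      · rw [Pi.single_eq_of_ne h4]
  obtain ⟨⟨v₀, w₀⟩, he₀⟩ := hne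
  have hit : ∀ i, ∃ w, (s^[i] v₀, w) ∈ E := by
    intro i
    induction i with
    | zero => exact ⟨w₀, he₀⟩
    | succ i ih => rw [Function.iterate_succ_apply']; exact hsX _ ih
  obtain ⟨i, j, hij, heq⟩ : ∃ i j : ℕ, i < j ∧ s^[i] v₀ = s^[j] v₀ := by
    by_contra hc
    push Not at hc
    have hinj : Function.Injective fun i => s^[i] v₀ := by
      intro i j h
      rcases lt_trichotomy i j with h1 | h1 | h1
      exacts [absurd h (hc i j h1), h1, absurd h.symm (hc j i h1)]
    refine Set.infinite_range_of_injective hinj ((E.image Prod.fst).finite_toSet.subset ?_)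
    rintro _ ⟨i, rfl⟩
    obtain ⟨w, hw⟩ := hit i
    simpa using ⟨w, hw⟩
  set v := s^[i] v₀ with hv
  have hper : v ∈ Function.periodicPts s := by
    refine ⟨j - i, Nat.sub_pos_of_lt hij, ?_⟩
    rw [Function.IsPeriodicPt, Function.IsFixedPt, hv, ← Function.iterate_add_apply,
      Nat.sub_add_cancel hij.le]
    exact heq.symm
  refine ⟨Function.minimalPeriod s v, Function.minimalPeriod_pos_of_mem_periodicPts hper,
    fun n => s^[n] v, ?_, Function.iterate_injOn_Iio_minimalPeriod, ?_⟩
  · simp [Function.iterate_minimalPeriod]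
  · intro n
    simp only [Function.iterate_succ_apply']
    refine hsE _ ?_
    rw [hv, ← Function.iterate_add_apply]
    exact hit _

/-- A simple cycle telescopes against every `F`, so removing it keeps the balance, and induction on
the number of edges applies. Testing with arbitrary `G` records the multiplicities: it gives the
integrals and, for indicators, that every edge is used. -/
theorem exists_cycle_decomposition {α : Type*} [DecidableEq α] (E : Finset (α × α))
    (hE : ∀ F : α → ℤ, ∑ e ∈ E, (F e.2 - F e.1) = 0) :
    ∃ (n : ℕ) (m : Fin n → ℕ) (c : Fin n → ℕ → α), (∀ j, 0 < m j ∧ c j (m j) = c j 0 ∧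
      Set.InjOn (c j) (Set.Iio (m j)) ∧ ∀ i, (c j i, c j (i + 1)) ∈ E) ∧
      ∀ G : α × α → ℂ, ∑ e ∈ E, G e = ∑ j, ∑ i ∈ Finset.range (m j), G (c j i, c j (i + 1)) := by
  induction h : E.card using Nat.strong_induction_on generalizing E with
  | _ N ih =>
  rcases E.eq_empty_or_nonempty with rfl | hne
  · exact ⟨0, Fin.elim0, Fin.elim0, fun j => j.elim0, fun G => by simp⟩
  obtain ⟨m, hm, c, hc0, hinj, hcE⟩ := exists_simple_cycle hne hE
  set C := (Finset.range m).image fun i => (c i, c (i + 1)) with hC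
  have hCE : C ⊆ E := by
    intro e he
    obtain ⟨i, -, rfl⟩ := Finset.mem_image.1 he
    exact hcE i
  have hsumC : ∀ {M : Type} [AddCommMonoid M] (G : α × α → M),
      ∑ e ∈ C, G e = ∑ i ∈ Finset.range m, G (c i, c (i + 1)) := by
    intro M _ G
    rw [hC, Finset.sum_image]
    intro i hi j hj hij
    exact hinj (Finset.mem_range.1 hi) (Finset.mem_range.1 hj) (Prod.mk.inj hij).1
  have hlt : (E \ C).card < N := by
    rw [← h]
    refine Finset.card_lt_card (Finset.ssubset_iff_subset_ne.2 ⟨Finset.sdiff_subset, fun h0 => ?_⟩)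
    have h1 : (c 0, c 1) ∈ C := Finset.mem_image.2 ⟨0, Finset.mem_range.2 hm, rfl⟩
    have h2 := hCE h1
    rw [← h0] at h2
    exact (Finset.mem_sdiff.1 h2).2 h1
  obtain ⟨n, m', c', hc', hsum⟩ := ih _ hlt (E \ C) (fun F => by
    have h1 := hE F
    rw [← Finset.sum_sdiff hCE, hsumC, Finset.sum_range_sub fun i => F (c i), hc0, sub_self,
      add_zero] at h1
    exact h1) rfl
  refine ⟨n + 1, Fin.cons m m', Fin.cons c c', ?_, fun G => ?_⟩
  · rw [Fin.forall_fin_succ]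
    refine ⟨⟨hm, hc0, hinj, hcE⟩, fun j => ?_⟩
    simp only [Fin.cons_succ]
    obtain ⟨h1, h2, h3, h4⟩ := hc' j
    exact ⟨h1, h2, h3, fun i => (Finset.mem_sdiff.1 (h4 i)).1⟩
  · rw [← Finset.sum_sdiff hCE, hsumC, hsum, Fin.sum_univ_succ]
    simp only [Fin.cons_zero, Fin.cons_succ]
    rw [add_comm]

/-! ### Closed polygons -/

/-- The retraction of the line on the unit interval. -/
def clamp (x : ℝ) : ℝ := max 0 (min 1 x)

theorem clamp_lipschitz (x y : ℝ) : |clamp x - clamp y| ≤ |x - y| := by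
  refine (abs_max_sub_max_le_max 0 _ 0 _).trans ?_
  simp only [sub_self, abs_zero, abs_nonneg, sup_of_le_right]
  exact (abs_min_sub_min_le_max 1 _ 1 _).trans (by simp)

/-- The polygon with vertices `w 0, …, w m`, parametrized by `[0, 1]`. -/
def polygon (m : ℕ) (w : ℕ → ℂ) (t : ℝ) : ℂ :=
  w 0 + ∑ i ∈ Finset.range m, clamp (m * t - i) * (w (i + 1) - w i)

theorem polygon_lipschitz (m : ℕ) (w : ℕ → ℂ) : ∃ K, LipschitzWith K (polygon m w) := by
  refine ⟨⟨∑ i ∈ Finset.range m, m * ‖w (i + 1) - w i‖,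
    Finset.sum_nonneg fun i _ => by positivity⟩, LipschitzWith.of_dist_le_mul fun t s => ?_⟩
  rw [dist_eq_norm, polygon, polygon, add_sub_add_left_eq_sub, ← Finset.sum_sub_distrib]
  refine (norm_sum_le _ _).trans ?_
  change _ ≤ (∑ i ∈ Finset.range m, m * ‖w (i + 1) - w i‖) * _
  rw [Finset.sum_mul]
  refine Finset.sum_le_sum fun i _ => ?_
  rw [← sub_mul, norm_mul, ← ofReal_sub, norm_real, Real.norm_eq_abs, mul_right_comm]
  refine mul_le_mul_of_nonneg_right ((clamp_lipschitz _ _).trans ?_) (norm_nonneg _)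
  rw [show (m : ℝ) * t - i - (m * s - i) = m * (t - s) by ring, abs_mul, Real.dist_eq]
  simp

/-- At a time in the `i`-th subinterval the clamps of earlier edges equal `1` and telescope to `w
i`, and those of later edges equal `0`. -/
theorem polygon_eq {m i : ℕ} (hi : i < m) (w : ℕ → ℂ) {t : ℝ} (h1 : i ≤ m * t)
    (h2 : m * t ≤ i + 1) : polygon m w t = w i + (m * t - i : ℝ) * (w (i + 1) - w i) := by
  have key : ∀ n, n ≤ m → w 0 + ∑ l ∈ Finset.range n, clamp (m * t - l) * (w (l + 1) - w l) =
      if n ≤ i then w n else w i + (m * t - i : ℝ) * (w (i + 1) - w i) := by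
    intro n
    induction n with
    | zero => simp
    | succ n ih =>
      intro hn
      rw [Finset.sum_range_succ, ← add_assoc, ih (by omega)]
      rcases lt_trichotomy n i with h | h | h
      · have : (n : ℝ) + 1 ≤ i := by exact_mod_cast h
        rw [if_pos h.le, if_pos (by omega), clamp, min_eq_left (by linarith)]
        simp
      · subst h
        rw [if_pos le_rfl, if_neg (by omega), clamp, min_eq_right (by linarith),
          max_eq_right (by linarith)]
      · have : (i : ℝ) + 1 ≤ n := by exact_mod_cast h
        rw [if_neg (by omega), if_neg (by omega), clamp,
          max_eq_left ((min_le_right _ _).trans (by linarith))]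
        simp
  rw [polygon, key m le_rfl, if_neg (by omega)]

theorem exists_floor {m : ℕ} {t : ℝ} (ht : t ∈ Set.Ico (0 : ℝ) 1) (hm : 0 < m) :
    ∃ i < m, i ≤ m * t ∧ m * t < i + 1 := by
  have hm' : (0 : ℝ) < m := by exact_mod_cast hm
  refine ⟨⌊m * t⌋₊, ?_, Nat.floor_le (mul_nonneg hm'.le ht.1), Nat.lt_floor_add_one _⟩
  rw [Nat.floor_lt (mul_nonneg hm'.le ht.1)]
  nlinarith [ht.2]

theorem polygon_image {m : ℕ} (hm : 0 < m) (w : ℕ → ℂ) :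
    polygon m w '' Set.Icc 0 1 = ⋃ i ∈ Finset.range m, segment ℝ (w i) (w (i + 1)) := by
  have hm' : (0 : ℝ) < m := by exact_mod_cast hm
  ext z
  simp only [Set.mem_image, Set.mem_iUnion, Finset.mem_range, exists_prop]
  constructor
  · rintro ⟨t, ht, rfl⟩
    obtain ⟨i, hi, h1, h2⟩ : ∃ i < m, i ≤ m * t ∧ m * t ≤ i + 1 := by
      rcases ht.2.eq_or_lt with h | h
      · refine ⟨m - 1, by omega, ?_, ?_⟩ <;>
        · rw [Nat.cast_sub hm, h]
          push_cast
          linarith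
      · obtain ⟨i, hi, h1, h2⟩ := exists_floor ⟨ht.1, h⟩ hm
        exact ⟨i, hi, h1, h2.le⟩
    refine ⟨i, hi, ?_⟩
    rw [polygon_eq hi w h1 h2, segment_eq_image']
    exact ⟨m * t - i, ⟨by linarith, by linarith⟩, by simp⟩
  · rintro ⟨i, hi, hz⟩
    rw [segment_eq_image'] at hz
    obtain ⟨θ, ⟨h1, h2⟩, rfl⟩ := hz
    have hi' : (i : ℝ) + 1 ≤ m := by exact_mod_cast hi
    have e : (m : ℝ) * ((i + θ) / m) = i + θ := by field_simp
    refine ⟨(i + θ) / m, ⟨by positivity, by rw [div_le_one hm']; linarith⟩, ?_⟩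
    rw [polygon_eq hi w (by rw [e]; linarith) (by rw [e]; linarith), e]
    simp

/-- The parametrization is affine between consecutive breakpoints `i / m`, which form a null set, so
the derivative there is irrelevant. -/
theorem integral_polygon {m : ℕ} (hm : 0 < m) (w : ℕ → ℂ) {g : ℂ → ℂ}
    (hg : ∀ i < m, ContinuousOn g (segment ℝ (w i) (w (i + 1)))) :
    ∫ t in (0 : ℝ)..1, g (polygon m w t) * deriv (polygon m w) t =
      ∑ i ∈ Finset.range m, edgeInt g (w i) (w (i + 1)) := by
  have hm' : (0 : ℝ) < m := by exact_mod_cast hm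
  have hle : ∀ i : ℕ, (i : ℝ) / m ≤ (i + 1 : ℕ) / m := fun i => by
    gcongr; exact_mod_cast Nat.le_succ i
  have hexp : ∀ i < m, Set.EqOn (fun t => g (polygon m w t) * deriv (polygon m w) t)
      (fun t : ℝ => (m : ℝ) • ((w (i + 1) - w i) *
        g (w i + (m * t - i : ℝ) * (w (i + 1) - w i)))) (Set.Ioo (i / m) ((i + 1 : ℕ) / m)) := by
    intro i hi t ht
    have hin : ∀ s ∈ Set.Ioo ((i : ℝ) / m) ((i + 1 : ℕ) / m), polygon m w s =
        w i + (m * s - i : ℝ) * (w (i + 1) - w i) := by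
      intro s hs
      have h1 := (div_lt_iff₀ hm').1 hs.1
      have h2 := (lt_div_iff₀ hm').1 hs.2
      push_cast at h2
      exact polygon_eq hi w (by linarith) (by linarith)
    have hd : HasDerivAt (polygon m w) (m * (w (i + 1) - w i)) t := by
      have h3 : HasDerivAt (fun s : ℝ => w i + ((m * s - i : ℝ) : ℂ) * (w (i + 1) - w i))
          (m * (w (i + 1) - w i)) t := by
        have h4 : HasDerivAt (fun s : ℝ => (m : ℝ) * s - i) m t := by
          simpa using ((hasDerivAt_id t).const_mul (m : ℝ)).sub_const (i : ℝ)
        simpa using (h4.ofReal_comp.mul_const (w (i + 1) - w i)).const_add (w i)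
      refine h3.congr_of_eventuallyEq ?_
      filter_upwards [Ioo_mem_nhds ht.1 ht.2] with s hs using hin s hs
    simp only
    rw [hd.deriv, hin t ht, Complex.real_smul]
    push_cast
    ring
  have hcont : ∀ i < m, ContinuousOn (fun t : ℝ => (m : ℝ) • ((w (i + 1) - w i) *
        g (w i + (m * t - i : ℝ) * (w (i + 1) - w i)))) (Set.Icc (i / m) ((i + 1 : ℕ) / m)) := by
    intro i hi
    have hlin : Continuous fun t : ℝ => w i + ((m * t - i : ℝ) : ℂ) * (w (i + 1) - w i) := by
      fun_prop
    refine ContinuousOn.const_smul (continuousOn_const.mul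
      ((hg i hi).comp hlin.continuousOn ?_)) (m : ℝ)
    intro t ht
    have h1 := (div_le_iff₀ hm').1 ht.1
    have h2 := (le_div_iff₀ hm').1 ht.2
    push_cast at h2
    rw [segment_eq_image']
    exact ⟨m * t - i, ⟨by linarith, by linarith⟩, by simp⟩
  have hae : ∀ i < m, ∀ᵐ t, t ∈ Set.uIoc ((i : ℝ) / m) ((i + 1 : ℕ) / m) →
      g (polygon m w t) * deriv (polygon m w) t = (m : ℝ) • ((w (i + 1) - w i) *
        g (w i + (m * t - i : ℝ) * (w (i + 1) - w i))) := by
    intro i hi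
    have h1 : ∀ᵐ t : ℝ, t ≠ (i + 1 : ℕ) / m := by simp [ae_iff, measure_singleton]
    filter_upwards [h1] with t ht1 ht
    rw [Set.uIoc_of_le (hle i)] at ht
    exact hexp i hi ⟨ht.1, lt_of_le_of_ne ht.2 ht1⟩
  have hsum := intervalIntegral.sum_integral_adjacent_intervals (μ := volume)
    (f := fun t => g (polygon m w t) * deriv (polygon m w) t) (a := fun i : ℕ => (i : ℝ) / m)
    (n := m) (fun i hi => by
      refine IntervalIntegrable.congr_ae ?_ (f := fun t : ℝ => (m : ℝ) • ((w (i + 1) - w i) *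
        g (w i + (m * t - i : ℝ) * (w (i + 1) - w i)))) ?_
      rotate_left
      · refine (ae_restrict_iff' measurableSet_uIoc).2 ?_
        filter_upwards [hae i hi] with t ht h
        exact (ht h).symm
      · refine ContinuousOn.intervalIntegrable ?_
        rw [Set.uIcc_of_le (hle i)]
        exact hcont i hi)
  simp only [Nat.cast_zero, zero_div, div_self hm'.ne'] at hsum
  rw [← hsum]
  refine Finset.sum_congr rfl fun i hi => ?_
  rw [intervalIntegral.integral_congr_ae (hae i (Finset.mem_range.1 hi)),
    intervalIntegral.integral_smul]
  have h := intervalIntegral.smul_integral_comp_mul_sub (a := (i : ℝ) / m)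
    (b := (i + 1 : ℕ) / m) (fun θ : ℝ => (w (i + 1) - w i) * g (w i + θ * (w (i + 1) - w i)))
    (m : ℝ) i
  rw [h, edgeInt]
  congr 1
  · field_simp; simp
  · field_simp; simp

end SCalc

namespace SCalc

open Complex MeasureTheory

/-! ### Unions of grid squares have positively oriented boundaries -/

theorem isClosed_gridSquare (δ : ℝ) (P : ℤ × ℤ) : IsClosed (gridSquare δ P) :=
  (isClosed_Icc.preimage continuous_re).inter (isClosed_Icc.preimage continuous_im)

/-- The complement is the union of the closed squares not in `S`, a locally finite family. -/
theorem isOpen_gridDomain {δ : ℝ} (hδ : 0 < δ) (S : Finset (ℤ × ℤ)) :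
    IsOpen (gridDomain δ S) := by
  have hlf : LocallyFinite (gridSquare δ) := fun z =>
    ⟨Metric.ball z 1, Metric.ball_mem_nhds z one_pos,
      finite_gridSquare_inter hδ Metric.isBounded_ball⟩
  have h := (hlf.comp_injective (Subtype.val_injective (p := fun P => P ∉ S))).isClosed_iUnion
    fun P => isClosed_gridSquare δ _
  convert h.isOpen_compl using 1
  ext z
  simp only [gridDomain, Set.mem_ofPred_eq, Set.mem_compl_iff, Set.mem_iUnion, Function.comp,
    not_exists, Subtype.forall]
  exact forall_congr' fun P => ⟨fun h1 h2 h3 => h2 (h1 h3), fun h1 h2 => by_contra fun h3 =>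
    h1 h3 h2⟩

theorem gridSquare_subset_closure {δ : ℝ} (hδ : 0 < δ) {S : Finset (ℤ × ℤ)} {P : ℤ × ℤ}
    (hP : P ∈ S) : gridSquare δ P ⊆ closure (gridDomain δ S) := by
  have h1 : gridSquare δ P = closure (openSquare (gridPt δ P) δ) := by
    rw [openSquare, closure_reProdIm, closure_Ioo (by linarith), closure_Ioo (by linarith)]
    rfl
  rw [h1]
  refine closure_mono fun z hz Q hQ => ?_
  rwa [← eq_of_mem_open_closed hδ hz hQ]

theorem closure_gridDomain {δ : ℝ} (hδ : 0 < δ) (S : Finset (ℤ × ℤ)) :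
    closure (gridDomain δ S) = ⋃ P ∈ S, gridSquare δ P := by
  refine subset_antisymm (closure_minimal ?_ ?_) (Set.iUnion₂_subset fun P hP =>
    gridSquare_subset_closure hδ hP)
  · intro z hz
    obtain ⟨P, hP⟩ := exists_gridSquare hδ z
    exact Set.mem_biUnion (hz P hP) hP
  · exact S.finite_toSet.isClosed_biUnion fun P _ => isClosed_gridSquare δ P

theorem mem_gridSeg_vertical {δ : ℝ} (hδ : 0 < δ) {a b : ℤ} {z : ℂ} (h1 : z.re = δ * a)
    (h2 : δ * b ≤ z.im) (h3 : z.im ≤ δ * b + δ) : z ∈ gridSeg δ ((a, b), (a, b + 1)) := by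
  rw [gridSeg, segment_eq_image']
  refine ⟨(z.im - δ * b) / δ, ⟨div_nonneg (by linarith) hδ.le, by
    rw [div_le_one hδ]; linarith⟩, ?_⟩
  apply Complex.ext
  · simp [gridPt, h1]
  · simp [gridPt]
    field_simp
    ring

theorem mem_gridSeg_horizontal {δ : ℝ} (hδ : 0 < δ) {a b : ℤ} {z : ℂ} (h1 : z.im = δ * b)
    (h2 : δ * a ≤ z.re) (h3 : z.re ≤ δ * a + δ) : z ∈ gridSeg δ ((a, b), (a + 1, b)) := by
  rw [gridSeg, segment_eq_image']
  refine ⟨(z.re - δ * a) / δ, ⟨div_nonneg (by linarith) hδ.le, by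
    rw [div_le_one hδ]; linarith⟩, ?_⟩
  apply Complex.ext
  · simp [gridPt]
    field_simp
    ring
  · simp [gridPt, h1]

theorem exists_gridSeg_of_adjacent {δ : ℝ} (hδ : 0 < δ) {S : Finset (ℤ × ℤ)} {P Q : ℤ × ℤ}
    (hPQ : (P ∈ S ∧ Q ∉ S) ∨ (P ∉ S ∧ Q ∈ S)) {z : ℂ} (hP : z ∈ gridSquare δ P)
    (hQ : z ∈ gridSquare δ Q) (h : Q = (P.1 + 1, P.2) ∨ Q = (P.1, P.2 + 1)) :
    ∃ e ∈ bdryEdges S, z ∈ gridSeg δ e := by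
  obtain ⟨p, p'⟩ := P
  rw [mem_gridSquare] at hP hQ
  obtain ⟨⟨a1, a2⟩, a3, a4⟩ := hP
  obtain ⟨⟨b1, b2⟩, b3, b4⟩ := hQ
  rcases h with rfl | rfl
  · push_cast at b1
    have hz : z ∈ gridSeg δ ((p + 1, p'), (p + 1, p' + 1)) :=
      mem_gridSeg_vertical hδ (by push_cast; linarith) a3 a4
    rcases hPQ with ⟨h1, h2⟩ | ⟨h1, h2⟩
    · exact ⟨((p + 1, p'), (p + 1, p' + 1)), mem_bdryEdges_of h1 h2 (by simp [mem_ccwEdges])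
        (by simp [mem_ccwEdges]), hz⟩
    · exact ⟨((p + 1, p' + 1), (p + 1, p')), mem_bdryEdges_of h2 h1 (by simp [mem_ccwEdges])
        (by simp [mem_ccwEdges]), by rw [← gridSeg_swap]; exact hz⟩
  · push_cast at b3
    have hz : z ∈ gridSeg δ ((p, p' + 1), (p + 1, p' + 1)) :=
      mem_gridSeg_horizontal hδ (by push_cast; linarith) a1 a2
    rcases hPQ with ⟨h1, h2⟩ | ⟨h1, h2⟩
    · exact ⟨((p + 1, p' + 1), (p, p' + 1)), mem_bdryEdges_of h1 h2 (by simp [mem_ccwEdges])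
        (by simp [mem_ccwEdges]), by rw [← gridSeg_swap]; exact hz⟩
    · exact ⟨((p, p' + 1), (p + 1, p' + 1)), mem_bdryEdges_of h2 h1 (by simp [mem_ccwEdges])
        (by simp [mem_ccwEdges]), hz⟩

theorem frontier_gridDomain {δ : ℝ} (hδ : 0 < δ) (S : Finset (ℤ × ℤ)) :
    frontier (gridDomain δ S) = ⋃ e ∈ bdryEdges S, gridSeg δ e := by
  rw [(isOpen_gridDomain hδ S).frontier_eq, closure_gridDomain hδ]
  ext z
  simp only [Set.mem_sdiff, Set.mem_iUnion, exists_prop]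
  constructor
  · rintro ⟨⟨P, hP, hzP⟩, hz⟩
    obtain ⟨Q, hzQ, hQ⟩ : ∃ Q, z ∈ gridSquare δ Q ∧ Q ∉ S := by
      by_contra hc
      push Not at hc
      exact hz hc
    have key : ∀ m n : ℤ, ∀ x : ℝ, δ * m ≤ x → x ≤ δ * n + δ → m ≤ n + 1 := by
      intro m n x h1 h2
      have : δ * m ≤ δ * (n + 1 : ℤ) := by push_cast; linarith
      exact_mod_cast le_of_mul_le_mul_left this hδ
    have hzP' := hzP
    have hzQ' := hzQ
    rw [mem_gridSquare] at hzP' hzQ'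
    have k1 := key _ _ _ hzP'.1.1 hzQ'.1.2
    have k2 := key _ _ _ hzQ'.1.1 hzP'.1.2
    have k3 := key _ _ _ hzP'.2.1 hzQ'.2.2
    have k4 := key _ _ _ hzQ'.2.1 hzP'.2.2
    have step : ∀ P Q : ℤ × ℤ, P ∈ S → Q ∉ S → z ∈ gridSquare δ P → z ∈ gridSquare δ Q →
        ((P.1 = Q.1 ∧ (P.2 = Q.2 + 1 ∨ Q.2 = P.2 + 1)) ∨
          (P.2 = Q.2 ∧ (P.1 = Q.1 + 1 ∨ Q.1 = P.1 + 1))) →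
        ∃ e ∈ bdryEdges S, z ∈ gridSeg δ e := by
      intro P Q hP hQ hzP hzQ h
      rcases h with ⟨h1, h2 | h2⟩ | ⟨h1, h2 | h2⟩
      · exact exists_gridSeg_of_adjacent hδ (Or.inr ⟨hQ, hP⟩) hzQ hzP (Or.inr (Prod.ext h1 h2))
      · exact exists_gridSeg_of_adjacent hδ (Or.inl ⟨hP, hQ⟩) hzP hzQ
          (Or.inr (Prod.ext h1.symm h2))
      · exact exists_gridSeg_of_adjacent hδ (Or.inr ⟨hQ, hP⟩) hzQ hzP (Or.inl (Prod.ext h2 h1))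
      · exact exists_gridSeg_of_adjacent hδ (Or.inl ⟨hP, hQ⟩) hzP hzQ
          (Or.inl (Prod.ext h2 h1.symm))
    -- If `P` and `Q` meet only in a corner, the square `(P.1, Q.2)` also contains `z` and shares a
    -- side with each. Whether it belongs to `S` or not, one of the two pairs straddles a boundary
    -- edge.
    have hzR : z ∈ gridSquare δ (P.1, Q.2) := ⟨hzP.1, hzQ.2⟩
    by_cases e1 : P.1 = Q.1
    · refine step P Q hP hQ hzP hzQ (Or.inl ⟨e1, ?_⟩)
      have : P.2 ≠ Q.2 := fun e2 => hQ (Prod.ext e1 e2 ▸ hP)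
      omega
    · by_cases e2 : P.2 = Q.2
      · exact step P Q hP hQ hzP hzQ (Or.inr ⟨e2, by omega⟩)
      · by_cases hR : (P.1, Q.2) ∈ S
        · exact step _ Q hR hQ hzR hzQ (Or.inr ⟨rfl, by simp only; omega⟩)
        · exact step P _ hP hR hzP hzR (Or.inl ⟨rfl, by simp only; omega⟩)
  · rintro ⟨e, he, hz⟩
    obtain ⟨⟨P, hP, heP⟩, -⟩ := exists_of_mem_bdryEdges he
    exact ⟨⟨P, hP, gridSeg_subset hδ heP hz⟩, gridSeg_disjoint_gridDomain hδ he hz⟩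

theorem int_add_eq {a b : ℤ} {s t : ℝ} (hs : s ∈ Set.Ico (0 : ℝ) 1) (ht : t ∈ Set.Ico (0 : ℝ) 1)
    (h : a + s = b + t) : a = b ∧ s = t := by
  have h1 : a < b + 1 := by
    have : (a : ℝ) < b + 1 := by linarith [hs.1, ht.2]
    exact_mod_cast this
  have h2 : b < a + 1 := by
    have : (b : ℝ) < a + 1 := by linarith [ht.1, hs.2]
    exact_mod_cast this
  have h3 : a = b := by omega
  subst h3
  exact ⟨rfl, by linarith⟩

theorem int_add_eq_sub {a b : ℤ} {s t : ℝ} (hs : s ∈ Set.Ico (0 : ℝ) 1)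
    (ht : t ∈ Set.Ico (0 : ℝ) 1) (h : a + s = b - t) : (a = b ∧ s = t) ∨ b = a + 1 := by
  have h1 : a ≤ b := by
    have : (a : ℝ) ≤ b := by linarith [hs.1, ht.1]
    exact_mod_cast this
  have h2 : b < a + 2 := by
    have : (b : ℝ) < a + 2 := by linarith [ht.2, hs.2]
    exact_mod_cast this
  rcases h1.eq_or_lt with h3 | h3
  · subst h3
    exact Or.inl ⟨rfl, by linarith [hs.1, ht.1]⟩
  · exact Or.inr (by omega)

/-- Half open edges of the grid are disjoint unless they have the same origin or are opposite. -/
theorem gridEdge_inj {δ : ℝ} (hδ : 0 < δ) {P Q : ℤ × ℤ} {e f : (ℤ × ℤ) × (ℤ × ℤ)}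
    (he : e ∈ ccwEdges P) (hf : f ∈ ccwEdges Q) {s t : ℝ} (hs : s ∈ Set.Ico (0 : ℝ) 1)
    (ht : t ∈ Set.Ico (0 : ℝ) 1)
    (h : gridPt δ e.1 + s * (gridPt δ e.2 - gridPt δ e.1) =
      gridPt δ f.1 + t * (gridPt δ f.2 - gridPt δ f.1)) :
    (e.1 = f.1 ∧ s = t) ∨ f = e.swap := by
  have h0 : (0 : ℝ) ∈ Set.Ico (0 : ℝ) 1 := ⟨le_rfl, one_pos⟩
  have hcoord : ∀ e : (ℤ × ℤ) × (ℤ × ℤ), ∀ s : ℝ,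
      gridPt δ e.1 + s * (gridPt δ e.2 - gridPt δ e.1) =
      ⟨δ * (e.1.1 + s * (e.2.1 - e.1.1)), δ * (e.1.2 + s * (e.2.2 - e.1.2))⟩ := by
    intro e s
    apply Complex.ext <;> simp [gridPt] <;> ring
  rw [hcoord, hcoord, Complex.mk.injEq] at h
  obtain ⟨hx, hy⟩ := h
  replace hx := mul_left_cancel₀ hδ.ne' hx
  replace hy := mul_left_cancel₀ hδ.ne' hy
  obtain ⟨⟨a, b⟩, c, d⟩ := e
  obtain ⟨⟨a', b'⟩, c', d'⟩ := f
  have hd : (c = a + 1 ∧ d = b) ∨ (c = a ∧ d = b + 1) ∨ (a = c + 1 ∧ d = b) ∨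
      (c = a ∧ b = d + 1) := by
    simp only [mem_ccwEdges, Prod.mk.injEq] at he
    omega
  have hd' : (c' = a' + 1 ∧ d' = b') ∨ (c' = a' ∧ d' = b' + 1) ∨ (a' = c' + 1 ∧ d' = b') ∨
      (c' = a' ∧ b' = d' + 1) := by
    simp only [mem_ccwEdges, Prod.mk.injEq] at hf
    omega
  simp only [Prod.mk.injEq, Prod.swap_prod_mk] at hx hy ⊢
  have sgn : ∀ {p q : ℤ}, (q = p + 1 ∨ q = p ∨ p = q + 1) →
      ((q : ℝ) - p = 1 ∧ q = p + 1) ∨ ((q : ℝ) - p = 0 ∧ q = p) ∨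
        ((q : ℝ) - p = -1 ∧ p = q + 1) := by
    rintro p q (rfl | rfl | rfl)
    · left; simp
    · right; left; simp
    · right; right; simp
  -- The comparison in a single coordinate, in which each edge moves by `1`, `0` or `-1`. The
  -- conclusions for the two coordinates are combined at the end.
  have main : ∀ {p q p' q' : ℤ}, (q = p + 1 ∨ q = p ∨ p = q + 1) →
      (q' = p' + 1 ∨ q' = p' ∨ p' = q' + 1) →
      (p : ℝ) + s * (q - p) = p' + t * (q' - p') →
      ((q - p = q' - p') → p = p' ∧ (q ≠ p → s = t)) ∧
      (q = p → p = p' ∧ (q' ≠ p' → t = 0)) ∧ (q' = p' → p = p' ∧ (q ≠ p → s = 0)) ∧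
      ((p = p' ∧ s = t) ∨ q' = p ∨ q = p) := by
    intro p q p' q' h1 h2 h3
    rcases sgn h1 with ⟨e1, e1'⟩ | ⟨e1, e1'⟩ | ⟨e1, e1'⟩ <;>
      rcases sgn h2 with ⟨e2, e2'⟩ | ⟨e2, e2'⟩ | ⟨e2, e2'⟩ <;> rw [e1, e2] at h3
    · have := int_add_eq hs ht (a := p) (b := p') (by linarith)
      refine ⟨fun _ => ⟨this.1, fun _ => this.2⟩, fun _ => by omega, fun _ => by omega,
        Or.inl this⟩
    · have := int_add_eq hs h0 (a := p) (b := p') (by linarith)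
      refine ⟨fun _ => by omega, fun _ => by omega, fun _ => ⟨this.1, fun _ => this.2⟩,
        Or.inr (Or.inl (by omega))⟩
    · have := int_add_eq_sub hs ht (a := p) (b := p') (by linarith)
      refine ⟨fun _ => by omega, fun _ => by omega, fun _ => by omega, ?_⟩
      rcases this with h | h
      · exact Or.inl h
      · exact Or.inr (Or.inl (by omega))
    · have := int_add_eq h0 ht (a := p) (b := p') (by linarith)
      refine ⟨fun _ => by omega, fun _ => ⟨this.1, fun _ => this.2.symm⟩, fun _ => by omega,
        Or.inr (Or.inr (by omega))⟩
    · have := int_add_eq h0 h0 (a := p) (b := p') (by linarith)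
      exact ⟨fun _ => ⟨this.1, fun h => absurd e1' h⟩, fun _ => ⟨this.1, fun h => absurd e2' h⟩,
        fun _ => ⟨this.1, fun h => absurd e1' h⟩, Or.inr (Or.inr e1')⟩
    · have := int_add_eq ht h0 (a := p) (b := p') (by linarith)
      refine ⟨fun _ => by omega, fun _ => ⟨this.1, fun _ => this.2⟩, fun _ => by omega,
        Or.inr (Or.inr (by omega))⟩
    · have := int_add_eq_sub ht hs (a := p') (b := p) (by linarith)
      refine ⟨fun _ => by omega, fun _ => by omega, fun _ => by omega, ?_⟩
      rcases this with h | h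
      · exact Or.inl ⟨h.1.symm, h.2.symm⟩
      · exact Or.inr (Or.inl (by omega))
    · have := int_add_eq hs h0 (a := p') (b := p) (by linarith)
      refine ⟨fun _ => by omega, fun _ => by omega, fun _ => ⟨this.1.symm, fun _ => this.2⟩,
        Or.inr (Or.inl (by omega))⟩
    · have := int_add_eq ht hs (a := p) (b := p') (by linarith)
      refine ⟨fun _ => ⟨this.1, fun _ => this.2.symm⟩, fun _ => by omega, fun _ => by omega,
        Or.inl ⟨this.1, this.2.symm⟩⟩
  obtain ⟨x1, x2, x3, x4⟩ := main (by omega) (by omega) hx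
  obtain ⟨y1, y2, y3, y4⟩ := main (by omega) (by omega) hy
  grind

/-- The sides of each square are balanced, hence so are the boundary edges, and their simple cycles
are closed polygons. A polygon is a Jordan curve because half open edges meet only if they have the
same origin or are opposite, and an edge and its opposite are never both boundary edges. The winding
numbers `1` and `0` are Cauchy's formula for `h = 1` and Cauchy's theorem. -/
theorem PositiveBoundary.ofGridDomain {δ : ℝ} (hδ : 0 < δ) (S : Finset (ℤ × ℤ)) :
    Nonempty (PositiveBoundary (gridDomain δ S)) := by
  obtain ⟨n, m, c, hc, hsum⟩ := exists_cycle_decomposition (bdryEdges S) (fun F => by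
    rw [sum_bdryEdges S (fun e => F e.2 - F e.1) (fun e => by simp)]
    refine Finset.sum_eq_zero fun P _ => ?_
    rw [sum_ccwEdges]
    ring)
  have hpi : (2 * Real.pi * I : ℂ) ≠ 0 := by simp [Real.pi_ne_zero]
  set w : Fin n → ℕ → ℂ := fun j i => gridPt δ (c j i) with hw
  have hccw : ∀ e ∈ bdryEdges S, ∃ P, e ∈ ccwEdges P := fun e he => by
    obtain ⟨⟨P, -, h⟩, -⟩ := exists_of_mem_bdryEdges he
    exact ⟨P, h⟩
  have hsimple : ∀ j, Set.InjOn (polygon (m j) (w j)) (Set.Ico 0 1) := by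
    intro j t ht s hs hts
    obtain ⟨hm, -, hinj, hE⟩ := hc j
    have hm' : (0 : ℝ) < m j := by exact_mod_cast hm
    obtain ⟨i, hi, i1, i2⟩ := exists_floor ht hm
    obtain ⟨l, hl, l1, l2⟩ := exists_floor hs hm
    rw [polygon_eq hi (w j) i1 i2.le, polygon_eq hl (w j) l1 l2.le] at hts
    obtain ⟨P, hP⟩ := hccw _ (hE i)
    obtain ⟨Q, hQ⟩ := hccw _ (hE l)
    rcases gridEdge_inj hδ hP hQ ⟨by linarith, by linarith⟩ ⟨by linarith, by linarith⟩ hts with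
      ⟨h1, h2⟩ | h
    · have h3 : i = l := hinj hi hl h1
      subst h3
      exact mul_left_cancel₀ hm'.ne' (by linarith)
    · have h1 := hE l
      have h2 := hE i
      rw [h] at h1
      simp only [bdryEdges, Finset.mem_filter] at h1 h2
      exact absurd h1.1 h2.2
  set γ : Fin n → JordanCurve := fun j =>
    { toFun := polygon (m j) (w j)
      lipschitz := by
        obtain ⟨K, hK⟩ := polygon_lipschitz (m j) (w j)
        exact ⟨K, hK.lipschitzOnWith⟩
      closed := by
        have hm := (hc j).1
        have hm1 : ((m j - 1 : ℕ) : ℝ) = m j - 1 := by rw [Nat.cast_sub hm]; simp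
        have hm2 : m j - 1 + 1 = m j := Nat.sub_add_cancel hm
        rw [polygon_eq hm (w j) (by simp) (by simp),
          polygon_eq (Nat.sub_lt hm one_pos) (w j) (by linarith) (by linarith),
          hm2, hm1]
        simp [hw, (hc j).2.1]
      simple := hsimple j } with hγ
  have htrace : ⋃ j, (γ j).trace = frontier (gridDomain δ S) := by
    rw [frontier_gridDomain hδ]
    have h1 : ∀ j, (γ j).trace = ⋃ i ∈ Finset.range (m j), gridSeg δ (c j i, c j (i + 1)) :=
      fun j => polygon_image (hc j).1 (w j)
    simp only [h1]
    refine subset_antisymm (Set.iUnion_subset fun j => Set.iUnion₂_subset fun i _ =>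
      Set.subset_biUnion_of_mem (u := fun e => gridSeg δ e) ((hc j).2.2.2 i)) ?_
    refine Set.iUnion₂_subset fun e he => ?_
    obtain ⟨j, i, hi, hji⟩ : ∃ j, ∃ i < m j, (c j i, c j (i + 1)) = e := by
      by_contra hne
      push Not at hne
      -- With the indicator of `e` as `G`, an edge on no cycle would give `1 = 0`.
      have h2 := hsum (Pi.single e 1)
      rw [Finset.sum_pi_single', if_pos he, Finset.sum_eq_zero] at h2
      · exact one_ne_zero h2
      · intro j _
        refine Finset.sum_eq_zero fun i hi => ?_
        exact Pi.single_eq_of_ne (hne j i (Finset.mem_range.1 hi)) _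
    intro z hz
    simp only [Set.mem_iUnion, exists_prop]
    exact ⟨j, i, Finset.mem_range.2 hi, hji ▸ hz⟩
  have hindex : ∀ z ∉ frontier (gridDomain δ S), ∑ j, (γ j).index z = (2 * Real.pi * I)⁻¹ *
      ∑ e ∈ bdryEdges S, edgeInt (fun ζ => (ζ - z)⁻¹) (gridPt δ e.1) (gridPt δ e.2) := by
    intro z hz
    rw [hsum, Finset.mul_sum]
    refine Finset.sum_congr rfl fun j _ => ?_
    rw [← integral_polygon (hc j).1 (w j)]
    · simp only [JordanCurve.index, hγ, div_eq_inv_mul]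
    · intro i _
      refine ContinuousOn.inv₀ (by fun_prop) fun ζ hζ h0 => hz ?_
      rw [frontier_gridDomain hδ, ← sub_eq_zero.1 h0]
      exact Set.mem_biUnion ((hc j).2.2.2 i) hζ
  refine ⟨⟨n, γ, htrace, 0, fun z hz => ?_, fun z hz => ?_⟩⟩
  · rw [hindex z fun h => (isOpen_gridDomain hδ S).inter_frontier_eq.subset ⟨hz, h⟩]
    have h1 := sum_edgeInt_cauchy hδ isOpen_univ (fun P _ => Set.subset_univ _)
      (differentiableOn_const (1 : ℂ)) hz
    simp only [one_mul, mul_one] at h1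
    rw [h1, inv_mul_cancel₀ hpi, zero_add]
  · rw [hindex z fun h => hz (frontier_subset_closure h), sum_edgeInt_eq_zero hδ, mul_zero]
    intro P hP
    refine DifferentiableOn.inv (by fun_prop) fun ζ hζ h0 => hz ?_
    rw [← sub_eq_zero.1 h0]
    exact gridSquare_subset_closure hδ hP hζ

/-- Between a compact set, symmetric with respect to the real axis, and an open neighbourhood of it
there is a symmetric open set with a positively oriented boundary. -/
theorem exists_positiveBoundary {K G : Set ℂ} (hK : IsCompact K) (hG : IsOpen G) (hKG : K ⊆ G)
    (hsymm : ∀ z ∈ K, (starRingEnd ℂ) z ∈ K) :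
    ∃ D : Set ℂ, IsOpen D ∧ Bornology.IsBounded D ∧ K ⊆ D ∧ closure D ⊆ G ∧
      (∀ z ∈ D, (starRingEnd ℂ) z ∈ D) ∧ Nonempty (PositiveBoundary D) := by
  obtain ⟨δ, hδ, S, hS, hSG⟩ := exists_grid hK hG hKG
  have hcl : closure (gridDomain δ S) ⊆ ⋃ P ∈ S, gridSquare δ P := (closure_gridDomain hδ S).subset
  -- Conjugation permutes the grid squares: the row from `δn` to `δn + δ` goes to the row that
  -- starts at `δ(-1 - n)`. Hence the selected squares are symmetric like `K`.
  have hsq : ∀ (P : ℤ × ℤ) (z : ℂ), (starRingEnd ℂ) z ∈ gridSquare δ P →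
      z ∈ gridSquare δ (P.1, -1 - P.2) := by
    intro P z hz
    rw [mem_gridSquare] at hz ⊢
    simp only [conj_re, conj_im] at hz
    push_cast
    refine ⟨hz.1, ?_, ?_⟩ <;> linarith [hz.2.1, hz.2.2]
  refine ⟨gridDomain δ S, isOpen_gridDomain hδ S, ?_, fun z hz P hP => (hS P).2 ⟨z, hP, hz⟩,
    hcl.trans (Set.iUnion₂_subset hSG), ?_, PositiveBoundary.ofGridDomain hδ S⟩
  · refine (Bornology.IsBounded.subset ?_ hcl).subset subset_closure
    refine (Bornology.isBounded_biUnion S.finite_toSet).2 fun P _ => ?_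
    exact (Bornology.IsBounded.reProdIm (Metric.isBounded_Icc _ _) (Metric.isBounded_Icc _ _))
  · intro z hz P hP
    have h1 := hz _ (hsq P z hP)
    rw [hS] at h1 ⊢
    obtain ⟨w, hw, hwK⟩ := h1
    refine ⟨(starRingEnd ℂ) w, ?_, hsymm w hwK⟩
    have h2 := hsq (P.1, -1 - P.2) ((starRingEnd ℂ) w) (by simpa using hw)
    simpa using h2

end SCalc

namespace SCalc

/-! ### Slices -/

theorem imUnits.mul_self {I : ℍ[ℝ]} (hI : I ∈ imUnits) : I * I = -1 := by
  obtain ⟨h1, h2⟩ := hI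
  have h3 : Quaternion.normSq I = 1 := by rw [Quaternion.normSq_eq_norm_mul_self, h2, one_mul]
  have h4 : star I = -I := by ext <;> simp [h1]
  have h5 := Quaternion.self_mul_star I
  rw [h4, h3] at h5
  rw [← neg_neg (I * I), ← mul_neg, h5]
  simp

theorem imUnits.star_eq {I : ℍ[ℝ]} (hI : I ∈ imUnits) : star I = -I := by
  ext <;> simp [hI.1]

theorem imUnits.neg_mem {I : ℍ[ℝ]} (hI : I ∈ imUnits) : -I ∈ imUnits := by
  constructor
  · simp [hI.1]
  · rw [norm_neg, hI.2]

theorem isCompact_imUnits : IsCompact imUnits := by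
  refine Metric.isCompact_of_isClosed_isBounded ?_ ?_
  · exact (isClosed_eq Quaternion.continuous_re continuous_const).inter
      (isClosed_eq continuous_norm continuous_const)
  · refine (Metric.isBounded_closedBall (x := (0 : ℍ[ℝ])) (r := 1)).subset fun q hq => ?_
    simp [hq.2]

theorem imUnits_nonempty : imUnits.Nonempty := by
  refine ⟨Quaternion.coeComplex Complex.I, by simp, ?_⟩
  have h : Quaternion.coeComplex Complex.I * Quaternion.coeComplex Complex.I = -1 := by
    rw [← Quaternion.coeComplex_mul, Complex.I_mul_I]
    ext <;> simp
  have h2 := congrArg norm h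
  rw [norm_mul, norm_neg, norm_one] at h2
  exact (mul_self_eq_one_iff.1 h2).resolve_right fun h3 => by
    linarith [norm_nonneg (Quaternion.coeComplex Complex.I)]

theorem quaternion_coe_eq_smul (x : ℝ) : (x : ℍ[ℝ]) = x • (1 : ℍ[ℝ]) := by
  ext <;> simp

/-- The slice parametrization as a continuous real linear map. -/
def sliceL (I : ℍ[ℝ]) : ℂ →L[ℝ] ℍ[ℝ] :=
  Complex.reCLM.smulRight 1 + Complex.imCLM.smulRight I

theorem sliceL_apply (I : ℍ[ℝ]) (z : ℂ) : sliceL I z = slice I z := by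
  simp [sliceL, slice, quaternion_coe_eq_smul]

theorem coe_sliceL (I : ℍ[ℝ]) : ⇑(sliceL I) = slice I := funext (sliceL_apply I)

theorem continuous_slice (I : ℍ[ℝ]) : Continuous (slice I) := coe_sliceL I ▸ (sliceL I).continuous

theorem continuous_slice_uncurry : Continuous fun p : ℍ[ℝ] × ℂ => slice p.1 p.2 := by
  unfold slice
  have : Continuous fun p : ℍ[ℝ] × ℂ => ((p.2.re : ℝ) : ℍ[ℝ]) :=
    Quaternion.continuous_coe.comp (by fun_prop)
  fun_prop

theorem slice_add (I : ℍ[ℝ]) (z w : ℂ) : slice I (z + w) = slice I z + slice I w := by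
  simp only [← sliceL_apply, map_add]

theorem slice_sub (I : ℍ[ℝ]) (z w : ℂ) : slice I (z - w) = slice I z - slice I w := by
  simp only [← sliceL_apply, map_sub]

theorem slice_neg (I : ℍ[ℝ]) (z : ℂ) : slice I (-z) = -slice I z := by
  simp only [← sliceL_apply, map_neg]

@[simp] theorem slice_zero (I : ℍ[ℝ]) : slice I 0 = 0 := by simp [slice]

@[simp] theorem slice_one (I : ℍ[ℝ]) : slice I 1 = 1 := by simp [slice]

@[simp] theorem slice_I (I : ℍ[ℝ]) : slice I Complex.I = I := by simp [slice]

@[simp] theorem slice_ofReal (I : ℍ[ℝ]) (x : ℝ) : slice I x = (x : ℍ[ℝ]) := by simp [slice]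

theorem slice_conj (I : ℍ[ℝ]) (z : ℂ) : slice I ((starRingEnd ℂ) z) = slice (-I) z := by
  simp [slice]

theorem slice_mul {I : ℍ[ℝ]} (hI : I ∈ imUnits) (z w : ℂ) :
    slice I (z * w) = slice I z * slice I w := by
  have h := imUnits.mul_self hI
  simp only [slice, quaternion_coe_eq_smul, add_mul, mul_add, smul_mul_smul_comm, h, one_mul,
    mul_one, Complex.mul_re, Complex.mul_im, sub_smul, add_smul, smul_neg]
  abel

theorem slice_re {I : ℍ[ℝ]} (hI : I ∈ imUnits) (z : ℂ) : (slice I z).re = z.re := by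
  simp [slice, hI.1]

theorem star_slice {I : ℍ[ℝ]} (hI : I ∈ imUnits) (z : ℂ) :
    star (slice I z) = slice I ((starRingEnd ℂ) z) := by
  rw [slice_conj, slice, slice, star_add, Quaternion.star_coe, Quaternion.star_smul,
    imUnits.star_eq hI]

theorem norm_slice {I : ℍ[ℝ]} (hI : I ∈ imUnits) (z : ℂ) : ‖slice I z‖ = ‖z‖ := by
  have h : ((Quaternion.normSq (slice I z) : ℝ) : ℍ[ℝ]) = ((Complex.normSq z : ℝ) : ℍ[ℝ]) := by
    rw [← Quaternion.self_mul_star, star_slice hI, ← slice_mul hI, Complex.mul_conj, slice_ofReal]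
  have h2 : Quaternion.normSq (slice I z) = Complex.normSq z := Quaternion.coe_injective h
  rw [Quaternion.normSq_eq_norm_mul_self, Complex.normSq_eq_norm_sq, sq] at h2
  exact (mul_self_inj (norm_nonneg _) (norm_nonneg _)).1 h2

theorem slice_eq_zero {I : ℍ[ℝ]} (hI : I ∈ imUnits) {z : ℂ} : slice I z = 0 ↔ z = 0 := by
  rw [← norm_eq_zero, norm_slice hI, norm_eq_zero]

theorem slice_inv {I : ℍ[ℝ]} (hI : I ∈ imUnits) (z : ℂ) : slice I z⁻¹ = (slice I z)⁻¹ := by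
  rcases eq_or_ne z 0 with rfl | hz
  · simp
  · refine eq_inv_of_mul_eq_one_left ?_
    rw [← slice_mul hI, inv_mul_cancel₀ hz, slice_one]

theorem exists_slice (q : ℍ[ℝ]) : ∃ I ∈ imUnits, slice I ⟨q.re, ‖q.im‖⟩ = q := by
  by_cases h : q.im = 0
  · obtain ⟨I, hI⟩ := imUnits_nonempty
    refine ⟨I, hI, ?_⟩
    conv_rhs => rw [← Quaternion.re_add_im q, h]
    simp [slice, h]
  · refine ⟨‖q.im‖⁻¹ • q.im, ⟨by simp, ?_⟩, ?_⟩
    · rw [norm_smul, norm_inv, norm_norm, inv_mul_cancel₀ (norm_ne_zero_iff.2 h)]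
    · simp only [slice, smul_smul]
      rw [mul_inv_cancel₀ (norm_ne_zero_iff.2 h), one_smul, Quaternion.re_add_im]

/-! ### Holomorphic functions with values in the quaternions or in an algebra over them -/

/-- `φ` is holomorphic for the complex structure on `ℍ` given by left multiplication by `I`. -/
def LeftHol (I : ℍ[ℝ]) (φ : ℂ → ℍ[ℝ]) (s : Set ℂ) : Prop :=
  ∀ z ∈ s, ∃ φ' : ℂ →L[ℝ] ℍ[ℝ], HasFDerivAt φ φ' z ∧ φ' Complex.I = I * φ' 1

theorem LeftHol.continuousOn {I : ℍ[ℝ]} {φ : ℂ → ℍ[ℝ]} {s : Set ℂ} (h : LeftHol I φ s) :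
    ContinuousOn φ s := fun z hz => by
  obtain ⟨φ', h1, -⟩ := h z hz
  exact h1.continuousAt.continuousWithinAt

theorem LeftHol.mono {I : ℍ[ℝ]} {φ : ℂ → ℍ[ℝ]} {s t : Set ℂ} (h : LeftHol I φ s) (hts : t ⊆ s) :
    LeftHol I φ t := fun z hz => h z (hts hz)

theorem clm_apply_eq {F : Type*} [NormedAddCommGroup F] [NormedSpace ℝ F] (D : ℂ →L[ℝ] F) (w : ℂ) :
    D w = w.re • D 1 + w.im • D Complex.I := by
  conv_lhs => rw [← Complex.re_add_im w]
  rw [map_add, show (w.re : ℂ) = w.re • (1 : ℂ) by simp,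
    show (w.im : ℂ) * Complex.I = w.im • Complex.I by simp, map_smul, map_smul]

theorem leftLinear_apply {I : ℍ[ℝ]} {D : ℂ →L[ℝ] ℍ[ℝ]}
    (hD : D Complex.I = I * D 1) (w : ℂ) : D w = slice I w * D 1 := by
  rw [clm_apply_eq, hD, slice, add_mul, smul_mul_assoc, Quaternion.coe_mul_eq_smul]

/-- Slice regularity in terms of the restrictions to the slices. -/
theorem sliceRegularOn_iff {f : ℍ[ℝ] → ℍ[ℝ]} {Ω : Set ℍ[ℝ]} :
    SliceRegularOn f Ω ↔ (∀ q ∈ Ω, DifferentiableAt ℝ f q) ∧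
      ∀ I ∈ imUnits, LeftHol I (fun z => f (slice I z)) (slice I ⁻¹' Ω) := by
  refine and_congr_right fun hd => forall₂_congr fun I hI => forall₂_congr fun z hz => ?_
  have h1 : HasFDerivAt (fun z => f (slice I z)) ((fderiv ℝ f (slice I z)).comp (sliceL I)) z := by
    have h2 := (hd _ hz).hasFDerivAt
    rw [← sliceL_apply] at h2
    have h3 := h2.comp z (sliceL I).hasFDerivAt
    rw [sliceL_apply] at h3
    exact h3.congr_of_eventuallyEq (Filter.Eventually.of_forall fun w => by
      simp [sliceL_apply])
  have h4 : fderiv ℝ f (slice I z) I = I * fderiv ℝ f (slice I z) 1 ↔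
      (1 / 2 : ℝ) • (fderiv ℝ f (slice I z) 1 + I * fderiv ℝ f (slice I z) I) = 0 := by
    rw [smul_eq_zero_iff_right (by norm_num)]
    constructor
    · intro h
      rw [h, ← mul_assoc, imUnits.mul_self hI]
      simp
    · intro h
      have h5 := congrArg (I * ·) h
      simp only [mul_add, ← mul_assoc, imUnits.mul_self hI, mul_zero, neg_mul, one_mul] at h5
      exact (eq_of_sub_eq_zero (by rw [sub_eq_add_neg]; exact h5)).symm
  rw [← h4]
  constructor
  · intro h
    exact ⟨_, h1, by simpa [sliceL_apply] using h⟩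
  · rintro ⟨D, hD, h⟩
    rw [hD.unique h1] at h
    simpa [sliceL_apply] using h

section algebra

variable {E : Type*} [NormedRing E] [NormedAlgebra ℝ E] (ρ : ℍ[ℝ] →ₐ[ℝ] E)

/-- `R` is holomorphic for the complex structure given by right multiplication by `ρ I`. -/
def RightHol (I : ℍ[ℝ]) (R : ℂ → E) (s : Set ℂ) : Prop :=
  ∀ z ∈ s, ∃ R' : ℂ →L[ℝ] E, HasFDerivAt R R' z ∧ R' Complex.I = R' 1 * ρ I

variable {ρ} in
theorem RightHol.continuousOn {I : ℍ[ℝ]} {R : ℂ → E} {s : Set ℂ} (h : RightHol ρ I R s) :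
    ContinuousOn R s := fun z hz => by
  obtain ⟨φ', h1, -⟩ := h z hz
  exact h1.continuousAt.continuousWithinAt

variable {ρ} in
theorem RightHol.mono {I : ℍ[ℝ]} {R : ℂ → E} {s t : Set ℂ} (h : RightHol ρ I R s) (hts : t ⊆ s) :
    RightHol ρ I R t := fun z hz => h z (hts hz)

/-- An algebra homomorphism from the quaternions as a continuous linear map. -/
def algCLM : ℍ[ℝ] →L[ℝ] E := ρ.toLinearMap.toContinuousLinearMap

theorem algCLM_apply (q : ℍ[ℝ]) : algCLM ρ q = ρ q := rfl

/-- The complex linear functional of `R z * ρ (φ z)` whose real part is `u`. -/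
def scalarForm (I : ℍ[ℝ]) (u : E →L[ℝ] ℝ) (R : ℂ → E) (φ : ℂ → ℍ[ℝ]) (z : ℂ) : ℂ :=
  (u (R z * ρ (φ z)) : ℂ) - (u (R z * ρ (I * φ z)) : ℂ) * Complex.I

/-- Multiplication of the form by a complex number amounts to inserting the corresponding element of
`L_I` between `R` and `φ`. This is how quaternionic contour integrals become real parts of scalar
ones. -/
theorem re_mul_scalarForm (I : ℍ[ℝ]) (u : E →L[ℝ] ℝ) (R : ℂ → E) (φ : ℂ → ℍ[ℝ]) (z w : ℂ) :
    (scalarForm ρ I u R φ z * w).re = u (R z * ρ (slice I w * φ z)) := by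
  rw [slice, add_mul, map_add, mul_add, map_add, Quaternion.coe_mul_eq_smul, smul_mul_assoc,
    map_smul, map_smul, mul_smul_comm, mul_smul_comm, map_smul, map_smul]
  simp [scalarForm]
  ring

/-- Differentiating either factor in the direction `i` instead of `1` inserts `I` at the same place,
between `R` and `φ`. Since `I² = -1`, this is the pair of Cauchy–Riemann equations. -/
theorem differentiableOn_scalarForm {I : ℍ[ℝ]} (hI : I ∈ imUnits) (u : E →L[ℝ] ℝ) {R : ℂ → E}
    {φ : ℂ → ℍ[ℝ]} {s : Set ℂ} (hR : RightHol ρ I R s) (hφ : LeftHol I φ s) :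
    DifferentiableOn ℂ (scalarForm ρ I u R φ) s := by
  intro z hz
  obtain ⟨R', hR1, hR2⟩ := hR z hz
  obtain ⟨φ', hφ1, hφ2⟩ := hφ z hz
  have hI2 := imUnits.mul_self hI
  have key : ∀ q : ℍ[ℝ], ∃ D : ℂ →L[ℝ] ℝ, HasFDerivAt (fun z => u (R z * ρ (q * φ z))) D z ∧
      ∀ w, D w = u (R z * ρ (q * φ' w)) + u (R' w * ρ (q * φ z)) := by
    intro q
    have h1 : HasFDerivAt (fun z => ρ (q * φ z))
        ((algCLM ρ).comp ((ContinuousLinearMap.mul ℝ ℍ[ℝ] q).comp φ')) z :=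
      (algCLM ρ).hasFDerivAt.comp z ((ContinuousLinearMap.mul ℝ ℍ[ℝ] q).hasFDerivAt.comp z hφ1)
    refine ⟨_, u.hasFDerivAt.comp z (hR1.mul' h1), fun w => ?_⟩
    simp [algCLM_apply]
  obtain ⟨D₁, hD₁, h₁⟩ := key 1
  obtain ⟨D₂, hD₂, h₂⟩ := key I
  simp only [one_mul] at hD₁ h₁
  have hg : HasFDerivAt (scalarForm ρ I u R φ) (Complex.ofRealCLM.comp D₁ -
      (ContinuousLinearMap.mul ℝ ℂ Complex.I).comp (Complex.ofRealCLM.comp D₂)) z := by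
    have h3 := (Complex.ofRealCLM.hasFDerivAt.comp z hD₁).sub
      ((ContinuousLinearMap.mul ℝ ℂ Complex.I).hasFDerivAt.comp z
        (Complex.ofRealCLM.hasFDerivAt.comp z hD₂))
    refine h3.congr_of_eventuallyEq (Filter.Eventually.of_forall fun w => ?_)
    simp [scalarForm, mul_comm]
  refine (differentiableAt_complex_iff_differentiableAt_real.2
    ⟨hg.differentiableAt, ?_⟩).differentiableWithinAt
  rw [hg.fderiv]
  have e1 : D₁ Complex.I = D₂ 1 := by
    rw [h₁, h₂, hφ2, hR2, mul_assoc, ← map_mul]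
  have e2 : D₂ Complex.I = -D₁ 1 := by
    rw [h₁, h₂, hφ2, hR2, mul_assoc, ← map_mul, ← mul_assoc, ← mul_assoc, hI2]
    simp only [neg_mul, one_mul, map_neg, mul_neg]
    ring
  simp only [sub_apply, ContinuousLinearMap.comp_apply,
    ContinuousLinearMap.mul_apply', Complex.ofRealCLM_apply, e1, e2, smul_eq_mul]
  apply Complex.ext <;> simp

end algebra

end SCalc

namespace SCalc

/-! ### Regularity of the transported function -/

/-- The largest open set on which `f` is slice regular. -/
def regDomain (f : ℍ[ℝ] → ℍ[ℝ]) : Set ℍ[ℝ] := ⋃₀ {Ω | IsOpen Ω ∧ SliceRegularOn f Ω}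

theorem isOpen_regDomain (f : ℍ[ℝ] → ℍ[ℝ]) : IsOpen (regDomain f) :=
  isOpen_sUnion fun _ h => h.1

theorem sliceRegularOn_regDomain (f : ℍ[ℝ] → ℍ[ℝ]) : SliceRegularOn f (regDomain f) := by
  constructor
  · rintro q ⟨Ω, ⟨-, h⟩, hq⟩
    exact h.1 q hq
  · rintro I hI z ⟨Ω, ⟨-, h⟩, hz⟩
    exact h.2 I hI z hz

theorem subset_regDomain {f : ℍ[ℝ] → ℍ[ℝ]} {Ω : Set ℍ[ℝ]} (h1 : IsOpen Ω)
    (h2 : SliceRegularOn f Ω) : Ω ⊆ regDomain f := Set.subset_sUnion_of_mem ⟨h1, h2⟩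

theorem SliceRegularOn.mono {f : ℍ[ℝ] → ℍ[ℝ]} {Ω Ω' : Set ℍ[ℝ]} (h : SliceRegularOn f Ω)
    (hs : Ω' ⊆ Ω) : SliceRegularOn f Ω' :=
  ⟨fun q hq => h.1 q (hs hq), fun I hI z hz => h.2 I hI z (hs hz)⟩

theorem leftHol_regDomain (f : ℍ[ℝ] → ℍ[ℝ]) {I : ℍ[ℝ]} (hI : I ∈ imUnits) :
    LeftHol I (fun z => f (slice I z)) (slice I ⁻¹' regDomain f) :=
  (sliceRegularOn_iff.1 (sliceRegularOn_regDomain f)).2 I hI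

theorem LeftHol.comp {I : ℍ[ℝ]} (hI : I ∈ imUnits) {φ : ℂ → ℍ[ℝ]} {s t : Set ℂ}
    (h : LeftHol I φ t) {g : ℂ → ℂ} (hg : ∀ z ∈ s, DifferentiableAt ℂ g z)
    (hst : Set.MapsTo g s t) : LeftHol I (fun z => φ (g z)) s := by
  intro z hz
  obtain ⟨D, hD, hD'⟩ := h _ (hst hz)
  refine ⟨_, hD.comp z ((hg z hz).hasFDerivAt.restrictScalars ℝ), ?_⟩
  simp only [ContinuousLinearMap.comp_apply, ContinuousLinearMap.coe_restrictScalars']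
  rw [leftLinear_apply hD', leftLinear_apply hD' (fderiv ℂ g z 1),
    show fderiv ℂ g z Complex.I = Complex.I * fderiv ℂ g z 1 by
      rw [← smul_eq_mul, ← map_smul, smul_eq_mul, mul_one], slice_mul hI, slice_I, mul_assoc]

theorem LeftHol.congr {I : ℍ[ℝ]} {φ ψ : ℂ → ℍ[ℝ]} {s : Set ℂ} (hs : IsOpen s)
    (h : LeftHol I φ s) (hφψ : Set.EqOn ψ φ s) : LeftHol I ψ s := by
  intro z hz
  obtain ⟨D, hD, hD'⟩ := h z hz
  exact ⟨D, hD.congr_of_eventuallyEq (hφψ.eventuallyEq_of_mem (hs.mem_nhds hz)), hD'⟩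

theorem transport_of_ne (f : ℍ[ℝ] → ℍ[ℝ]) (c : ℍ[ℝ]) (k : ℝ) {p : ℍ[ℝ]} (hp : p ≠ 0) :
    transport f c k p = f (p⁻¹ + k) := by
  simp [transport, hp]

theorem transport_zero (f : ℍ[ℝ] → ℍ[ℝ]) (c : ℍ[ℝ]) (k : ℝ) : transport f c k 0 = c := by
  simp [transport]

theorem isOpen_inv_preimage {Ω : Set ℍ[ℝ]} (hΩ : IsOpen Ω) (k : ℝ) :
    IsOpen {p : ℍ[ℝ] | p ≠ 0 ∧ p⁻¹ + k ∈ Ω} := by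
  have : ContinuousOn (fun p : ℍ[ℝ] => p⁻¹ + k) {0}ᶜ := continuousOn_inv₀.add continuousOn_const
  exact this.isOpen_inter_preimage isOpen_compl_singleton hΩ

/-- As `k` is real, `p ↦ p⁻¹ + k` maps every line `L_I` to itself and acts there as the complex
holomorphic map `z ↦ z⁻¹ + k`. -/
theorem sliceRegularOn_transport {f : ℍ[ℝ] → ℍ[ℝ]} (c : ℍ[ℝ]) (k : ℝ) {Ω : Set ℍ[ℝ]}
    (hΩ : IsOpen Ω) (hf : SliceRegularOn f Ω) :
    SliceRegularOn (transport f c k) {p | p ≠ 0 ∧ p⁻¹ + k ∈ Ω} := by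
  have ho := isOpen_inv_preimage hΩ k
  rw [sliceRegularOn_iff] at hf ⊢
  refine ⟨fun q hq => ?_, fun I hI => ?_⟩
  · have h1 : DifferentiableAt ℝ (fun p : ℍ[ℝ] => f (p⁻¹ + k)) q :=
      DifferentiableAt.comp (g := f) q (hf.1 _ hq.2)
        ((DifferentiableAt.inv differentiableAt_id hq.1).add_const _)
    refine h1.congr_of_eventuallyEq ?_
    filter_upwards [isOpen_compl_singleton.mem_nhds hq.1] with p hp using transport_of_ne f c k hp
  · have h1 : LeftHol I (fun z => f (slice I (z⁻¹ + k)))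
        (slice I ⁻¹' {p | p ≠ 0 ∧ p⁻¹ + k ∈ Ω}) := by
      refine (hf.2 I hI).comp hI (g := fun z => z⁻¹ + k) ?_ ?_
      · intro z hz
        have hz0 : z ≠ 0 := fun h => hz.1 ((slice_eq_zero hI).2 h)
        exact (differentiableAt_inv hz0).add_const _
      · intro z hz
        change slice I (z⁻¹ + k) ∈ Ω
        rw [slice_add, slice_inv hI, slice_ofReal]
        exact hz.2
    refine h1.congr (ho.preimage (continuous_slice I)) fun z hz => ?_
    rw [transport_of_ne f c k hz.1, slice_add, slice_inv hI, slice_ofReal]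

/-- The Schwarz lemma of second order for `g z - z g'(0)`. The point is that the constant depends on
`B` and `r` only, so that it can be used uniformly over the slices. -/
theorem norm_sub_linear_le {g : ℂ → ℂ} {r B : ℝ} (hr : 0 < r)
    (hg : DifferentiableOn ℂ g (Metric.ball 0 r)) (hB : ∀ z ∈ Metric.ball 0 r, ‖g z - g 0‖ ≤ B)
    {z : ℂ} (hz : z ∈ Metric.ball (0 : ℂ) r) :
    ‖g z - g 0 - z * deriv g 0‖ ≤ 2 * B / r ^ 2 * ‖z‖ ^ 2 := by
  have h0 : (0 : ℂ) ∈ Metric.ball (0 : ℂ) r := Metric.mem_ball_self hr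
  have hd := Complex.norm_deriv_le_div_of_mapsTo_ball hg
    (fun z hz => by rw [mem_closedBall_iff_norm]; exact hB z hz) hr
  have hdiff : DifferentiableOn ℂ (fun z => g z - z * deriv g 0) (Metric.ball 0 r) :=
    hg.sub (differentiableOn_id.mul_const _)
  have hg0 : HasDerivAt g (deriv g 0) 0 :=
    (hg.differentiableAt (Metric.isOpen_ball.mem_nhds h0)).hasDerivAt
  have key := Complex.dist_le_mul_div_pow_of_mapsTo_ball_of_isLittleO (n := 1) (R₂ := 2 * B)
    hdiff (fun z hz => by
      rw [mem_closedBall_iff_norm]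
      have h1 := hB z hz
      rw [mem_ball_zero_iff] at hz
      -- Cauchy's estimate `‖g'(0)‖ ≤ B / r` bounds the linear term by `B`, whence the total `2B`.
      have h2 : ‖z * deriv g 0‖ ≤ B := by
        rw [norm_mul]
        calc ‖z‖ * ‖deriv g 0‖ ≤ r * (B / r) := by gcongr
          _ = B := by field_simp
      calc ‖g z - z * deriv g 0 - (g 0 - 0 * deriv g 0)‖ = ‖(g z - g 0) - z * deriv g 0‖ := by
            congr 1; ring
        _ ≤ 2 * B := (norm_sub_le _ _).trans (by linarith)) (by
      have h3 := (Asymptotics.isLittleO_norm_right.2 hg0.isLittleO)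
      refine h3.congr (fun z => ?_) fun z => by rw [pow_one]
      simp
      ring) hz
  rw [dist_eq_norm, dist_zero_right] at key
  calc ‖g z - g 0 - z * deriv g 0‖ = ‖g z - z * deriv g 0 - (g 0 - 0 * deriv g 0)‖ := by
        congr 1; ring
    _ ≤ 2 * B * (‖z‖ / r) ^ (1 + 1) := key
    _ = _ := by ring

theorem rightHol_const {E : Type*} [NormedRing E] [NormedAlgebra ℝ E] (ρ : ℍ[ℝ] →ₐ[ℝ] E)
    (I : ℍ[ℝ]) (e : E) (s : Set ℂ) : RightHol ρ I (fun _ => e) s := fun z _ =>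
  ⟨0, hasFDerivAt_const e z, by simp⟩

theorem hasDerivAt_of_forall_dual {F : Type*} [NormedAddCommGroup F] [NormedSpace ℝ F]
    [FiniteDimensional ℝ F] {h : ℝ → F} {x : ℝ}
    (H : ∀ u : F →L[ℝ] ℝ, ∃ d, HasDerivAt (fun t => u (h t)) d x) : ∃ a, HasDerivAt h a x := by
  choose d hd using H
  set b := Module.finBasis ℝ F
  refine ⟨∑ i, d (b.coord i).toContinuousLinearMap • b i, ?_⟩
  have := HasDerivAt.fun_sum (u := Finset.univ) fun i _ =>
    (hd (b.coord i).toContinuousLinearMap).smul_const (b i)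
  refine this.congr_of_eventuallyEq (Filter.Eventually.of_forall fun t => ?_)
  simp [b.sum_repr]

/-- On each slice the singularity is removable, and the slice derivative is determined by the
derivative `a` along the real axis, common to all slices. The quadratic error bound is uniform in
`I`, so the slices assemble to differentiability in all of `ℍ`, with derivative `q ↦ q a`. -/
theorem hasFDerivAt_of_slices {φ : ℍ[ℝ] → ℍ[ℝ]} {r : ℝ} (hr : 0 < r)
    (hφ : ∀ I ∈ imUnits, LeftHol I (fun z => φ (slice I z)) (Metric.ball 0 r \ {0}))
    (hc : ContinuousAt φ 0) (hb : ∀ q ∈ Metric.ball 0 r, ‖φ q - φ 0‖ ≤ 1) :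
    ∃ a, HasFDerivAt φ ((ContinuousLinearMap.mul ℝ ℍ[ℝ]).flip a) 0 := by
  set ρ := AlgHom.id ℝ ℍ[ℝ]
  set g : ℍ[ℝ] → (ℍ[ℝ] →L[ℝ] ℝ) → ℂ → ℂ := fun I u =>
    scalarForm ρ I u (fun _ => 1) fun z => φ (slice I z) with hgdef
  have hgval : ∀ I u z, g I u z = (u (φ (slice I z)) : ℂ) - (u (I * φ (slice I z)) : ℂ) *
      Complex.I := fun I u z => by simp [hgdef, scalarForm, ρ]
  have h0 : (0 : ℂ) ∈ Metric.ball (0 : ℂ) r := Metric.mem_ball_self hr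
  have hg : ∀ I ∈ imUnits, ∀ u, DifferentiableOn ℂ (g I u) (Metric.ball 0 r) := by
    intro I hI u
    refine (Complex.differentiableOn_compl_singleton_and_continuousAt_iff
      (Metric.isOpen_ball.mem_nhds h0)).1 ⟨differentiableOn_scalarForm ρ hI u
        (rightHol_const ρ I 1 _) (hφ I hI), ?_⟩
    have h1 : ContinuousAt (fun z => φ (slice I z)) 0 :=
      ContinuousAt.comp (g := φ) (by rw [slice_zero]; exact hc) (continuous_slice I).continuousAt
    rw [show g I u = fun z => (u (φ (slice I z)) : ℂ) - (u (I * φ (slice I z)) : ℂ) *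
      Complex.I from funext (hgval I u)]
    have h2 : ContinuousAt (fun z => u (φ (slice I z))) 0 := u.continuous.continuousAt.comp h1
    have h3 : ContinuousAt (fun z => u (I * φ (slice I z))) 0 :=
      u.continuous.continuousAt.comp (continuousAt_const.mul h1)
    exact (Complex.continuous_ofReal.continuousAt.comp h2).sub
      ((Complex.continuous_ofReal.continuousAt.comp h3).mul continuousAt_const)
  have hgd : ∀ I ∈ imUnits, ∀ u, HasDerivAt (g I u) (deriv (g I u) 0) ((0 : ℝ) : ℂ) := by
    intro I hI u
    rw [Complex.ofReal_zero]
    exact ((hg I hI u).differentiableAt (Metric.isOpen_ball.mem_nhds h0)).hasDerivAt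
  obtain ⟨a, ha⟩ : ∃ a, HasDerivAt (fun x : ℝ => φ x) a 0 := by
    refine hasDerivAt_of_forall_dual fun u => ?_
    obtain ⟨I, hI⟩ := imUnits_nonempty
    refine ⟨_, (hgd I hI u).real_of_complex.congr_of_eventuallyEq
      (Filter.Eventually.of_forall fun x => ?_)⟩
    simp [hgval]
  have hderiv : ∀ I ∈ imUnits, ∀ u : ℍ[ℝ] →L[ℝ] ℝ,
      deriv (g I u) 0 = (u a : ℂ) - (u (I * a) : ℂ) * Complex.I := by
    intro I hI u
    have h1 := (hgd I hI u).comp_ofReal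
    have h2 : HasDerivAt (fun x : ℝ => u (φ x)) (u a) 0 := u.hasFDerivAt.comp_hasDerivAt _ ha
    have h3 : HasDerivAt (fun x : ℝ => u (I * φ x)) (u (I * a)) 0 :=
      u.hasFDerivAt.comp_hasDerivAt _ (ha.const_mul I)
    have h4 := h2.ofReal_comp.sub (h3.ofReal_comp.mul_const Complex.I)
    refine h1.unique (h4.congr_of_eventuallyEq (Filter.Eventually.of_forall fun x => ?_))
    simp [hgval]
  have hbound : ∀ q ∈ Metric.ball (0 : ℍ[ℝ]) r, ‖φ q - φ 0 - q * a‖ ≤ 4 / r ^ 2 * ‖q‖ ^ 2 := by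
    intro q hq
    obtain ⟨I, hI, hIq⟩ := exists_slice q
    set z : ℂ := ⟨q.re, ‖q.im‖⟩
    have hzq : ‖z‖ = ‖q‖ := by rw [← hIq, norm_slice hI]
    have hI1 : ∀ p : ℍ[ℝ], ‖I * p‖ = ‖p‖ := fun p => by rw [norm_mul, hI.2, one_mul]
    refine NormedSpace.norm_le_dual_bound ℝ _ (by positivity) fun u => ?_
    -- Both parts of the scalar function vary by at most `‖u‖`, so `B = 2‖u‖`. This yields the
    -- constant `4 / r²`, independent of `I`.
    have h1 := norm_sub_linear_le (B := 2 * ‖u‖) hr (hg I hI u) (fun w hw => by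
      have h2 := hb (slice I w) (by rwa [mem_ball_zero_iff, norm_slice hI, ← mem_ball_zero_iff])
      have h3 : g I u w - g I u 0 = (u (φ (slice I w) - φ 0) : ℂ) -
          (u (I * (φ (slice I w) - φ 0)) : ℂ) * Complex.I := by
        simp only [hgval, slice_zero, mul_sub, map_sub]
        push_cast
        ring
      rw [h3]
      refine (norm_sub_le _ _).trans ?_
      rw [norm_mul, Complex.norm_I, mul_one, Complex.norm_real, Complex.norm_real]
      have h4 := u.le_opNorm (φ (slice I w) - φ 0)
      have h5 := u.le_opNorm (I * (φ (slice I w) - φ 0))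
      rw [hI1] at h5
      nlinarith [norm_nonneg u]) (z := z) (by rwa [mem_ball_zero_iff, hzq, ← mem_ball_zero_iff])
    rw [hderiv I hI u, hzq] at h1
    have h2 : (g I u z - g I u 0 - z * ((u a : ℂ) - (u (I * a) : ℂ) * Complex.I)).re =
        u (φ q - φ 0 - q * a) := by
      have h3 : q * a = z.re • a + z.im • (I * a) := by
        rw [← hIq, slice, add_mul, smul_mul_assoc, Quaternion.coe_mul_eq_smul]
      rw [h3, map_sub, map_sub, map_add, map_smul, map_smul]
      simp [hgval, hIq]
    rw [← h2, Real.norm_eq_abs]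
    refine (Complex.abs_re_le_norm _).trans (h1.trans (le_of_eq ?_))
    ring
  refine ⟨a, ?_⟩
  rw [hasFDerivAt_iff_isLittleO_nhds_zero]
  refine Asymptotics.IsBigO.trans_isLittleO (g := fun q : ℍ[ℝ] => ‖q‖ ^ 2) ?_
    (Asymptotics.isLittleO_norm_pow_id one_lt_two)
  refine Asymptotics.IsBigO.of_bound (4 / r ^ 2) ?_
  filter_upwards [Metric.ball_mem_nhds (0 : ℍ[ℝ]) hr] with q hq
  simpa using hbound q hq

theorem tendsto_inv_add_cobounded {𝕜 : Type*} [NormedDivisionRing 𝕜] (k : 𝕜) :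
    Filter.Tendsto (fun p : 𝕜 => p⁻¹ + k) (𝓝[≠] 0) (Bornology.cobounded 𝕜) := by
  rw [← tendsto_norm_atTop_iff_cobounded]
  have h := Filter.tendsto_atTop_add_const_right _ (-‖k‖)
    (tendsto_norm_cobounded_atTop.comp (Filter.tendsto_inv₀_nhdsNE_zero (α := 𝕜)))
  refine Filter.tendsto_atTop_mono (fun p => ?_) h
  have := norm_sub_norm_le p⁻¹ (-k)
  rw [norm_neg, sub_neg_eq_add] at this
  simpa [sub_eq_add_neg] using this

/-- If `f` is regular at infinity then its transport is regular at `0`. -/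
theorem zero_mem_regDomain_transport {f : ℍ[ℝ] → ℍ[ℝ]} {c : ℍ[ℝ]} (hf : RegularAtInfty f c)
    (k : ℝ) : 0 ∈ regDomain (transport f c k) := by
  obtain ⟨⟨R, hR⟩, hlim⟩ := hf
  have hΩ : IsOpen {q : ℍ[ℝ] | R < ‖q‖} := isOpen_lt continuous_const continuous_norm
  set φ := transport f c k with hφ
  have hreg := sliceRegularOn_transport c k hΩ hR
  have htend := tendsto_inv_add_cobounded (k : ℍ[ℝ])
  have hev1 : ∀ᶠ p : ℍ[ℝ] in 𝓝[≠] 0, R < ‖p⁻¹ + (k : ℍ[ℝ])‖ :=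
    htend.eventually (tendsto_norm_cobounded_atTop.eventually (Filter.eventually_gt_atTop R))
  have hlim2 : Filter.Tendsto φ (𝓝[≠] 0) (𝓝 c) := by
    refine (hlim.comp htend).congr' ?_
    filter_upwards [self_mem_nhdsWithin] with p hp using (transport_of_ne f c k hp).symm
  have hcont : ContinuousAt φ 0 := by
    rw [continuousAt_iff_punctured_nhds, hφ, transport_zero]
    exact hlim2
  have hev2 : ∀ᶠ p in 𝓝 (0 : ℍ[ℝ]), ‖φ p - φ 0‖ ≤ 1 := by
    filter_upwards [hcont.eventually (Metric.closedBall_mem_nhds (φ 0) one_pos)] with p hp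
    rwa [dist_eq_norm] at hp
  rw [eventually_nhdsWithin_iff] at hev1
  obtain ⟨r, hr, hball⟩ := Metric.eventually_nhds_iff_ball.1 (hev1.and hev2)
  have hsub : Metric.ball 0 r \ {0} ⊆ {p : ℍ[ℝ] | p ≠ 0 ∧ p⁻¹ + k ∈ {q : ℍ[ℝ] | R < ‖q‖}} :=
    fun p hp => ⟨hp.2, (hball p hp.1).1 hp.2⟩
  have hreg' := sliceRegularOn_iff.1 (hreg.mono hsub)
  obtain ⟨a, ha⟩ := hasFDerivAt_of_slices hr (φ := φ) (fun I hI => (hreg'.2 I hI).mono fun z hz =>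
    ⟨by rw [mem_ball_zero_iff, norm_slice hI, ← mem_ball_zero_iff]; exact hz.1,
      fun h => hz.2 ((slice_eq_zero hI).1 h)⟩) hcont fun q hq => (hball q hq).2
  refine subset_regDomain (f := φ) (Metric.isOpen_ball (x := 0) (ε := r)) ?_
    (Metric.mem_ball_self hr)
  rw [sliceRegularOn_iff]
  constructor
  · intro q hq
    by_cases hq0 : q = 0
    · rw [hq0]; exact ha.differentiableAt
    · exact hreg'.1 q ⟨hq, hq0⟩
  · intro I hI z hz
    by_cases hz0 : z = 0
    · subst hz0
      refine ⟨((ContinuousLinearMap.mul ℝ ℍ[ℝ]).flip a).comp (sliceL I), ?_, ?_⟩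
      · rw [← slice_zero I, ← sliceL_apply] at ha
        have h := ha.comp (0 : ℂ) (sliceL I).hasFDerivAt
        exact h.congr_of_eventuallyEq (Filter.Eventually.of_forall fun w => by
          simp [sliceL_apply])
      · simp [sliceL_apply]
    · exact hreg'.2 I hI z ⟨hz, fun h => hz0 ((slice_eq_zero hI).1 h)⟩

end SCalc

namespace SCalc

open MeasureTheory

/-! ### Transformations of chains -/

namespace Chain

/-- The image of a chain under `p ↦ p⁻¹ + k`. -/
def invAdd (c : Chain) (h0 : 0 ∉ c.trace) (k : ℂ) : Chain where
  ι := c.ι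
  pos j t := (c.pos j t)⁻¹ + k
  vel j t := -((c.pos j t)⁻¹ ^ 2 * c.vel j t)
  continuousOn_pos j := ((c.continuousOn_pos j).inv₀ fun t ht h => h0 (h ▸ c.mem_trace j ht)).add
    continuousOn_const
  aestronglyMeasurable_vel j := by
    have h1 : ContinuousOn (fun t => (c.pos j t)⁻¹ ^ 2) (Set.Icc (0 : ℝ) 1) :=
      ((c.continuousOn_pos j).inv₀ fun t ht h => h0 (h ▸ c.mem_trace j ht)).pow 2
    exact (((h1.mono Set.Ioo_subset_Icc_self).aestronglyMeasurable measurableSet_Ioo).mul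
      (c.aestronglyMeasurable_vel j)).neg
  bounded_vel j := by
    have h1 : ContinuousOn (fun t => (c.pos j t)⁻¹ ^ 2) (Set.Icc (0 : ℝ) 1) :=
      ((c.continuousOn_pos j).inv₀ fun t ht h => h0 (h ▸ c.mem_trace j ht)).pow 2
    obtain ⟨M, hM⟩ := isCompact_Icc.exists_bound_of_continuousOn h1
    obtain ⟨N, hN⟩ := c.bounded_vel j
    refine ⟨M * N, fun t ht => ?_⟩
    have h2 := hM t (Set.Ioo_subset_Icc_self ht)
    rw [norm_neg, norm_mul]
    exact mul_le_mul h2 (hN t ht) (norm_nonneg _) ((norm_nonneg _).trans h2)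

/-- The complex conjugate of a chain, with the orientation reversed. -/
def conjNeg (c : Chain) : Chain where
  ι := c.ι
  pos j t := (starRingEnd ℂ) (c.pos j t)
  vel j t := -(starRingEnd ℂ) (c.vel j t)
  continuousOn_pos j := Complex.continuous_conj.comp_continuousOn (c.continuousOn_pos j)
  aestronglyMeasurable_vel j :=
    (Complex.continuous_conj.comp_aestronglyMeasurable (c.aestronglyMeasurable_vel j)).neg
  bounded_vel j := by simpa using c.bounded_vel j

theorem integral_conjNeg (c : Chain) (z : ℂ) : c.conjNeg.integral (fun ζ => (ζ - z)⁻¹) =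
    -(starRingEnd ℂ) (c.integral fun ζ => (ζ - (starRingEnd ℂ) z)⁻¹) := by
  change ∑ j : c.ι, _ = -(starRingEnd ℂ) (∑ j : c.ι, _)
  rw [map_sum, ← Finset.sum_neg_distrib]
  refine Finset.sum_congr rfl fun j _ => ?_
  have h1 : ∀ F : ℝ → ℂ, (starRingEnd ℂ) (∫ t in (0 : ℝ)..1, F t) =
      ∫ t in (0 : ℝ)..1, (starRingEnd ℂ) (F t) := fun F => by
    rw [intervalIntegral.integral_of_le zero_le_one, intervalIntegral.integral_of_le zero_le_one,
      integral_conj]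
  rw [h1, ← intervalIntegral.integral_neg]
  simp [conjNeg]

/-- Conjugation reverses the orientation and the sign in `vel` restores it, so a symmetric region is
enclosed as before. -/
theorem Encloses.conjNeg {c : Chain} {W C : Set ℂ} (hc : c.Encloses 0 W C)
    (hW : ∀ z ∈ W, (starRingEnd ℂ) z ∈ W) (hC : ∀ z ∈ C, (starRingEnd ℂ) z ∈ C) :
    c.conjNeg.Encloses 0 W C where
  isOpen := hc.isOpen
  isClosed := hc.isClosed
  subset := hc.subset
  trace_subset := by
    rintro _ ⟨j, t, ht, rfl⟩
    have h := hc.trace_subset (c.mem_trace j ht)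
    exact ⟨hC _ h.1, fun h2 => h.2 (by simpa [Chain.conjNeg] using hW _ h2)⟩
  inside z hz := by
    rw [integral_conjNeg, hc.inside _ (hW z hz)]
    simp [map_ofNat]
  outside z hz := by
    rw [integral_conjNeg, hc.outside _ fun h => hz (by simpa using hC _ h)]
    simp

theorem Encloses.zero_notMem {c : Chain} {a : ℂ} {W C : Set ℂ} (hc : c.Encloses a W C)
    (h0 : 0 ∈ W) : 0 ∉ c.trace := fun h => (hc.trace_subset h).2 h0

theorem integral_invAdd {c : Chain} (h0 : 0 ∉ c.trace) (k : ℂ) (g : ℂ → ℂ) :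
    (c.invAdd h0 k).integral g = c.integral fun ζ => -(g (ζ⁻¹ + k) * ζ⁻¹ ^ 2) := by
  change ∑ j : c.ι, _ = ∑ j : c.ι, _
  refine Finset.sum_congr rfl fun j _ => ?_
  congr 1
  ext t
  simp only [invAdd]
  ring

/-- The winding number of the image about `w` is that of `c` about `(w - k)⁻¹` minus that about `0`,
by a partial fraction identity. The latter is `1`, so the constant drops from `0` to `-1`: the image
encloses a neighbourhood of infinity. -/
theorem Encloses.invAdd {c : Chain} {W C : Set ℂ} (hc : c.Encloses 0 W C)
    (hb : Bornology.IsBounded C) (h0 : 0 ∈ W) (k : ℂ) :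
    (c.invAdd (hc.zero_notMem h0) k).Encloses (-1) {w | w ≠ k ∧ (w - k)⁻¹ ∈ W}
      {w | w ≠ k ∧ (w - k)⁻¹ ∈ C} where
  isOpen := by
    have : ContinuousOn (fun w : ℂ => (w - k)⁻¹) {k}ᶜ :=
      ContinuousOn.inv₀ (by fun_prop) fun w hw => sub_ne_zero.2 hw
    exact this.isOpen_inter_preimage isOpen_compl_singleton hc.isOpen
  isClosed := by
    -- Boundedness of `C` keeps its image at distance at least `M⁻¹` from `k`, so removing the point
    -- `k` does no harm to closedness.
    obtain ⟨M, hM0, hM⟩ := hb.exists_pos_norm_le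
    have hs : IsClosed {w : ℂ | M⁻¹ ≤ ‖w - k‖} := isClosed_le continuous_const (by fun_prop)
    have hne : ∀ w : ℂ, M⁻¹ ≤ ‖w - k‖ → w ≠ k := by
      rintro w hw rfl
      rw [sub_self, norm_zero] at hw
      exact absurd hw (not_le.2 (inv_pos.2 hM0))
    have hcont : ContinuousOn (fun w : ℂ => (w - k)⁻¹) {w : ℂ | M⁻¹ ≤ ‖w - k‖} :=
      ContinuousOn.inv₀ (by fun_prop) fun w hw => sub_ne_zero.2 (hne w hw)
    convert hcont.preimage_isClosed_of_isClosed hs hc.isClosed using 1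
    ext w
    simp only [Set.mem_ofPred_eq, Set.mem_inter_iff, Set.mem_preimage]
    refine and_congr_left fun h => ⟨fun hw => ?_, hne w⟩
    have h1 := hM _ h
    rw [norm_inv] at h1
    exact inv_le_of_inv_le₀ (norm_pos_iff.2 (sub_ne_zero.2 hw)) h1
  subset w hw := ⟨hw.1, hc.subset hw.2⟩
  trace_subset := by
    rintro _ ⟨j, t, ht, rfl⟩
    have h := hc.trace_subset (c.mem_trace j ht)
    have hne : c.pos j t ≠ 0 := fun h1 => hc.zero_notMem h0 (h1 ▸ c.mem_trace j ht)
    have e : (c.pos j t)⁻¹ + k - k = (c.pos j t)⁻¹ := add_sub_cancel_right _ _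
    refine ⟨⟨?_, ?_⟩, ?_⟩
    · simpa [Chain.invAdd] using hne
    · simp only [Chain.invAdd, e, inv_inv]
      exact h.1
    · simp only [Chain.invAdd, Set.mem_ofPred_eq, e, inv_inv, not_and]
      exact fun _ => h.2
  inside := by
    rintro w ⟨hwk, hw⟩
    have hw' : (w - k)⁻¹ ∉ c.trace := fun h => (hc.trace_subset h).2 hw
    rw [integral_invAdd_inv_sub hc h0 hwk hw', hc.inside _ hw]
    ring
  outside := by
    intro w hw
    -- The point `w = k` corresponds to `p = ∞`. There the integrand becomes `-ζ⁻¹`, and the index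
    -- is minus the one about `0`.
    by_cases hwk : w = k
    · subst hwk
      rw [integral_invAdd, c.integral_congr (h := fun ζ => (-1) * (ζ - 0)⁻¹), c.integral_const_mul,
        hc.inside 0 h0]
      · ring
      · intro ζ hζ
        have hζ0 : ζ ≠ 0 := fun h => hc.zero_notMem h0 (h ▸ hζ)
        simp only [add_sub_cancel_right, inv_inv, sub_zero]
        field_simp
    · have hw2 : (w - k)⁻¹ ∉ C := fun h => hw ⟨hwk, h⟩
      have hw' : (w - k)⁻¹ ∉ c.trace := fun h => hw2 (hc.trace_subset h).1
      rw [integral_invAdd_inv_sub hc h0 hwk hw', hc.outside _ hw2]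
      ring
where
  integral_invAdd_inv_sub {c : Chain} {W C : Set ℂ} (hc : c.Encloses 0 W C) (h0 : 0 ∈ W) {w k : ℂ}
      (hwk : w ≠ k) (hw : (w - k)⁻¹ ∉ c.trace) :
      (c.invAdd (hc.zero_notMem h0) k).integral (fun ζ => (ζ - w)⁻¹) =
        c.integral (fun ζ => (ζ - (w - k)⁻¹)⁻¹) - 2 * Real.pi * Complex.I := by
    have hc0 := hc.inside 0 h0
    simp only [zero_add, mul_one] at hc0
    rw [integral_invAdd, ← hc0, ← c.integral_fun_sub]
    · refine c.integral_congr fun ζ hζ => ?_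
      have hζ0 : ζ ≠ 0 := fun h => hc.zero_notMem h0 (h ▸ hζ)
      have h1 : ζ - (w - k)⁻¹ ≠ 0 := sub_ne_zero.2 fun h => hw (h ▸ hζ)
      have h2 : w - k ≠ 0 := sub_ne_zero.2 hwk
      have h3 : ζ * (w - k) - 1 ≠ 0 := by
        intro h
        apply h1
        field_simp
        rw [h, mul_zero]
      have e1 : ζ⁻¹ + k - w = -(ζ * (w - k) - 1) / ζ := by field_simp; ring
      have e2 : ζ - (w - k)⁻¹ = (ζ * (w - k) - 1) / (w - k) := by field_simp
      simp only [sub_zero]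
      rw [e1, e2]
      field_simp
      ring
    · exact ContinuousOn.inv₀ (by fun_prop) fun ζ hζ => sub_ne_zero.2 fun h => hw (h ▸ hζ)
    · exact ContinuousOn.inv₀ (by fun_prop) fun ζ hζ => sub_ne_zero.2 fun h =>
        hc.zero_notMem h0 (h ▸ hζ)

end Chain

/-! ### Integrals with values in an algebra over the quaternions -/

section algebra

variable {E : Type*} [NormedRing E] [NormedAlgebra ℝ E] (ρ : ℍ[ℝ] →ₐ[ℝ] E)

/-- The integral of `R(z) dz_I φ(z)` along a chain, where `dz_I = -I dz`. -/
def opIntegral (c : Chain) (I : ℍ[ℝ]) (R : ℂ → E) (φ : ℂ → ℍ[ℝ]) : E :=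
  ∑ j, ∫ t in (0 : ℝ)..1, R (c.pos j t) * ρ (-I * slice I (c.vel j t) * φ (c.pos j t))

theorem intervalIntegrable_opIntegral (c : Chain) (I : ℍ[ℝ]) {R : ℂ → E} {φ : ℂ → ℍ[ℝ]}
    (hR : ContinuousOn R c.trace) (hφ : ContinuousOn φ c.trace) (j : c.ι) :
    IntervalIntegrable (fun t => R (c.pos j t) * ρ (-I * slice I (c.vel j t) * φ (c.pos j t)))
      volume 0 1 := by
  rw [intervalIntegrable_iff_integrableOn_Ioo_of_le zero_le_one]
  have hm : Set.MapsTo (c.pos j) (Set.Icc 0 1) c.trace := fun t ht => c.mem_trace j ht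
  have hR' := hR.comp (c.continuousOn_pos j) hm
  have hφ' := hφ.comp (c.continuousOn_pos j) hm
  obtain ⟨M₁, h₁⟩ := isCompact_Icc.exists_bound_of_continuousOn hR'
  obtain ⟨M₂, h₂⟩ := isCompact_Icc.exists_bound_of_continuousOn hφ'
  obtain ⟨M₃, h₃⟩ := c.bounded_vel j
  refine Integrable.of_bound (C := M₁ * (‖algCLM ρ‖ * (‖-I‖ * (‖sliceL I‖ * M₃) * M₂))) ?_ ?_
  · refine ((hR'.mono Set.Ioo_subset_Icc_self).aestronglyMeasurable measurableSet_Ioo).mul ?_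
    refine (algCLM ρ).continuous.comp_aestronglyMeasurable ((aestronglyMeasurable_const.mul
      ((continuous_slice I).comp_aestronglyMeasurable (c.aestronglyMeasurable_vel j))).mul ?_)
    exact (hφ'.mono Set.Ioo_subset_Icc_self).aestronglyMeasurable measurableSet_Ioo
  · refine (ae_restrict_iff' measurableSet_Ioo).2 (Filter.Eventually.of_forall fun t ht => ?_)
    have g₁ := h₁ t (Set.Ioo_subset_Icc_self ht)
    have g₂ := h₂ t (Set.Ioo_subset_Icc_self ht)
    have g₃ := h₃ t ht
    simp only [Function.comp_apply] at g₁ g₂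
    have p₃ := (norm_nonneg _).trans g₃
    refine (norm_mul_le _ _).trans (mul_le_mul g₁ ?_ (norm_nonneg _) ((norm_nonneg _).trans g₁))
    rw [← algCLM_apply]
    refine ((algCLM ρ).le_opNorm _).trans (mul_le_mul_of_nonneg_left ?_ (norm_nonneg _))
    rw [norm_mul, norm_mul]
    have g₄ : ‖slice I (c.vel j t)‖ ≤ ‖sliceL I‖ * M₃ := by
      rw [← sliceL_apply]
      exact ((sliceL I).le_opNorm _).trans (mul_le_mul_of_nonneg_left g₃ (norm_nonneg _))
    gcongr

/-- The factor `-i` is the trace of `dz_I = -I dz`. With this formula the scalar Cauchy theorems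
apply, since real functionals separate points. -/
theorem apply_opIntegral [CompleteSpace E] (c : Chain) {I : ℍ[ℝ]} (hI : I ∈ imUnits)
    (u : E →L[ℝ] ℝ) {R : ℂ → E} {φ : ℂ → ℍ[ℝ]} (hR : ContinuousOn R c.trace)
    (hφ : ContinuousOn φ c.trace) :
    u (opIntegral ρ c I R φ) = (-Complex.I * c.integral (scalarForm ρ I u R φ)).re := by
  have hs : ContinuousOn (scalarForm ρ I u R φ) c.trace := by
    have h1 : ∀ q : ℍ[ℝ], ContinuousOn (fun z => u (R z * ρ (q * φ z))) c.trace := fun q =>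
      u.continuous.comp_continuousOn (hR.mul ((algCLM ρ).continuous.comp_continuousOn
        (continuousOn_const.mul hφ)))
    have h2 := h1 1
    simp only [one_mul] at h2
    exact (Complex.continuous_ofReal.comp_continuousOn h2).sub
      ((Complex.continuous_ofReal.comp_continuousOn (h1 I)).mul continuousOn_const)
  rw [opIntegral, map_sum, Chain.integral, Finset.mul_sum, Complex.re_sum]
  refine Finset.sum_congr rfl fun j _ => ?_
  rw [← ContinuousLinearMap.intervalIntegral_comp_comm u
    (intervalIntegrable_opIntegral ρ c I hR hφ j), ← intervalIntegral.integral_const_mul,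
    ← Complex.reCLM_apply, ← ContinuousLinearMap.intervalIntegral_comp_comm Complex.reCLM
      ((c.intervalIntegrable hs j).const_mul _)]
  congr 1
  ext t
  rw [Complex.reCLM_apply, show -Complex.I * (scalarForm ρ I u R φ (c.pos j t) * c.vel j t) =
    scalarForm ρ I u R φ (c.pos j t) * (-Complex.I * c.vel j t) by ring, re_mul_scalarForm,
    slice_mul hI, slice_neg, slice_I]

/-- Chains that enclose the singularities in the same way give the same integral. -/
theorem opIntegral_eq [CompleteSpace E] {I : ℍ[ℝ]} (hI : I ∈ imUnits) {c d : Chain} {a : ℂ}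
    {W₁ C₁ W₂ C₂ K Ω : Set ℂ} (hc : c.Encloses a W₁ C₁) (hd : d.Encloses a W₂ C₂)
    (hK : IsClosed K) (hΩ : IsOpen Ω) (hK₁ : K ⊆ W₁) (hK₂ : K ⊆ W₂) (hC₁ : C₁ ⊆ Ω) (hC₂ : C₂ ⊆ Ω)
    (hb : Bornology.IsBounded ((C₁ ∪ C₂) \ (W₁ ∩ W₂))) {R : ℂ → E} {φ : ℂ → ℍ[ℝ]}
    (hR : RightHol ρ I R (Ω \ K)) (hφ : LeftHol I φ (Ω \ K)) :
    opIntegral ρ c I R φ = opIntegral ρ d I R φ := by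
  have hcs : c.trace ⊆ Ω \ K := fun z hz =>
    ⟨hC₁ (hc.trace_subset hz).1, fun h => (hc.trace_subset hz).2 (hK₁ h)⟩
  have hds : d.trace ⊆ Ω \ K := fun z hz =>
    ⟨hC₂ (hd.trace_subset hz).1, fun h => (hd.trace_subset hz).2 (hK₂ h)⟩
  refine (SeparatingDual.eq_iff_forall_dual_eq (R := ℝ)).2 fun u => ?_
  rw [apply_opIntegral ρ c hI u (hR.continuousOn.mono hcs) (hφ.continuousOn.mono hcs),
    apply_opIntegral ρ d hI u (hR.continuousOn.mono hds) (hφ.continuousOn.mono hds)]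
  have h := hc.integral_sub_eq_zero hd hK hΩ hK₁ hK₂ hC₁ hC₂ hb
    (differentiableOn_scalarForm ρ hI u hR hφ)
  rw [Chain.integral_sub, sub_eq_zero] at h
  rw [h]

/-- Cauchy's formula at the origin. -/
theorem opIntegral_inv [CompleteSpace E] {I : ℍ[ℝ]} (hI : I ∈ imUnits) {c : Chain}
    {W C Ω : Set ℂ} (hc : c.Encloses 0 W C) (hb : Bornology.IsBounded C) (hΩ : IsOpen Ω)
    (hC : C ⊆ Ω) (h0 : 0 ∈ W) {φ : ℂ → ℍ[ℝ]} (hφ : LeftHol I φ Ω) :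
    opIntegral ρ c I (fun z => ρ (slice I z⁻¹)) φ = (2 * Real.pi) • ρ (φ 0) := by
  have hcs : c.trace ⊆ Ω := fun z hz => hC (hc.trace_subset hz).1
  have hR : ContinuousOn (fun z => ρ (slice I z⁻¹)) c.trace :=
    (algCLM ρ).continuous.comp_continuousOn ((continuous_slice I).comp_continuousOn
      (continuousOn_id.inv₀ fun z hz h => hc.zero_notMem h0 (h ▸ hz)))
  refine (SeparatingDual.eq_iff_forall_dual_eq (R := ℝ)).2 fun u => ?_
  rw [apply_opIntegral ρ c hI u hR (hφ.continuousOn.mono hcs)]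
  -- A complex number is determined by the real parts of its products with `1` and `i`, and these
  -- are given by `re_mul_scalarForm`.
  have e : ∀ z, scalarForm ρ I u (fun z => ρ (slice I z⁻¹)) φ z =
      (z - 0)⁻¹ * scalarForm ρ I u (fun _ => 1) φ z := by
    intro z
    have h1 := fun w => re_mul_scalarForm ρ I u (fun _ => 1) φ z w
    have h2 := fun w => re_mul_scalarForm ρ I u (fun z => ρ (slice I z⁻¹)) φ z w
    have h3 : ∀ w, (scalarForm ρ I u (fun z => ρ (slice I z⁻¹)) φ z * w).re =
        ((z - 0)⁻¹ * scalarForm ρ I u (fun _ => 1) φ z * w).re := by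
      intro w
      rw [h2, sub_zero, mul_assoc, mul_comm z⁻¹, mul_assoc, mul_comm w, h1, slice_mul hI, one_mul,
        ← map_mul, mul_assoc]
    have h4 := h3 1
    have h5 := h3 Complex.I
    rw [mul_one, mul_one] at h4
    refine Complex.ext h4 ?_
    rw [Complex.mul_I_re, Complex.mul_I_re] at h5
    exact neg_injective h5
  rw [c.integral_congr fun z _ => e z,
    hc.cauchy hb hΩ hC (differentiableOn_scalarForm ρ hI u (rightHol_const ρ I 1 _) hφ) h0]
  simp [scalarForm]

theorem opIntegral_conjNeg (c : Chain) (I : ℍ[ℝ]) (R : ℂ → E) (φ : ℂ → ℍ[ℝ]) :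
    opIntegral ρ c.conjNeg I R φ = opIntegral ρ c (-I) (fun z => R ((starRingEnd ℂ) z))
      (fun z => φ ((starRingEnd ℂ) z)) := by
  change ∑ j : c.ι, _ = ∑ j : c.ι, _
  refine Finset.sum_congr rfl fun j _ => ?_
  congr 1
  ext t
  simp only [Chain.conjNeg, slice_neg, slice_conj, neg_neg, neg_mul, mul_neg]

/-- The substitution has velocity factor `-ζ⁻²`. Times `ζ` this is `-ζ⁻¹`, and times `-ζ²` it is
`1`, which gives the two integrals on the right. -/
theorem opIntegral_invAdd (c : Chain) (h0 : 0 ∉ c.trace) (k : ℂ) {I : ℍ[ℝ]} (hI : I ∈ imUnits)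
    {R R' : ℂ → E} {φ φ' : ℂ → ℍ[ℝ]} (hR' : ContinuousOn R' c.trace)
    (hφ' : ContinuousOn φ' c.trace)
    (hR : ∀ ζ ∈ c.trace, R (ζ⁻¹ + k) = ρ (slice I ζ) - R' ζ * ρ (slice I (ζ ^ 2)))
    (hφ : ∀ ζ ∈ c.trace, φ (ζ⁻¹ + k) = φ' ζ) :
    opIntegral ρ (c.invAdd h0 k) I R φ =
      opIntegral ρ c I R' φ' - opIntegral ρ c I (fun z => ρ (slice I z⁻¹)) φ' := by
  have hinv : ContinuousOn (fun z => ρ (slice I z⁻¹)) c.trace :=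
    (algCLM ρ).continuous.comp_continuousOn ((continuous_slice I).comp_continuousOn
      (continuousOn_id.inv₀ fun z hz h => h0 (h ▸ hz)))
  rw [opIntegral, opIntegral, opIntegral, ← Finset.sum_sub_distrib]
  refine Finset.sum_congr rfl fun j _ => ?_
  rw [← intervalIntegral.integral_sub (intervalIntegrable_opIntegral ρ c I hR' hφ' j)
    (intervalIntegrable_opIntegral ρ c I hinv hφ' j)]
  refine intervalIntegral.integral_congr fun t ht => ?_
  rw [Set.uIcc_of_le zero_le_one] at ht
  have hmem := c.mem_trace j ht
  have hne : c.pos j t ≠ 0 := fun h => h0 (h ▸ hmem)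
  simp only [Chain.invAdd]
  rw [hR _ hmem, hφ _ hmem]
  change c.ι at j
  generalize c.pos j t = ζ at hne
  generalize c.vel j t = w
  rw [sub_mul, mul_assoc (R' ζ), ← map_mul, ← map_mul, ← map_mul]
  have hI' : -I = slice I (-Complex.I) := by rw [slice_neg, slice_I]
  have e1 : slice I ζ * (-I * slice I (-(ζ⁻¹ ^ 2 * w)) * φ' ζ) =
      -(slice I ζ⁻¹ * (-I * slice I w * φ' ζ)) := by
    have h : slice I (ζ * -Complex.I * -(ζ⁻¹ ^ 2 * w)) = -slice I (ζ⁻¹ * -Complex.I * w) := by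
      rw [← slice_neg]
      congr 1
      field_simp
    rw [hI', ← mul_assoc, ← mul_assoc, ← mul_assoc, ← mul_assoc, ← slice_mul hI, ← slice_mul hI,
      ← slice_mul hI, ← slice_mul hI, h, neg_mul]
  have e2 : slice I (ζ ^ 2) * (-I * slice I (-(ζ⁻¹ ^ 2 * w)) * φ' ζ) =
      -(-I * slice I w * φ' ζ) := by
    have h : slice I (ζ ^ 2 * -Complex.I * -(ζ⁻¹ ^ 2 * w)) = -slice I (-Complex.I * w) := by
      rw [← slice_neg]
      congr 1
      field_simp
    rw [hI', ← mul_assoc, ← mul_assoc, ← slice_mul hI, ← slice_mul hI, ← slice_mul hI, h, neg_mul]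
  rw [e1, e2, map_neg, map_neg]
  noncomm_ring

/-! ### Holomorphy of the resolvent operators -/

/-- The common form `C² - 2 Re(z) C A + |z|² A²` of the operators whose inverses define the
S-resolvents. -/
def quadForm (A C : E) (z : ℂ) : E :=
  C * C - (2 * z.re) • (C * A) + (z.re ^ 2 + z.im ^ 2) • (A * A)

/-- The common form `-(C² - 2 Re(z) C A + |z|² A²)⁻¹ (C A - A² z̄)` of the S-resolvents. -/
def resolventForm (I : ℍ[ℝ]) (A C : E) (z : ℂ) : E :=
  -(Ring.inverse (quadForm A C z) * (C * A - A * A * ρ (slice I ((starRingEnd ℂ) z))))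

theorem continuous_quadForm (A C : E) : Continuous (quadForm A C) := by
  unfold quadForm
  fun_prop

/-- The inverse `Q` commutes with `A` and `C` and so with the derivative of the quadratic form,
though not with `J = ρ I`. As `J` occurs only at the far right, the derivative `-Q N' Q` may be
written `-Q² N'`, and the claim reduces to a polynomial identity. -/
theorem rightHol_resolventForm [CompleteSpace E] {I : ℍ[ℝ]} (hI : I ∈ imUnits) {A C : E}
    (hAC : C * A = A * C) :
    RightHol ρ I (resolventForm ρ I A C) {z | IsUnit (quadForm A C z)} := by
  intro z hz
  obtain ⟨N, hN⟩ := hz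
  set Q : E := ↑N⁻¹ with hQ
  set J := ρ I with hJ
  have hJJ : J * J = -1 := by rw [hJ, ← map_mul, imUnits.mul_self hI, map_neg, map_one]
  have hre : HasFDerivAt (fun z : ℂ => z.re) Complex.reCLM z := Complex.reCLM.hasFDerivAt
  have him : HasFDerivAt (fun z : ℂ => z.im) Complex.imCLM z := Complex.imCLM.hasFDerivAt
  have h1 := (((hre.const_mul 2).smul_const (C * A)).const_sub (C * C)).add
    (((hre.pow 2).add (him.pow 2)).smul_const (A * A))
  obtain ⟨N', hN', hNw⟩ : ∃ N' : ℂ →L[ℝ] E, HasFDerivAt (quadForm A C) N' z ∧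
      ∀ w, N' w = -((2 * w.re) • (C * A)) + (2 * z.re * w.re + 2 * z.im * w.im) • (A * A) := by
    refine ⟨_, h1, fun w => ?_⟩
    simp [mul_assoc]
  have h2 : HasFDerivAt (fun z => Ring.inverse (quadForm A C z))
      ((-ContinuousLinearMap.mulLeftRight ℝ E Q Q).comp N') z := by
    have h3 := hasFDerivAt_ringInverse (𝕜 := ℝ) N
    rw [hN] at h3
    exact h3.comp z hN'
  have h4 : HasFDerivAt (fun z => A * A * ρ (slice I ((starRingEnd ℂ) z)))
      ((ContinuousLinearMap.mul ℝ E (A * A)).comp ((algCLM ρ).comp (sliceL (-I)))) z := by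
    have h5 := ((ContinuousLinearMap.mul ℝ E (A * A)).comp
      ((algCLM ρ).comp (sliceL (-I)))).hasFDerivAt (x := z)
    refine h5.congr_of_eventuallyEq (Filter.Eventually.of_forall fun w => ?_)
    simp [algCLM_apply, sliceL_apply, slice_conj]
  refine ⟨_, (h2.mul' (h4.const_sub (C * A))).neg, ?_⟩
  have hCA : Commute C A := hAC
  have hNA : Commute (N : E) A := by
    rw [hN, quadForm]
    exact (((hCA.mul_left hCA).sub_left ((hCA.mul_left (Commute.refl A)).smul_left _))).add_left
      (((Commute.refl A).mul_left (Commute.refl A)).smul_left _)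
  have hNC : Commute (N : E) C := by
    rw [hN, quadForm]
    exact ((((Commute.refl C).mul_left (Commute.refl C)).sub_left
      (((Commute.refl C).mul_left hCA.symm).smul_left _))).add_left
        ((hCA.symm.mul_left hCA.symm).smul_left _)
  have hQA : Commute Q A := hNA.units_inv_left
  have hQC : Commute Q C := hNC.units_inv_left
  have hQN' : ∀ w, Commute Q (N' w) := fun w => by
    rw [hNw]
    exact ((hQC.mul_right hQA).smul_right _).neg_right.add_right
      ((hQA.mul_right hQA).smul_right _)
  set B : E := C * A - A * A * ρ (slice I ((starRingEnd ℂ) z)) with hB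
  have hBz : B = C * A - A * A * (z.re • 1 - z.im • J) := by
    rw [hB, slice, quaternion_coe_eq_smul, map_add, map_smul, map_smul, map_one, Complex.conj_re,
      Complex.conj_im, neg_smul, sub_eq_add_neg (z.re • (1 : E))]
  -- This is the condition `R'(i) = R'(1) J` with `Q²` cleared on the left. The factor `2` arises
  -- since `B' 1 = -A²` and `B' i = A² J` contribute equally.
  have key : N' Complex.I * B - N' 1 * B * J - (2 : ℝ) • ((N : E) * (A * A) * J) = 0 := by
    rw [hNw, hNw, hN, quadForm, hBz]
    simp only [Complex.I_re, Complex.I_im, Complex.one_re, Complex.one_im]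
    have hA1 : ∀ x, C * (A * x) = A * (C * x) := fun x => by
      rw [← mul_assoc, hAC, mul_assoc]
    simp only [add_mul, sub_mul, mul_sub, neg_mul, mul_neg, smul_mul_assoc,
      mul_smul_comm, mul_assoc, hAC, hA1, hJJ, mul_one]
    module
  have hQNQ : Q * (N : E) = 1 := N.inv_mul
  have hcomm : ∀ w x, Q * N' w * Q * x = Q * Q * (N' w * x) := fun w x => by
    rw [mul_assoc Q (N' w) Q, ← (hQN' w).eq]
    simp only [mul_assoc]
  have key2 : Q * Q * (N' Complex.I * B) - Q * Q * (N' 1 * B) * J -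
      (2 : ℝ) • (Q * (A * A) * J) = 0 := by
    have h6 := congrArg (fun x => Q * Q * x) key
    simp only [mul_sub, mul_zero, mul_smul_comm] at h6
    rw [← h6]
    congr 2
    · simp only [mul_assoc]
    · simp only [mul_assoc]
      rw [← mul_assoc Q (N : E), hQNQ, one_mul]
  rw [two_smul] at key2
  simp only [neg_apply, add_apply, smul_apply]
  simp only [← hN, Ring.inverse_unit, ← hQ, ContinuousLinearMap.comp_apply,
    ContinuousLinearMap.mulLeftRight_apply, neg_apply]
  simp [sliceL_apply, algCLM_apply, ← hJ]
  rw [hcomm, hcomm, add_mul, ← mul_assoc Q (A * A) J, ← sub_eq_zero, ← key2]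
  abel

end algebra

end SCalc

namespace SCalc

/-! ### The representation formula -/

/-- The points `x + iy` of the plane for which `x + yI` lies in `Ω` for all imaginary units `I`. -/
def sphericalPreimage (Ω : Set ℍ[ℝ]) : Set ℂ := {z | ∀ I ∈ imUnits, slice I z ∈ Ω}

/-- The tube lemma over the compact sphere of imaginary units. -/
theorem isOpen_sphericalPreimage {Ω : Set ℍ[ℝ]} (hΩ : IsOpen Ω) :
    IsOpen (sphericalPreimage Ω) := by
  rw [isOpen_iff_eventually]
  intro z hz
  refine isCompact_imUnits.eventually_forall_of_forall_eventually fun I hI => ?_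
  have h : Continuous fun p : ℂ × ℍ[ℝ] => slice p.2 p.1 :=
    continuous_slice_uncurry.comp continuous_swap
  exact h.continuousAt.eventually (hΩ.mem_nhds (hz I hI))

/-- The points `x + iy` such that `f` is affine in `I` on the sphere of all `x + yI`. -/
def affineSet (f : ℍ[ℝ] → ℍ[ℝ]) : Set ℂ :=
  {z | ∃ α β : ℍ[ℝ], ∀ I ∈ imUnits, f (slice I z) = α + I * β}

theorem LeftHol.sub {I : ℍ[ℝ]} {φ ψ : ℂ → ℍ[ℝ]} {s : Set ℂ} (hφ : LeftHol I φ s)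
    (hψ : LeftHol I ψ s) : LeftHol I (fun z => φ z - ψ z) s := by
  intro z hz
  obtain ⟨D, h1, h2⟩ := hφ z hz
  obtain ⟨D', h3, h4⟩ := hψ z hz
  refine ⟨D - D', h1.sub h3, ?_⟩
  rw [sub_apply, sub_apply, h2, h4, mul_sub]

theorem LeftHol.const_mul {I J a : ℍ[ℝ]} {φ : ℂ → ℍ[ℝ]} {s : Set ℂ} (hφ : LeftHol J φ s)
    (ha : a * J = I * a) : LeftHol I (fun z => a * φ z) s := by
  intro z hz
  obtain ⟨D, h1, h2⟩ := hφ z hz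
  refine ⟨(ContinuousLinearMap.mul ℝ ℍ[ℝ] a).comp D,
    (ContinuousLinearMap.mul ℝ ℍ[ℝ] a).hasFDerivAt.comp z h1, ?_⟩
  simp only [ContinuousLinearMap.comp_apply, ContinuousLinearMap.mul_apply']
  rw [h2, ← mul_assoc, ha, mul_assoc]

/-- The identity principle for real points. -/
theorem LeftHol.eq_zero_of_real {I : ℍ[ℝ]} (hI : I ∈ imUnits) {φ : ℂ → ℍ[ℝ]} {H : Set ℂ}
    (hH : IsOpen H) (hc : IsPreconnected H) (hφ : LeftHol I φ H) {x : ℝ} (hx : (x : ℂ) ∈ H)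
    (h0 : ∀ t : ℝ, (t : ℂ) ∈ H → φ t = 0) {z : ℂ} (hz : z ∈ H) : φ z = 0 := by
  set ρ := AlgHom.id ℝ ℍ[ℝ]
  refine (SeparatingDual.eq_zero_iff_forall_dual_eq_zero (R := ℝ) _).2 fun u => ?_
  have hd := differentiableOn_scalarForm ρ hI u (rightHol_const ρ I 1 H) hφ
  have hfreq : ∃ᶠ w in 𝓝[≠] (x : ℂ), scalarForm ρ I u (fun _ => 1) φ w = (0 : ℂ → ℂ) w := by
    have ht : Filter.Tendsto (fun t : ℝ => (t : ℂ)) (𝓝[≠] x) (𝓝[≠] (x : ℂ)) :=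
      Complex.continuous_ofReal.continuousAt.continuousWithinAt.tendsto_nhdsWithin
        fun t ht h => ht (Complex.ofReal_injective h)
    refine ht.frequently (Filter.Eventually.frequently ?_)
    have h1 : ∀ᶠ t : ℝ in 𝓝[≠] x, (t : ℂ) ∈ H :=
      (Complex.continuous_ofReal.continuousAt.eventually (hH.mem_nhds hx)).filter_mono
        nhdsWithin_le_nhds
    filter_upwards [h1] with t ht
    simp [scalarForm, h0 t ht]
  have h := (hd.analyticOnNhd hH).eqOn_of_preconnected_of_frequently_eq
    (analyticOnNhd_const (v := (0 : ℂ))) hc hx hfreq hz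
  have h2 := re_mul_scalarForm ρ I u (fun _ => 1) φ z 1
  rw [h] at h2
  simpa [ρ] using h2.symm

/-- The circle is connected and meets the real axis, so the component `H` of the regularity region
around it contains real points. On `H` the function on `L_I` and the combination `½(1 - IJ) f(x +
Jy) + ½(1 + IJ) f(x - Jy)` are both holomorphic for `I` and agree at real points. -/
theorem mem_interior_affineSet {f : ℍ[ℝ] → ℍ[ℝ]} {z : ℂ} {x : ℝ}
    (h : ∀ w : ℂ, ‖w - x‖ = ‖z - x‖ → w ∈ sphericalPreimage (regDomain f)) :
    z ∈ interior (affineSet f) := by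
  set G := sphericalPreimage (regDomain f)
  have hG : IsOpen G := isOpen_sphericalPreimage (isOpen_regDomain f)
  have hS : Metric.sphere (x : ℂ) ‖z - x‖ ⊆ G := fun w hw => h w (by simpa using hw)
  have hzS : z ∈ Metric.sphere (x : ℂ) ‖z - x‖ := by simp
  have hSc : IsPreconnected (Metric.sphere (x : ℂ) ‖z - x‖) :=
    isPreconnected_sphere (by simp [Complex.rank_real_complex]) _ _
  have hSH := hSc.subset_connectedComponentIn hzS hS
  set H := connectedComponentIn G z
  have hHG : H ⊆ G := connectedComponentIn_subset G z
  have hH : IsOpen H := hG.connectedComponentIn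
  have hx : ((x + ‖z - x‖ : ℝ) : ℂ) ∈ H := hSH (by simp)
  refine mem_interior.2 ⟨H, fun w hw => ?_, hH, hSH hzS⟩
  obtain ⟨J, hJ⟩ := imUnits_nonempty
  have hl : ∀ I ∈ imUnits, LeftHol I (fun w => f (slice I w)) H := fun I hI =>
    (leftHol_regDomain f hI).mono fun w hw => hHG hw I hI
  refine ⟨(1 / 2 : ℝ) • (f (slice J w) + f (slice (-J) w)),
    (1 / 2 : ℝ) • (J * (f (slice (-J) w) - f (slice J w))), fun I hI => ?_⟩
  have hII := imUnits.mul_self hI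
  have hJJ := imUnits.mul_self hJ
  -- The coefficients intertwine `J`, respectively `-J`, with `I`, so multiplying by them on the
  -- left makes functions on `L_J` and `L_{-J}` holomorphic for `I`.
  have e1 : ((1 / 2 : ℝ) • (1 - I * J)) * J = I * ((1 / 2 : ℝ) • (1 - I * J)) := by
    rw [smul_mul_assoc, mul_smul_comm, sub_mul, mul_sub, mul_assoc, hJJ, ← mul_assoc, hII]
    simp [add_comm]
  have e2 : ((1 / 2 : ℝ) • (1 + I * J)) * -J = I * ((1 / 2 : ℝ) • (1 + I * J)) := by
    rw [smul_mul_assoc, mul_smul_comm, add_mul, mul_add, mul_neg, mul_neg, mul_assoc, hJJ,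
      ← mul_assoc, hII]
    simp [add_comm]
  have h3 := ((hl I hI).sub ((hl J hJ).const_mul e1)).sub
    ((hl (-J) (imUnits.neg_mem hJ)).const_mul e2)
  have h4 := h3.eq_zero_of_real hI hH isPreconnected_connectedComponentIn hx (fun t _ => ?_) hw
  · rw [sub_eq_zero, sub_eq_iff_eq_add] at h4
    rw [h4]
    simp only [smul_add, smul_mul_assoc, sub_mul, add_mul, one_mul, mul_sub, smul_sub,
      mul_smul_comm, mul_assoc]
    abel
  · simp only [slice_ofReal]
    rw [sub_sub, ← add_mul, ← smul_add]
    simp only [sub_add_add_cancel]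
    rw [show (1 : ℍ[ℝ]) + 1 = (2 : ℝ) • 1 by rw [two_smul], smul_smul]
    norm_num

theorem mem_affineSet_transport {f : ℍ[ℝ] → ℍ[ℝ]} {c : ℍ[ℝ]} {k : ℝ} {p : ℂ}
    (hp : p ≠ 0 → p⁻¹ + k ∈ affineSet f) : p ∈ affineSet (transport f c k) := by
  rcases eq_or_ne p 0 with rfl | h0
  · exact ⟨c, 0, fun I _ => by simp [transport_zero]⟩
  · obtain ⟨α, β, h⟩ := hp h0
    refine ⟨α, β, fun I hI => ?_⟩
    rw [transport_of_ne f c k (mt (slice_eq_zero hI).1 h0), ← slice_inv hI, ← slice_ofReal I k,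
      ← slice_add]
    exact h I hI

end SCalc

namespace SCalc

/-! ### The two S-resolvent forms -/

section forms

variable {E : Type*} [NormedRing E] [NormedAlgebra ℝ E] (ρ : ℍ[ℝ] →ₐ[ℝ] E)

theorem sq_add_sq_ne_zero {z : ℂ} (hz : z ≠ 0) : z.re ^ 2 + z.im ^ 2 ≠ 0 := by
  have := (Complex.normSq_pos.2 hz).ne'
  rwa [Complex.normSq_apply, ← sq, ← sq] at this

/-- The form is homogeneous in the pair `(A, C)`, and inversion of `z` exchanges the two. It relates
`A² - 2 Re(p) A + |p|²` to `1 - 2 Re(s) A + |s|² A²` for `s = p⁻¹`. -/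
theorem quadForm_inv {A C : E} (hAC : C * A = A * C) {z : ℂ} (hz : z ≠ 0) :
    quadForm A C z⁻¹ = (z.re ^ 2 + z.im ^ 2)⁻¹ • quadForm C A z := by
  have h := sq_add_sq_ne_zero hz
  have h2 : Complex.normSq z = z.re ^ 2 + z.im ^ 2 := by rw [Complex.normSq_apply]; ring
  rw [quadForm, quadForm, Complex.inv_re, Complex.inv_im, h2, hAC]
  have h3 : (z.re / (z.re ^ 2 + z.im ^ 2)) ^ 2 + (-z.im / (z.re ^ 2 + z.im ^ 2)) ^ 2 =
      (z.re ^ 2 + z.im ^ 2)⁻¹ := by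
    field_simp
  rw [h3, smul_add, smul_sub, smul_smul, smul_smul, inv_mul_cancel₀ h, one_smul,
    show 2 * (z.re / (z.re ^ 2 + z.im ^ 2)) = (z.re ^ 2 + z.im ^ 2)⁻¹ * (2 * z.re) by ring]
  abel

theorem isUnit_smul_iff_of_ne_zero {r : ℝ} (hr : r ≠ 0) {x : E} : IsUnit (r • x) ↔ IsUnit x := by
  rw [show r • x = Units.mk0 r hr • x from rfl, isUnit_smul_iff]

theorem isUnit_quadForm_inv_iff {A C : E} (hAC : C * A = A * C) {z : ℂ} (hz : z ≠ 0) :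
    IsUnit (quadForm A C z⁻¹) ↔ IsUnit (quadForm C A z) := by
  rw [quadForm_inv hAC hz, isUnit_smul_iff_of_ne_zero (inv_ne_zero (sq_add_sq_ne_zero hz))]

/-- The identity `S⁻¹(z⁻¹ + k, T) = z - S⁻¹(z, A) z²` in terms of `A = (T - k)⁻¹`. After factoring
out the inverse pencil it follows from `z̄ z² = |z|² z` and `z² = 2 Re(z) z - |z|²`. -/
theorem resolventForm_inv {I : ℍ[ℝ]} (hI : I ∈ imUnits) {A : E} {z : ℂ} (hz : z ≠ 0)
    (hu : IsUnit (quadForm 1 A z)) :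
    resolventForm ρ I A 1 z⁻¹ = ρ (slice I z) - resolventForm ρ I 1 A z * ρ (slice I (z ^ 2)) := by
  have hr := sq_add_sq_ne_zero hz
  set r := z.re ^ 2 + z.im ^ 2 with hrdef
  have h2 : Complex.normSq z = r := by rw [Complex.normSq_apply]; ring
  obtain ⟨N, hN⟩ := hu
  have hinv : Ring.inverse (r⁻¹ • quadForm 1 A z) = r • (↑N⁻¹ : E) := by
    rw [← hN, show r⁻¹ • (N : E) = ((Units.mk0 r hr)⁻¹ • N : Eˣ) from rfl, Ring.inverse_unit]
    rfl
  have hconj : (starRingEnd ℂ) z⁻¹ = (r⁻¹ : ℝ) • z := by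
    rw [Complex.inv_def, h2, map_mul, Complex.conj_conj, Complex.conj_ofReal, mul_comm]
    simp
  have hzz : z * (starRingEnd ℂ) z = r := by rw [Complex.mul_conj, h2]
  have hsq : z ^ 2 = (2 * z.re) • z - (r : ℂ) := by
    rw [← hzz, Complex.real_smul]
    apply Complex.ext <;> simp [sq] <;> ring
  have hs : ∀ (t : ℝ) (w : ℂ), slice I (t • w) = t • slice I w := fun t w => by
    rw [← sliceL_apply, map_smul, sliceL_apply]
  have h1 : (↑N⁻¹ : E) * (N : E) = 1 := N.inv_mul
  rw [resolventForm, resolventForm, quadForm_inv (by simp) hz, hinv, ← hN, Ring.inverse_unit, hconj,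
    hs, map_smul, neg_mul, sub_neg_eq_add]
  have h3 : ρ (slice I ((starRingEnd ℂ) z)) * ρ (slice I (z ^ 2)) = r • ρ (slice I z) := by
    rw [← map_mul, ← slice_mul hI, ← map_smul, ← hs]
    congr 2
    rw [sq, ← mul_assoc, mul_comm ((starRingEnd ℂ) z) z, hzz, Complex.real_smul]
  have h4 : ρ (slice I (z ^ 2)) = (2 * z.re) • ρ (slice I z) - r • 1 := by
    rw [hsq, slice_sub, hs, slice_ofReal, map_sub, map_smul, quaternion_coe_eq_smul, map_smul,
      map_one]
  have h5 : ρ (slice I z) = ↑N⁻¹ * (quadForm 1 A z * ρ (slice I z)) := by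
    rw [← mul_assoc, ← hN, h1, one_mul]
  rw [mul_assoc (↑N⁻¹ : E), sub_mul, mul_assoc (1 * 1 : E), h3, h4]
  conv_rhs => lhs; rw [h5]
  rw [← mul_add, smul_mul_assoc, ← mul_smul_comm, ← mul_neg]
  congr 1
  rw [quadForm, ← hrdef]
  simp only [one_mul, mul_one, mul_sub, mul_smul_comm, smul_sub, smul_smul, sub_mul, add_mul,
    smul_mul_assoc, mul_inv_cancel₀ hr, one_smul]
  abel

theorem isClosed_not_isUnit_quadForm [CompleteSpace E] (A C : E) :
    IsClosed {z | ¬ IsUnit (quadForm A C z)} := by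
  rw [← isOpen_compl_iff]
  simp only [Set.compl_ofPred, not_not]
  exact Units.isOpen.preimage (continuous_quadForm A C)

/-- Inversion moves a neighbourhood of infinity to one of `0`, where the reversed form is close to
`1`. -/
theorem isBounded_not_isUnit_quadForm [CompleteSpace E] (A : E) :
    Bornology.IsBounded {z | ¬ IsUnit (quadForm 1 A z)} := by
  have h1 : ∀ᶠ w in 𝓝 (0 : ℂ), IsUnit (quadForm A 1 w) :=
    (continuous_quadForm A 1).continuousAt.eventually (Units.isOpen.mem_nhds (by simp [quadForm]))
  have h2 := Filter.tendsto_inv₀_cobounded (α := ℂ) |>.eventually h1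
  rw [← Bornology.isCobounded_compl_iff, Bornology.isCobounded_def]
  filter_upwards [h2, Bornology.eventually_ne_cobounded (0 : ℂ)] with z hz hz0
  simpa using (isUnit_quadForm_inv_iff (by simp) hz0).1 hz

theorem quadForm_conj (A C : E) (z : ℂ) : quadForm A C ((starRingEnd ℂ) z) = quadForm A C z := by
  simp [quadForm]

end forms

section operators

variable {V : Type*} [NormedAddCommGroup V] [NormedSpace ℝ V]
  [Module ℍ[ℝ] V] [Module ℍ[ℝ]ᵐᵒᵖ V] [SMulCommClass ℍ[ℝ] ℍ[ℝ]ᵐᵒᵖ V]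
  [IsScalarTower ℝ ℍ[ℝ] V] [IsScalarTower ℝ ℍ[ℝ]ᵐᵒᵖ V]
  [IsBoundedSMul ℍ[ℝ] V] [IsBoundedSMul ℍ[ℝ]ᵐᵒᵖ V]

/-! ### Right linear operators as real linear operators -/

variable (V) in
/-- Restriction of scalars as a ring homomorphism. -/
def toReal : (V →L[ℍ[ℝ]ᵐᵒᵖ] V) →+* (V →L[ℝ] V) where
  toFun A := A.restrictScalars ℝ
  map_one' := rfl
  map_mul' _ _ := rfl
  map_zero' := rfl
  map_add' _ _ := rfl

theorem toReal_apply (A : V →L[ℍ[ℝ]ᵐᵒᵖ] V) (v : V) : toReal V A v = A v := rfl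

theorem toReal_injective : Function.Injective (toReal V) := fun A B h => by
  ext v
  exact congrArg (fun F : V →L[ℝ] V => F v) h

theorem lmul_apply (a : ℍ[ℝ]) (v : V) : (lmul a : V →L[ℍ[ℝ]ᵐᵒᵖ] V) v = a • v := rfl

variable (V) in
/-- Left multiplication by quaternions as an algebra homomorphism. -/
def lmulAlg : ℍ[ℝ] →ₐ[ℝ] (V →L[ℝ] V) where
  toFun a := toReal V (lmul a)
  map_one' := by ext v; simp [toReal_apply, lmul_apply]
  map_mul' a b := by ext v; simp [toReal_apply, lmul_apply, mul_smul]
  map_zero' := by ext v; simp [toReal_apply, lmul_apply]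
  map_add' a b := by ext v; simp [toReal_apply, lmul_apply, add_smul]
  commutes' r := by
    ext v
    simp only [toReal_apply, lmul_apply, Algebra.algebraMap_eq_smul_one, smul_assoc, one_smul,
      smul_apply, one_apply_eq_self]

theorem lmulAlg_apply (a : ℍ[ℝ]) : lmulAlg V a = toReal V (lmul a) := rfl

theorem coe_smul_eq (r : ℝ) (v : V) : (r : ℍ[ℝ]) • v = r • v := by
  rw [quaternion_coe_eq_smul, smul_assoc, one_smul]

/-- The real linear inverse of a right linear operator is right linear, so invertibility may be
tested in the real operator algebra. -/
theorem isUnit_toReal_iff {A : V →L[ℍ[ℝ]ᵐᵒᵖ] V} : IsUnit (toReal V A) ↔ IsUnit A := by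
  refine ⟨fun ⟨u, hu⟩ => ?_, fun h => h.map (toReal V)⟩
  have h1 : ∀ v, A ((↑u⁻¹ : V →L[ℝ] V) v) = v := fun v => by
    have := congrArg (fun F : V →L[ℝ] V => F v) u.mul_inv
    rwa [hu] at this
  have h2 : ∀ v, (↑u⁻¹ : V →L[ℝ] V) (A v) = v := fun v => by
    have := congrArg (fun F : V →L[ℝ] V => F v) u.inv_mul
    rwa [hu] at this
  let B : V →L[ℍ[ℝ]ᵐᵒᵖ] V :=
    { toFun := (↑u⁻¹ : V →L[ℝ] V)
      map_add' := map_add _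
      map_smul' := fun b v => by
        conv_lhs => rw [← h1 v, ← map_smul A, h2]
        rfl
      cont := (↑u⁻¹ : V →L[ℝ] V).continuous }
  exact ⟨⟨A, B, by ext v; exact h1 v, by ext v; exact h2 v⟩, rfl⟩

theorem toReal_inverse (A : V →L[ℍ[ℝ]ᵐᵒᵖ] V) :
    toReal V (Ring.inverse A) = Ring.inverse (toReal V A) := by
  by_cases h : IsUnit A
  · obtain ⟨u, rfl⟩ := h
    rw [Ring.inverse_unit, show toReal V (u : V →L[ℍ[ℝ]ᵐᵒᵖ] V) =
      (Units.map (toReal V : _ →* _) u : (V →L[ℝ] V)ˣ) from rfl, Ring.inverse_unit]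
    rfl
  · rw [Ring.inverse_non_unit _ h, Ring.inverse_non_unit _ (mt isUnit_toReal_iff.1 h), map_zero]

theorem toReal_lmul_coe (r : ℝ) : toReal V (lmul (r : ℍ[ℝ])) = r • 1 := by
  ext v
  simp [toReal_apply, lmul_apply, coe_smul_eq]

theorem toReal_bddPencil (A : V →L[ℍ[ℝ]ᵐᵒᵖ] V) {I : ℍ[ℝ]} (hI : I ∈ imUnits) (z : ℂ) :
    toReal V (bddPencil A (slice I z)) = quadForm 1 (toReal V A) z := by
  rw [bddPencil, slice_re hI, norm_slice hI, map_add, map_sub, map_mul, map_mul, toReal_lmul_coe,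
    toReal_lmul_coe, quadForm, Complex.sq_norm, Complex.normSq_apply, sq, sq]
  simp

theorem mem_bddSpectrum_slice (A : V →L[ℍ[ℝ]ᵐᵒᵖ] V) {I : ℍ[ℝ]} (hI : I ∈ imUnits) (z : ℂ) :
    slice I z ∈ bddSpectrum A ↔ ¬ IsUnit (quadForm 1 (toReal V A) z) := by
  rw [← toReal_bddPencil A hI, isUnit_toReal_iff]
  rfl

theorem toReal_bddResolvent (A : V →L[ℍ[ℝ]ᵐᵒᵖ] V) {I : ℍ[ℝ]} (hI : I ∈ imUnits) (z : ℂ) :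
    toReal V (bddResolvent A (slice I z)) = resolventForm (lmulAlg V) I 1 (toReal V A) z := by
  rw [bddResolvent, map_neg, map_mul, toReal_inverse, toReal_bddPencil A hI, map_sub, star_slice hI,
    ← lmulAlg_apply, resolventForm]
  simp

/-! ### The bounded inverse of a shifted closed operator -/

theorem pencil_eq {T : V →ₗ.[ℍ[ℝ]ᵐᵒᵖ] V} (s : ℍ[ℝ]) {x y z : V} (h1 : (x, y) ∈ T.graph)
    (h2 : (y, z) ∈ T.graph) : ∃ h : x ∈ sqDomain T,
      pencil T s ⟨x, h⟩ = z - (2 * s.re) • y + (‖s‖ ^ 2) • x := by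
  obtain ⟨⟨x', hx⟩, rfl, rfl⟩ := (LinearPMap.mem_graph_iff T).1 h1
  obtain ⟨⟨y', hy⟩, e, rfl⟩ := (LinearPMap.mem_graph_iff T).1 h2
  simp only at e
  subst e
  exact ⟨⟨hx, hy⟩, rfl⟩

theorem exists_graph_of_mem_sqDomain {T : V →ₗ.[ℍ[ℝ]ᵐᵒᵖ] V} {x : V} (h : x ∈ sqDomain T) :
    ∃ y z, (x, y) ∈ T.graph ∧ (y, z) ∈ T.graph :=
  ⟨_, _, T.mem_graph ⟨x, h.1⟩, T.mem_graph ⟨_, h.2⟩⟩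

theorem smul_mem_graph {T : V →ₗ.[ℍ[ℝ]ᵐᵒᵖ] V} (r : ℝ) {x y : V} (h : (x, y) ∈ T.graph) :
    (r • x, r • y) ∈ T.graph := by
  have := T.graph.smul_mem (MulOpposite.op (r : ℍ[ℝ])) h
  rw [quaternion_coe_eq_smul, MulOpposite.op_smul, MulOpposite.op_one] at this
  simpa [smul_assoc] using this

theorem isShiftInverse_iff {T : V →ₗ.[ℍ[ℝ]ᵐᵒᵖ] V} {k : ℝ} {A : V →L[ℍ[ℝ]ᵐᵒᵖ] V} :
    IsShiftInverse T k A ↔ (∀ v, (A v, v + k • A v) ∈ T.graph) ∧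
      ∀ x y, (x, y) ∈ T.graph → A (y - k • x) = x := by
  refine and_congr (forall_congr' fun v => ?_) ⟨fun h x y hxy => ?_, fun h x => ?_⟩
  · constructor
    · rintro ⟨h, e⟩
      rw [← sub_eq_iff_eq_add.1 e]
      exact T.mem_graph ⟨A v, h⟩
    · intro h
      obtain ⟨⟨x, hx⟩, e1, e2⟩ := (LinearPMap.mem_graph_iff T).1 h
      simp only at e1
      subst e1
      exact ⟨hx, by rw [e2, add_sub_cancel_right]⟩
  · obtain ⟨x', rfl, rfl⟩ := (LinearPMap.mem_graph_iff T).1 hxy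
    exact h x'
  · exact h _ _ (T.mem_graph x)

/-- At `s = k` the pencil is `(T - k)²` and the S-resolvent acts as `-(T - k)⁻¹`, so the inverse has
to be `-B`. -/
theorem exists_isShiftInverse {T : V →ₗ.[ℍ[ℝ]ᵐᵒᵖ] V} (hT : IsAdmissible T) {k : ℝ}
    (hk : (k : ℍ[ℝ]) ∈ resolventSet T) : ∃ A, IsShiftInverse T k A := by
  obtain ⟨B, hbij, hB⟩ := hk
  have hpen : ∀ {x y z : V}, (x, y) ∈ T.graph → (y, z) ∈ T.graph → ∃ h : x ∈ sqDomain T,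
      pencil T k ⟨x, h⟩ = z - (2 * k) • y + (k ^ 2) • x := fun h1 h2 => by
    obtain ⟨h, e⟩ := pencil_eq (k : ℍ[ℝ]) h1 h2
    refine ⟨h, ?_⟩
    simpa using e
  -- A null vector of `T - k` lies in the domain of `T²` and is a null vector of `(T - k)²`.
  have hker : ∀ w, (w, k • w) ∈ T.graph → w = 0 := fun w hw => by
    obtain ⟨h, e⟩ := hpen hw (smul_mem_graph k hw)
    obtain ⟨h', e'⟩ := hpen T.graph.zero_mem T.graph.zero_mem
    have h0 : pencil T k ⟨w, h⟩ = pencil T k ⟨0, h'⟩ := by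
      rw [e, e', smul_smul, smul_smul]
      simp only [smul_zero, sub_zero, add_zero]
      module
    exact congrArg Subtype.val (hbij.1 h0)
  have hdom : ∀ x y, (x, y) ∈ T.graph → (-B x, x + k • -B x) ∈ T.graph := fun x y hxy => by
    obtain ⟨x', rfl, rfl⟩ := (LinearPMap.mem_graph_iff T).1 hxy
    obtain ⟨⟨y, hy⟩, e1, e2⟩ := hB x'
    obtain ⟨y₁, y₂, g1, g2⟩ := exists_graph_of_mem_sqDomain hy
    obtain ⟨h, e⟩ := hpen g1 g2
    rw [e, Quaternion.star_coe, coe_smul_eq] at e1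
    -- For `y = -B x'` one has `(T - k)² y = (T - k) x'`. So `(T - k) y - x'` is killed by `T - k`
    -- and vanishes.
    have hw := hker (y₁ - k • y - x') (by
      convert T.graph.sub_mem (T.graph.sub_mem g2 (smul_mem_graph k g1)) (T.mem_graph x') using 1
      refine Prod.ext rfl ?_
      simp only [Prod.snd_sub]
      have : T x' = y₂ - (2 * k) • y₁ + k ^ 2 • y + k • (x' : V) := by rw [e1]; abel
      rw [this]
      module)
    rw [e2, neg_neg, ← sub_eq_zero.1 hw, sub_add_cancel]
    exact g1
  -- The relation `(T - k)(-B v) = v` says that a pair depending continuously on `v` is in the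
  -- closed graph, so it extends from the dense domain.
  have hall : ∀ v, (-B v, v + k • -B v) ∈ T.graph := by
    have hc : IsClosed {v : V | (-B v, v + k • -B v) ∈ (T.graph : Set (V × V))} :=
      hT.closed.preimage (by fun_prop)
    have hd : closure (T.domain : Set V) ⊆ {v : V | (-B v, v + k • -B v) ∈ T.graph} :=
      closure_minimal (fun x hx => hdom x _ (T.mem_graph ⟨x, hx⟩)) hc
    intro v
    exact hd (hT.dense v)
  refine ⟨-B, isShiftInverse_iff.2 ⟨hall, fun x y hxy => ?_⟩⟩
  have h1 := hall (y - k • x)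
  have h2 := hker (-B (y - k • x) - x) (by
    convert T.graph.sub_mem h1 hxy using 1
    refine Prod.ext rfl ?_
    simp only [Prod.snd_sub]
    module)
  exact sub_eq_zero.1 h2

/-- `𝓘 - 2 Re[s] A + |s|² A²`. -/
def shiftPencil (A : V →L[ℍ[ℝ]ᵐᵒᵖ] V) (s : ℍ[ℝ]) : V →L[ℍ[ℝ]ᵐᵒᵖ] V :=
  1 - lmul ((2 * s.re : ℝ) : ℍ[ℝ]) * A + lmul ((‖s‖ ^ 2 : ℝ) : ℍ[ℝ]) * (A * A)

theorem shiftPencil_apply (A : V →L[ℍ[ℝ]ᵐᵒᵖ] V) (s : ℍ[ℝ]) (v : V) :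
    shiftPencil A s v = v - (2 * s.re) • A v + (‖s‖ ^ 2) • A (A v) := by
  rw [← coe_smul_eq, ← coe_smul_eq]
  rfl

theorem toReal_shiftPencil (A : V →L[ℍ[ℝ]ᵐᵒᵖ] V) {I : ℍ[ℝ]} (hI : I ∈ imUnits) (z : ℂ) :
    toReal V (shiftPencil A (slice I z)) = quadForm (toReal V A) 1 z := by
  rw [shiftPencil, slice_re hI, norm_slice hI, map_add, map_sub, map_mul, map_mul, map_mul,
    toReal_lmul_coe, toReal_lmul_coe, quadForm, Complex.sq_norm, Complex.normSq_apply, sq, sq]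
  simp

theorem commute_shiftPencil (A : V →L[ℍ[ℝ]ᵐᵒᵖ] V) (s : ℍ[ℝ]) : Commute (shiftPencil A s) A := by
  change shiftPencil A s * A = A * shiftPencil A s
  apply toReal_injective
  obtain ⟨I, hI, hs⟩ := exists_slice s
  rw [map_mul, map_mul, ← hs, toReal_shiftPencil A hI, quadForm]
  simp [mul_add, add_mul, mul_sub, sub_mul, mul_assoc]

/-! ### The spectrum and the S-resolvent of `T` in terms of `A = (T - k)⁻¹` -/

section shift

variable {T : V →ₗ.[ℍ[ℝ]ᵐᵒᵖ] V} {k : ℝ} {A : V →L[ℍ[ℝ]ᵐᵒᵖ] V}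

/-- For real `k` the pencil of `T` at `s` is the pencil of `T - k` at `s - k`, and `T - k` undoes
one factor `A` at a time. -/
theorem IsShiftInverse.pencil_sq (hA : IsShiftInverse T k A) (s : ℍ[ℝ]) (v : V) :
    ∃ h : A (A v) ∈ sqDomain T, pencil T s ⟨A (A v), h⟩ = shiftPencil A (s - (k : ℍ[ℝ])) v := by
  rw [isShiftInverse_iff] at hA
  have h1 := hA.1 (A v)
  have h2 := T.graph.add_mem (hA.1 v) (smul_mem_graph k h1)
  obtain ⟨h, e⟩ := pencil_eq s h1 h2
  refine ⟨h, ?_⟩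
  have hn : ‖s - (k : ℍ[ℝ])‖ ^ 2 = ‖s‖ ^ 2 - 2 * k * s.re + k ^ 2 := by
    rw [sq, sq, ← Quaternion.normSq_eq_norm_mul_self, ← Quaternion.normSq_eq_norm_mul_self,
      Quaternion.normSq_def', Quaternion.normSq_def']
    simp
    ring
  rw [e, shiftPencil_apply, hn, show (s - (k : ℍ[ℝ])).re = s.re - k by simp]
  module

theorem IsShiftInverse.apply_injective (hA : IsShiftInverse T k A) : Function.Injective A := by
  rw [isShiftInverse_iff] at hA
  refine (injective_iff_map_eq_zero A).2 fun v hv => ?_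
  have h := hA.1 v
  rw [hv, smul_zero, add_zero] at h
  exact T.graph_fst_eq_zero_snd h rfl

theorem IsShiftInverse.exists_sq (hA : IsShiftInverse T k A) {x : V} (hx : x ∈ sqDomain T) :
    ∃ v, A (A v) = x := by
  obtain ⟨y, z, h1, h2⟩ := exists_graph_of_mem_sqDomain hx
  rw [isShiftInverse_iff] at hA
  refine ⟨z - k • y - k • (y - k • x), ?_⟩
  rw [hA.2 _ _ (T.graph.sub_mem h2 (smul_mem_graph k h1)), hA.2 _ _ h1]

/-- `A²` is a bijection of `V` onto the domain of `T²`, and composing the pencil with it gives the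
bounded operator. -/
theorem IsShiftInverse.bijective_pencil_iff (hA : IsShiftInverse T k A) (s : ℍ[ℝ]) :
    Function.Bijective (pencil T s) ↔ Function.Bijective (shiftPencil A (s - (k : ℍ[ℝ]))) := by
  choose h e using hA.pencil_sq s
  set g : V → sqDomain T := fun v => ⟨A (A v), h v⟩ with hg
  have hgb : Function.Bijective g := by
    refine ⟨fun v w hvw => hA.apply_injective (hA.apply_injective (congrArg Subtype.val hvw)),
      fun ⟨x, hx⟩ => ?_⟩
    obtain ⟨v, rfl⟩ := hA.exists_sq hx
    exact ⟨v, rfl⟩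
  rw [show ⇑(shiftPencil A (s - (k : ℍ[ℝ]))) = pencil T s ∘ g from funext fun v => (e v).symm]
  exact (Function.Bijective.of_comp_iff _ hgb).symm

theorem IsShiftInverse.isSResolvent (hA : IsShiftInverse T k A) {s : ℍ[ℝ]}
    (hu : IsUnit (shiftPencil A (s - (k : ℍ[ℝ])))) :
    IsSResolvent T s (-(Ring.inverse (shiftPencil A (s - (k : ℍ[ℝ]))) *
      (A - A * A * lmul (star (s - (k : ℍ[ℝ])))))) := by
  obtain ⟨N, hN⟩ := hu
  have h1 : ∀ v, (N : V →L[ℍ[ℝ]ᵐᵒᵖ] V) ((↑N⁻¹ : V →L[ℍ[ℝ]ᵐᵒᵖ] V) v) = v := fun v =>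
    congrArg (fun F : V →L[ℍ[ℝ]ᵐᵒᵖ] V => F v) N.mul_inv
  have h2 : ∀ v, (↑N⁻¹ : V →L[ℍ[ℝ]ᵐᵒᵖ] V) ((N : V →L[ℍ[ℝ]ᵐᵒᵖ] V) v) = v := fun v =>
    congrArg (fun F : V →L[ℍ[ℝ]ᵐᵒᵖ] V => F v) N.inv_mul
  have hcomm : Commute (↑N⁻¹ : V →L[ℍ[ℝ]ᵐᵒᵖ] V) A :=
    (hN ▸ commute_shiftPencil A (s - (k : ℍ[ℝ])) : Commute (N : V →L[ℍ[ℝ]ᵐᵒᵖ] V) A).units_inv_left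
  have h3 : ∀ v, (↑N⁻¹ : V →L[ℍ[ℝ]ᵐᵒᵖ] V) (A v) = A ((↑N⁻¹ : V →L[ℍ[ℝ]ᵐᵒᵖ] V) v) := fun v =>
    congrArg (fun F : V →L[ℍ[ℝ]ᵐᵒᵖ] V => F v) hcomm.eq
  refine ⟨(hA.bijective_pencil_iff s).2 ?_, fun x => ?_⟩
  · rw [← hN]
    exact ⟨Function.LeftInverse.injective h2, Function.RightInverse.surjective h1⟩
  · have hx := (isShiftInverse_iff.1 hA).2 _ _ (T.mem_graph x)
    set u := T x - k • (x : V) with hu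
    -- Here `w = (T - s̄) x`, and its preimage under the pencil is `A² N⁻¹ w`. Since `A u = x`, `A²
    -- w` is `A - A² (s - k)‾` applied to `x`.
    set w := u - star (s - (k : ℍ[ℝ])) • (x : V) with hw
    obtain ⟨h, e⟩ := hA.pencil_sq s ((↑N⁻¹ : V →L[ℍ[ℝ]ᵐᵒᵖ] V) w)
    refine ⟨⟨_, h⟩, ?_, ?_⟩
    · rw [e, ← hN, h1, hw, hu, star_sub, Quaternion.star_coe, sub_smul, coe_smul_eq]
      abel
    · rw [← hN, Ring.inverse_unit]
      change -((↑N⁻¹ : V →L[ℍ[ℝ]ᵐᵒᵖ] V) (A x - A (A (star (s - (k : ℍ[ℝ])) • (x : V))))) = _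
      have h4 : A (x : V) - A (A (star (s - (k : ℍ[ℝ])) • (x : V))) = A (A w) := by
        rw [hw, map_sub, map_sub, hx]
      rw [h4, h3, h3]

theorem IsSResolvent.unique {s : ℍ[ℝ]} (hd : Dense (T.domain : Set V)) {B C : V →L[ℍ[ℝ]ᵐᵒᵖ] V}
    (hB : IsSResolvent T s B) (hC : IsSResolvent T s C) : B = C := by
  refine DFunLike.coe_injective (B.continuous.ext_on hd C.continuous fun x hx => ?_)
  obtain ⟨y, hy, e⟩ := hB.2 ⟨x, hx⟩
  obtain ⟨y', hy', e'⟩ := hC.2 ⟨x, hx⟩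
  rw [e, e', hB.1.1 (hy.trans hy'.symm)]

/-- By the bounded inverse theorem bijectivity of the pencil already gives an invertible bounded
operator, and then the bounded extension exists automatically. -/
theorem IsShiftInverse.mem_resolventSet_iff [CompleteSpace V] (hA : IsShiftInverse T k A)
    {s : ℍ[ℝ]} : s ∈ resolventSet T ↔ IsUnit (shiftPencil A (s - (k : ℍ[ℝ]))) := by
  refine ⟨fun ⟨B, hB⟩ => ?_, fun h => ⟨_, hA.isSResolvent h⟩⟩
  rw [← isUnit_toReal_iff, ContinuousLinearMap.isUnit_iff_bijective]
  exact (hA.bijective_pencil_iff s).1 hB.1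

theorem IsShiftInverse.mem_spectrum_slice [CompleteSpace V] (hA : IsShiftInverse T k A)
    {I : ℍ[ℝ]} (hI : I ∈ imUnits) (z : ℂ) :
    slice I z ∈ spectrum T ↔ ¬ IsUnit (quadForm (toReal V A) 1 (z - k)) := by
  rw [spectrum, Set.mem_compl_iff, hA.mem_resolventSet_iff, ← slice_ofReal I k, ← slice_sub,
    ← toReal_shiftPencil A hI, isUnit_toReal_iff]

theorem IsShiftInverse.toReal_sResolvent [CompleteSpace V] (hA : IsShiftInverse T k A)
    (hd : Dense (T.domain : Set V)) {I : ℍ[ℝ]} (hI : I ∈ imUnits) {z : ℂ}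
    (hu : IsUnit (quadForm (toReal V A) 1 (z - k))) :
    toReal V (sResolvent T (slice I z)) =
      resolventForm (lmulAlg V) I (toReal V A) 1 (z - k) := by
  have e : slice I z - (k : ℍ[ℝ]) = slice I (z - k) := by rw [slice_sub, slice_ofReal]
  rw [← toReal_shiftPencil A hI, isUnit_toReal_iff, ← e] at hu
  have h := hA.isSResolvent hu
  have hex : ∃ B, IsSResolvent T (slice I z) B := ⟨_, h⟩
  rw [sResolvent, dif_pos hex, hex.choose_spec.unique hd h, map_neg, map_mul, toReal_inverse, e,
    toReal_shiftPencil A hI, star_slice hI, map_sub, map_mul, map_mul, ← lmulAlg_apply,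
    resolventForm, one_mul]

end shift

end operators

end SCalc

namespace SCalc

/-! ### Axially symmetric sets and inversion -/

/-- The axially symmetric set of all `x + yI` with `y ≥ 0` and `x + iy ∈ D`. -/
def axialSet (D : Set ℂ) : Set ℍ[ℝ] := {q | (⟨q.re, ‖q.im‖⟩ : ℂ) ∈ D}

theorem continuous_axial : Continuous fun q : ℍ[ℝ] => (⟨q.re, ‖q.im‖⟩ : ℂ) := by
  have h : (fun q : ℍ[ℝ] => (⟨q.re, ‖q.im‖⟩ : ℂ)) = fun q => (q.re : ℂ) + (‖q.im‖ : ℂ) *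
      Complex.I := by
    ext q
    apply Complex.ext <;> simp
  rw [h]
  exact (Complex.continuous_ofReal.comp Quaternion.continuous_re).add
    ((Complex.continuous_ofReal.comp (continuous_norm.comp Quaternion.continuous_im)).mul
      continuous_const)

theorem isBounded_axialSet {D : Set ℂ} (hD : Bornology.IsBounded D) :
    Bornology.IsBounded (axialSet D) := by
  obtain ⟨M, hM⟩ := hD.exists_norm_le
  refine isBounded_iff_forall_norm_le.2 ⟨M, fun q hq => ?_⟩
  obtain ⟨I, hI, e⟩ := exists_slice q
  rw [← e, norm_slice hI]
  exact hM _ hq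

theorem slice_preimage_axialSet {D : Set ℂ} (hD : ∀ z ∈ D, (starRingEnd ℂ) z ∈ D) {I : ℍ[ℝ]}
    (hI : I ∈ imUnits) : slice I ⁻¹' axialSet D = D := by
  ext z
  have h1 : (slice I z).im = z.im • I := by
    ext <;> simp [slice, hI.1]
  change (⟨(slice I z).re, ‖(slice I z).im‖⟩ : ℂ) ∈ D ↔ _
  rw [slice_re hI, h1, norm_smul, hI.2, mul_one, Real.norm_eq_abs]
  rcases abs_choice z.im with h | h <;> rw [h]
  have e : (⟨z.re, -z.im⟩ : ℂ) = (starRingEnd ℂ) z := rfl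
  rw [e]
  exact ⟨fun h => by simpa using hD _ h, hD z⟩

/-- The preimage of a neighbourhood of `∞` under `p ↦ p⁻¹ + k`, where `0⁻¹ = ∞`. -/
def invPreimage (k : ℝ) (S : Set ℂ) : Set ℂ := {z | z ≠ 0 → z⁻¹ + k ∈ S}

theorem isOpen_invPreimage (k : ℝ) {S : Set ℂ} (hS : IsOpen S) (hc : S ∈ Bornology.cobounded ℂ) :
    IsOpen (invPreimage k S) := by
  rw [isOpen_iff_mem_nhds]
  intro z hz
  rcases eq_or_ne z 0 with rfl | h0
  · have := eventually_nhdsWithin_iff.1 ((tendsto_inv_add_cobounded (k : ℂ)).eventually hc)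
    exact this
  · have hcont : ContinuousAt (fun z : ℂ => z⁻¹ + k) z :=
      (continuousAt_inv₀ h0).add continuousAt_const
    filter_upwards [hcont.eventually (hS.mem_nhds (hz h0))] with w hw _ using hw

theorem sphericalPreimage_mem_cobounded {f : ℍ[ℝ] → ℍ[ℝ]} {c : ℍ[ℝ]} (hf : RegularAtInfty f c) :
    ∃ r : ℝ, {z : ℂ | r < ‖z‖} ⊆ sphericalPreimage (regDomain f) := by
  obtain ⟨⟨r, hr⟩, -⟩ := hf
  refine ⟨r, fun z hz I hI => subset_regDomain (isOpen_lt continuous_const continuous_norm) hr ?_⟩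
  rw [Set.mem_ofPred_eq, norm_slice hI]
  exact hz

theorem setOf_lt_norm_mem_cobounded (r : ℝ) : {z : ℂ | r < ‖z‖} ∈ Bornology.cobounded ℂ :=
  tendsto_norm_cobounded_atTop.eventually (Filter.eventually_gt_atTop r)

theorem invPreimage_subset {f : ℍ[ℝ] → ℍ[ℝ]} {c : ℍ[ℝ]} (hf : RegularAtInfty f c) (k : ℝ)
    {S : Set ℂ} (hS : S ⊆ sphericalPreimage (regDomain f)) :
    invPreimage k S ⊆ sphericalPreimage (regDomain (transport f c k)) := by
  intro z hz I hI
  rcases eq_or_ne z 0 with rfl | h0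
  · rw [slice_zero]
    exact zero_mem_regDomain_transport hf k
  · refine subset_regDomain (isOpen_inv_preimage (isOpen_regDomain f) k)
      (sliceRegularOn_transport c k (isOpen_regDomain f) (sliceRegularOn_regDomain f))
      ⟨mt (slice_eq_zero hI).1 h0, ?_⟩
    rw [← slice_inv hI, ← slice_ofReal I k, ← slice_add]
    exact hS (hz h0) I hI

theorem SliceRegularOnClosure.closure_slice_subset {f : ℍ[ℝ] → ℍ[ℝ]} {W : Set ℍ[ℝ]}
    (h : SliceRegularOnClosure f W) (I : ℍ[ℝ]) :
    closure (slice I ⁻¹' W) ⊆ slice I ⁻¹' regDomain f := by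
  obtain ⟨Ω, h1, h2, h3⟩ := h
  exact ((continuous_slice I).closure_preimage_subset W).trans
    (Set.preimage_mono (h2.trans (subset_regDomain h1 h3)))

theorem isBounded_slice_preimage {U : Set ℍ[ℝ]} (hU : Bornology.IsBounded U) {I : ℍ[ℝ]}
    (hI : I ∈ imUnits) : Bornology.IsBounded (slice I ⁻¹' U) := by
  obtain ⟨M, hM⟩ := hU.exists_norm_le
  exact isBounded_iff_forall_norm_le.2 ⟨M, fun z hz => norm_slice hI z ▸ hM _ hz⟩

theorem slice_preimage_mem_cobounded {W : Set ℍ[ℝ]} {r : ℝ} (hW : {q : ℍ[ℝ] | r < ‖q‖} ⊆ W)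
    {I : ℍ[ℝ]} (hI : I ∈ imUnits) : slice I ⁻¹' W ∈ Bornology.cobounded ℂ := by
  filter_upwards [setOf_lt_norm_mem_cobounded r] with z hz
  exact hW (by rwa [Set.mem_ofPred_eq, norm_slice hI])

/-! ### Further properties of the integrals -/

section algebra

variable {E : Type*} [NormedRing E] [NormedAlgebra ℝ E] {ρ : ℍ[ℝ] →ₐ[ℝ] E}

theorem RightHol.comp_sub_const {I : ℍ[ℝ]} {R : ℂ → E} {s : Set ℂ} (h : RightHol ρ I R s) (k : ℂ) :
    RightHol ρ I (fun z => R (z - k)) {z | z - k ∈ s} := by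
  intro z hz
  obtain ⟨D, h1, h2⟩ := h _ hz
  exact ⟨D, by simpa [Function.comp_def] using h1.comp z ((hasFDerivAt_id z).sub_const k), h2⟩

theorem RightHol.congr {I : ℍ[ℝ]} {R R' : ℂ → E} {s : Set ℂ} (hs : IsOpen s)
    (h : RightHol ρ I R s) (hRR' : Set.EqOn R' R s) : RightHol ρ I R' s := by
  intro z hz
  obtain ⟨D, hD, hD'⟩ := h z hz
  exact ⟨D, hD.congr_of_eventuallyEq (hRR'.eventuallyEq_of_mem (hs.mem_nhds hz)), hD'⟩

theorem commute_opIntegral [CompleteSpace E] (c : Chain) (I : ℍ[ℝ]) {R : ℂ → E} {φ : ℂ → ℍ[ℝ]}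
    (hR : ContinuousOn R c.trace) (hφ : ContinuousOn φ c.trace) {x : E}
    (h1 : ∀ z, Commute x (R z)) (h2 : ∀ q, Commute x (ρ q)) :
    Commute x (opIntegral ρ c I R φ) := by
  change x * _ = _ * x
  rw [opIntegral, Finset.mul_sum, Finset.sum_mul]
  refine Finset.sum_congr rfl fun j _ => ?_
  have hi := intervalIntegrable_opIntegral ρ c I hR hφ j
  have e1 := ((ContinuousLinearMap.mul ℝ E) x).intervalIntegral_comp_comm hi
  have e2 := ((ContinuousLinearMap.mul ℝ E).flip x).intervalIntegral_comp_comm hi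
  simp only [ContinuousLinearMap.mul_apply', ContinuousLinearMap.flip_apply] at e1 e2
  rw [← e1, ← e2]
  congr 1
  ext t
  exact ((h1 _).mul_right (h2 _)).eq

/-- Both products have the shape `P + I S` with `P` and `S` independent of `I`, so adding the values
for `I` and `-I` removes `I` altogether. -/
theorem form_slice_eq {I : ℍ[ℝ]} (hI : I ∈ imUnits) (z w : ℂ) (α β : ℍ[ℝ]) :
    -I * slice I w * (α + I * β) =
      (w.im • α + w.re • β) + I * (w.im • β - w.re • α) ∧
    slice I ((starRingEnd ℂ) z) * (-I * slice I w * (α + I * β)) =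
      (z.re • (w.im • α + w.re • β) + z.im • (w.im • β - w.re • α)) +
        I * (z.re • (w.im • β - w.re • α) - z.im • (w.im • α + w.re • β)) := by
  have hII := imUnits.mul_self hI
  have hI2 : ∀ x, I * (I * x) = -x := fun x => by rw [← mul_assoc, hII, neg_one_mul]
  have e : -I * slice I w * (α + I * β) =
      (w.im • α + w.re • β) + I * (w.im • β - w.re • α) := by
    rw [slice, quaternion_coe_eq_smul]
    simp only [mul_add, add_mul, neg_mul, mul_smul_comm, smul_mul_assoc, mul_one, hI2,
      hII, mul_sub, one_mul, smul_neg, neg_neg]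
    module
  refine ⟨e, ?_⟩
  rw [e, slice, quaternion_coe_eq_smul, Complex.conj_re, Complex.conj_im]
  generalize w.im • α + w.re • β = P
  generalize w.im • β - w.re • α = S
  simp only [mul_add, add_mul, mul_smul_comm, smul_mul_assoc, mul_sub, one_mul, hI2]
  module

/-- The representation formula makes the integral independent of the slice. -/
theorem opIntegral_add_neg_eq [CompleteSpace E] {c : Chain} {f : ℍ[ℝ] → ℍ[ℝ]} {A : E}
    (hf : c.trace ⊆ affineSet f) {I J : ℍ[ℝ]} (hI : I ∈ imUnits) (hJ : J ∈ imUnits)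
    (hR : ∀ K ∈ imUnits, ContinuousOn (resolventForm ρ K 1 A) c.trace)
    (hφ : ∀ K ∈ imUnits, ContinuousOn (fun z => f (slice K z)) c.trace) :
    opIntegral ρ c I (resolventForm ρ I 1 A) (fun z => f (slice I z)) +
        opIntegral ρ c (-I) (resolventForm ρ (-I) 1 A) (fun z => f (slice (-I) z)) =
      opIntegral ρ c J (resolventForm ρ J 1 A) (fun z => f (slice J z)) +
        opIntegral ρ c (-J) (resolventForm ρ (-J) 1 A) (fun z => f (slice (-J) z)) := by
  simp only [opIntegral, ← Finset.sum_add_distrib]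
  refine Finset.sum_congr rfl fun j _ => ?_
  have hint := fun K (hK : K ∈ imUnits) => intervalIntegrable_opIntegral ρ c K (hR K hK) (hφ K hK) j
  rw [← intervalIntegral.integral_add (hint I hI) (hint _ (imUnits.neg_mem hI)),
    ← intervalIntegral.integral_add (hint J hJ) (hint _ (imUnits.neg_mem hJ))]
  refine intervalIntegral.integral_congr fun t ht => ?_
  rw [Set.uIcc_of_le zero_le_one] at ht
  obtain ⟨α, β, h⟩ := hf (c.mem_trace j ht)
  set z := c.pos j t
  set w := c.vel j t
  set Q := Ring.inverse (quadForm 1 A z)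
  set P := w.im • α + w.re • β with hP
  set S := w.im • β - w.re • α with hS
  -- The inverse `Q` depends only on `z`, and the terms odd in `K` cancel. The right-hand side does
  -- not contain `K`.
  have key : ∀ K ∈ imUnits, resolventForm ρ K 1 A z * ρ (-K * slice K w * f (slice K z)) +
      resolventForm ρ (-K) 1 A z * ρ (-(-K) * slice (-K) w * f (slice (-K) z)) =
        -(Q * (A * ρ (P + P) - ρ ((z.re • P + z.im • S) + (z.re • P + z.im • S)))) := by
    intro K hK
    have hK' := imUnits.neg_mem hK
    have h2 : ∀ L ∈ imUnits, resolventForm ρ L 1 A z * ρ (-L * slice L w * f (slice L z)) =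
        -(Q * (A * ρ (P + L * S) -
          ρ ((z.re • P + z.im • S) + L * (z.re • S - z.im • P)))) := by
      intro L hL
      obtain ⟨e1, e2⟩ := form_slice_eq hL z w α β
      rw [h L hL, resolventForm, neg_mul, mul_assoc, sub_mul, mul_one, mul_one, one_mul,
        ← map_mul, e2, e1]
    rw [h2 K hK, h2 _ hK']
    generalize z.re • P + z.im • S = X
    generalize z.re • S - z.im • P = Y
    simp only [map_add, neg_mul, map_neg, mul_add, mul_sub, mul_neg]
    abel
  change resolventForm ρ I 1 A z * _ + _ = resolventForm ρ J 1 A z * _ + _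
  rw [key I hI, key J hJ]

end algebra

end SCalc

namespace SCalc

variable {V : Type*} [NormedAddCommGroup V] [NormedSpace ℝ V]
  [Module ℍ[ℝ] V] [Module ℍ[ℝ]ᵐᵒᵖ V] [SMulCommClass ℍ[ℝ] ℍ[ℝ]ᵐᵒᵖ V]
  [IsScalarTower ℝ ℍ[ℝ] V] [IsScalarTower ℝ ℍ[ℝ]ᵐᵒᵖ V]
  [IsBoundedSMul ℍ[ℝ] V] [IsBoundedSMul ℍ[ℝ]ᵐᵒᵖ V]

/-! ### The integral of a resolvent over a chain -/

/-- The integral of `R(s) ds_I f(s)` over a chain in the line `L_I`. -/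
def sliceIntegral (R : ℍ[ℝ] → (V →L[ℍ[ℝ]ᵐᵒᵖ] V)) (f : ℍ[ℝ] → ℍ[ℝ]) (I : ℍ[ℝ]) (c : Chain) :
    V →L[ℝ] V :=
  opIntegral (lmulAlg V) c I (fun z => toReal V (R (slice I z))) fun z => f (slice I z)

theorem contourIntegral_eq (I : ℍ[ℝ]) {D : Set ℂ} (Γ : PositiveBoundary D)
    (R : ℍ[ℝ] → (V →L[ℍ[ℝ]ᵐᵒᵖ] V)) (f : ℍ[ℝ] → ℍ[ℝ]) :
    contourIntegral I Γ R f = sliceIntegral R f I Γ.chain := rfl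

section bounded

variable [CompleteSpace V] {A : V →L[ℍ[ℝ]ᵐᵒᵖ] V} {φ : ℍ[ℝ] → ℍ[ℝ]} {I : ℍ[ℝ]}

theorem rightHol_bddResolvent (A : V →L[ℍ[ℝ]ᵐᵒᵖ] V) (hI : I ∈ imUnits) :
    RightHol (lmulAlg V) I (fun z => toReal V (bddResolvent A (slice I z)))
      (slice I ⁻¹' bddSpectrum A)ᶜ := by
  simp only [toReal_bddResolvent A hI]
  refine (rightHol_resolventForm (lmulAlg V) hI (by simp)).mono fun z hz => ?_
  have := mt (mem_bddSpectrum_slice A hI z).2 hz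
  simpa using this

theorem slice_preimage_bddSpectrum (A : V →L[ℍ[ℝ]ᵐᵒᵖ] V) (hI : I ∈ imUnits) :
    slice I ⁻¹' bddSpectrum A = {z | ¬ IsUnit (quadForm 1 (toReal V A) z)} :=
  Set.ext fun z => mem_bddSpectrum_slice A hI z

theorem sliceIntegral_bddResolvent_eq (hI : I ∈ imUnits) {c d : Chain} {W₁ C₁ W₂ C₂ : Set ℂ}
    (hc : c.Encloses 0 W₁ C₁) (hd : d.Encloses 0 W₂ C₂) (hK₁ : slice I ⁻¹' bddSpectrum A ⊆ W₁)
    (hK₂ : slice I ⁻¹' bddSpectrum A ⊆ W₂) (hC₁ : C₁ ⊆ slice I ⁻¹' regDomain φ)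
    (hC₂ : C₂ ⊆ slice I ⁻¹' regDomain φ) (hb₁ : Bornology.IsBounded C₁)
    (hb₂ : Bornology.IsBounded C₂) :
    sliceIntegral (bddResolvent A) φ I c = sliceIntegral (bddResolvent A) φ I d := by
  refine opIntegral_eq (lmulAlg V) hI hc hd ?_
    ((isOpen_regDomain φ).preimage (continuous_slice I)) hK₁ hK₂ hC₁ hC₂
    ((hb₁.union hb₂).subset Set.sdiff_subset) ((rightHol_bddResolvent A hI).mono fun z hz => hz.2)
    ((leftHol_regDomain φ hI).mono Set.sdiff_subset)
  rw [slice_preimage_bddSpectrum A hI]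
  exact isClosed_not_isUnit_quadForm 1 _

theorem exists_toReal_eq {X : V →L[ℝ] V} (h : ∀ (b : ℍ[ℝ]ᵐᵒᵖ) v, X (b • v) = b • X v) :
    ∃ F : V →L[ℍ[ℝ]ᵐᵒᵖ] V, toReal V F = X :=
  ⟨{ toFun := X, map_add' := map_add X, map_smul' := h, cont := X.continuous }, rfl⟩

/-- Right multiplication by a quaternion commutes with every right linear operator, including left
multiplications, hence with the integral. So the real linear operator obtained is right linear. -/
theorem exists_toReal_eq_sliceIntegral {R : ℍ[ℝ] → (V →L[ℍ[ℝ]ᵐᵒᵖ] V)} {c : Chain}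
    (hR : ContinuousOn (fun z => toReal V (R (slice I z))) c.trace)
    (hφ : ContinuousOn (fun z => φ (slice I z)) c.trace) (r : ℝ) :
    ∃ F : V →L[ℍ[ℝ]ᵐᵒᵖ] V, toReal V F = r • sliceIntegral R φ I c := by
  refine exists_toReal_eq fun b v => ?_
  let x : V →L[ℝ] V :=
    { toFun := fun v => b • v
      map_add' := smul_add b
      map_smul' := fun r v => by
        have := smul_comm (r : ℍ[ℝ]) b v
        rw [coe_smul_eq, coe_smul_eq] at this
        exact this.symm
      cont := continuous_const_smul b }
  have hx : ∀ G : V →L[ℍ[ℝ]ᵐᵒᵖ] V, Commute x (toReal V G) := fun G => by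
    ext v
    exact (map_smul G b v).symm
  have h := (commute_opIntegral (ρ := lmulAlg V) c I hR hφ (x := x) (fun z => hx _)
    fun q => hx (lmul q)).smul_right r
  exact (congrArg (fun G : V →L[ℝ] V => G v) h.eq).symm

end bounded

/-! ### Suitable domains -/

/-- A bounded open set in the `p`-plane, `p = (s - k)⁻¹`, which contains `0` and the spectrum of
`A` and whose closure corresponds to points `s` of `S`. -/
structure IsCalculusDomain (A : V →L[ℍ[ℝ]ᵐᵒᵖ] V) (k : ℝ) (S D : Set ℂ) : Prop where
  isOpen : IsOpen D
  isBounded : Bornology.IsBounded D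
  zero_mem : 0 ∈ D
  subset : {z | ¬ IsUnit (quadForm 1 (toReal V A) z)} ⊆ D
  closure_subset : closure D ⊆ invPreimage k S
  conj_mem : ∀ z ∈ D, (starRingEnd ℂ) z ∈ D

/-- The point `0` is adjoined to the spectrum of `A` because it represents `s = ∞`, which the
contour must surround even if `A` is invertible. -/
theorem exists_isCalculusDomain [CompleteSpace V] (A : V →L[ℍ[ℝ]ᵐᵒᵖ] V) (k : ℝ) {S : Set ℂ}
    (hS : IsOpen S) (hSc : S ∈ Bornology.cobounded ℂ)
    (hσ : ∀ z, ¬ IsUnit (quadForm (toReal V A) 1 (z - k)) → z ∈ S) :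
    ∃ D : Set ℂ, IsCalculusDomain A k S D ∧ Nonempty (PositiveBoundary D) := by
  have hcomp : IsCompact (insert 0 {z | ¬ IsUnit (quadForm 1 (toReal V A) z)}) :=
    (Metric.isCompact_of_isClosed_isBounded (isClosed_not_isUnit_quadForm 1 (toReal V A))
      (isBounded_not_isUnit_quadForm (toReal V A))).insert 0
  have hsub : insert 0 {z | ¬ IsUnit (quadForm 1 (toReal V A) z)} ⊆ invPreimage k S := by
    rintro z (rfl | hz) h0
    · exact absurd rfl h0
    · refine hσ _ ?_
      rw [add_sub_cancel_right, isUnit_quadForm_inv_iff (by simp) h0]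
      exact hz
  have hconj : ∀ z ∈ insert 0 {z | ¬ IsUnit (quadForm 1 (toReal V A) z)},
      (starRingEnd ℂ) z ∈ insert 0 {z | ¬ IsUnit (quadForm 1 (toReal V A) z)} := by
    rintro z (rfl | hz)
    · exact Or.inl (map_zero _)
    · right
      rw [Set.mem_ofPred_eq, quadForm_conj]
      exact hz
  obtain ⟨D, h1, h2, h3, h4, h5, h6⟩ := exists_positiveBoundary hcomp
    (isOpen_invPreimage k hS hSc) hsub hconj
  exact ⟨D, ⟨h1, h2, h3 (Set.mem_insert _ _), (Set.subset_insert _ _).trans h3, h4, h5⟩, h6⟩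

theorem IsCalculusDomain.axialSet [CompleteSpace V] {A : V →L[ℍ[ℝ]ᵐᵒᵖ] V} {f : ℍ[ℝ] → ℍ[ℝ]}
    {c : ℍ[ℝ]} {k : ℝ} {S D : Set ℂ} (hD : IsCalculusDomain A k S D) (hf : RegularAtInfty f c)
    (hS : S ⊆ sphericalPreimage (regDomain f)) :
    bddSpectrum A ⊆ axialSet D ∧ SliceRegularOnClosure (transport f c k) (axialSet D) := by
  refine ⟨fun q hq => ?_, regDomain _, isOpen_regDomain _, fun q hq => ?_,
    sliceRegularOn_regDomain _⟩
  · obtain ⟨I, hI, e⟩ := exists_slice q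
    rw [← e, mem_bddSpectrum_slice A hI] at hq
    exact hD.subset hq
  · obtain ⟨I, hI, e⟩ := exists_slice q
    rw [← e]
    exact invPreimage_subset hf k hS
      (hD.closure_subset (continuous_axial.closure_preimage_subset D hq)) I hI

/-! ### Comparison of the two Cauchy integrals -/

section unbounded

variable [CompleteSpace V] {T : V →ₗ.[ℍ[ℝ]ᵐᵒᵖ] V} {k : ℝ} {A : V →L[ℍ[ℝ]ᵐᵒᵖ] V}
  {f : ℍ[ℝ] → ℍ[ℝ]} {c : ℍ[ℝ]} {I : ℍ[ℝ]}

theorem IsShiftInverse.slice_preimage_spectrum (hA : IsShiftInverse T k A) (hI : I ∈ imUnits) :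
    slice I ⁻¹' spectrum T = {z | ¬ IsUnit (quadForm (toReal V A) 1 (z - k))} :=
  Set.ext fun z => hA.mem_spectrum_slice hI z

theorem IsShiftInverse.isClosed_slice_spectrum (hA : IsShiftInverse T k A) (hI : I ∈ imUnits) :
    IsClosed (slice I ⁻¹' spectrum T) := by
  rw [hA.slice_preimage_spectrum hI]
  exact (isClosed_not_isUnit_quadForm (toReal V A) 1).preimage (continuous_id.sub continuous_const)

theorem IsShiftInverse.rightHol_sResolvent (hA : IsShiftInverse T k A)
    (hd : Dense (T.domain : Set V)) (hI : I ∈ imUnits) :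
    RightHol (lmulAlg V) I (fun z => toReal V (sResolvent T (slice I z)))
      (slice I ⁻¹' spectrum T)ᶜ := by
  have h := (rightHol_resolventForm (lmulAlg V) hI
    (show 1 * toReal V A = toReal V A * 1 by simp)).comp_sub_const (k : ℂ)
  have e : (slice I ⁻¹' spectrum T)ᶜ = {z | z - (k : ℂ) ∈ {z | IsUnit (quadForm (toReal V A) 1 z)}} := by
    rw [hA.slice_preimage_spectrum hI]
    ext z
    simp
  refine RightHol.congr (hA.isClosed_slice_spectrum hI).isOpen_compl (e ▸ h) fun z hz => ?_
  rw [e] at hz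
  exact hA.toReal_sResolvent hd hI hz

theorem sliceIntegral_sResolvent_eq (hA : IsShiftInverse T k A) (hd : Dense (T.domain : Set V))
    (hI : I ∈ imUnits) {c d : Chain} {W₁ C₁ W₂ C₂ : Set ℂ}
    (hc : c.Encloses (-1) W₁ C₁) (hd' : d.Encloses (-1) W₂ C₂) (hK₁ : slice I ⁻¹' spectrum T ⊆ W₁)
    (hK₂ : slice I ⁻¹' spectrum T ⊆ W₂) (hC₁ : C₁ ⊆ slice I ⁻¹' regDomain f)
    (hC₂ : C₂ ⊆ slice I ⁻¹' regDomain f) (hb₁ : W₁ ∈ Bornology.cobounded ℂ)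
    (hb₂ : W₂ ∈ Bornology.cobounded ℂ) :
    sliceIntegral (sResolvent T) f I c = sliceIntegral (sResolvent T) f I d :=
  opIntegral_eq (lmulAlg V) hI hc hd' (hA.isClosed_slice_spectrum hI)
    ((isOpen_regDomain f).preimage (continuous_slice I)) hK₁ hK₂ hC₁ hC₂
    ((Bornology.isBounded_def.2 (by rw [compl_compl]; exact Filter.inter_mem hb₁ hb₂) :
      Bornology.IsBounded (W₁ ∩ W₂)ᶜ).subset fun z hz => hz.2)
    ((hA.rightHol_sResolvent hd hI).mono fun z hz => hz.2)
    ((leftHol_regDomain f hI).mono Set.sdiff_subset)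

/-- The change of variables `s = p⁻¹ + k`. The extra term `∫ p⁻¹ dp_I φ(p)` is evaluated by Cauchy's
formula at `p = 0`, where `φ` takes the value `c = f(∞)`. -/
theorem sliceIntegral_invAdd (hA : IsShiftInverse T k A) (hd : Dense (T.domain : Set V))
    (hf : RegularAtInfty f c) (hI : I ∈ imUnits) {γ : Chain} {D S : Set ℂ}
    (hD : IsCalculusDomain A k S D) (hS : S ⊆ sphericalPreimage (regDomain f))
    (hγ : γ.Encloses 0 D (closure D)) :
    sliceIntegral (sResolvent T) f I (γ.invAdd (hγ.zero_notMem hD.zero_mem) k) =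
      sliceIntegral (bddResolvent A) (transport f c k) I γ - (2 * Real.pi) • lmulAlg V c := by
  have h0 := hD.zero_mem
  have hreg : closure D ⊆ slice I ⁻¹' regDomain (transport f c k) := fun z hz =>
    invPreimage_subset hf k hS (hD.closure_subset hz) I hI
  have htr : γ.trace ⊆ closure D \ D := hγ.trace_subset
  have hun : ∀ ζ ∈ γ.trace, IsUnit (quadForm 1 (toReal V A) ζ) := fun ζ hζ => by
    by_contra h
    exact (htr hζ).2 (hD.subset h)
  have hl := leftHol_regDomain (transport f c k) hI
  have h1 := opIntegral_inv (lmulAlg V) hI hγ hD.isBounded.closure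
    ((isOpen_regDomain (transport f c k)).preimage (continuous_slice I)) hreg h0 hl
  rw [slice_zero, transport_zero] at h1
  rw [sliceIntegral, opIntegral_invAdd (lmulAlg V) γ (hγ.zero_notMem h0) k hI
    (R' := fun z => toReal V (bddResolvent A (slice I z)))
    (φ' := fun z => transport f c k (slice I z)) ?_ ?_ ?_ ?_, h1]
  · rfl
  · refine (rightHol_bddResolvent A hI).continuousOn.mono fun z hz h => ?_
    exact (mem_bddSpectrum_slice A hI z).1 h (hun z hz)
  · exact hl.continuousOn.mono fun z hz => hreg (htr hz).1
  · intro ζ hζ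
    have hne : ζ ≠ 0 := fun h => hγ.zero_notMem h0 (h ▸ hζ)
    have e : ζ⁻¹ + (k : ℂ) - k = ζ⁻¹ := add_sub_cancel_right _ _
    rw [hA.toReal_sResolvent hd hI, e, toReal_bddResolvent A hI,
      resolventForm_inv (lmulAlg V) hI hne (hun ζ hζ)]
    rw [e, isUnit_quadForm_inv_iff (by simp) hne]
    exact hun ζ hζ
  · intro ζ hζ
    have hne : ζ ≠ 0 := fun h => hγ.zero_notMem h0 (h ▸ hζ)
    rw [transport_of_ne f c k (mt (slice_eq_zero hI).1 hne), ← slice_inv hI, ← slice_ofReal I k,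
      ← slice_add]

theorem IsShiftInverse.spectrum_subset_invAdd (hA : IsShiftInverse T k A) (hI : I ∈ imUnits)
    {D S : Set ℂ} (hD : IsCalculusDomain A k S D) :
    slice I ⁻¹' spectrum T ⊆ {w | w ≠ (k : ℂ) ∧ (w - k)⁻¹ ∈ D} := by
  rw [hA.slice_preimage_spectrum hI]
  intro w hw
  have hne : w ≠ k := by
    rintro rfl
    exact hw (by simp [quadForm])
  refine ⟨hne, hD.subset ?_⟩
  rwa [Set.mem_ofPred_eq, isUnit_quadForm_inv_iff (by simp) (sub_ne_zero.2 hne)]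

theorem invAdd_mem_cobounded {D : Set ℂ} (hD : IsOpen D) (h0 : 0 ∈ D) (k : ℂ) :
    {w | w ≠ k ∧ (w - k)⁻¹ ∈ D} ∈ Bornology.cobounded ℂ := by
  have h1 : Filter.Tendsto (fun w : ℂ => w - k) (Bornology.cobounded ℂ) (Bornology.cobounded ℂ) := by
    rw [← tendsto_norm_atTop_iff_cobounded]
    refine Filter.tendsto_atTop_mono (fun w => norm_sub_norm_le w k)
      (Filter.tendsto_atTop_add_const_right _ (-‖k‖) tendsto_norm_cobounded_atTop)
  filter_upwards [Bornology.eventually_ne_cobounded k,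
    (Filter.tendsto_inv₀_cobounded.comp h1).eventually (hD.mem_nhds h0)] with w h2 h3
  exact ⟨h2, h3⟩

theorem IsCalculusDomain.invAdd_subset {D S : Set ℂ} (hD : IsCalculusDomain A k S D)
    (hS : S ⊆ sphericalPreimage (regDomain f)) (hI : I ∈ imUnits) :
    {w | w ≠ (k : ℂ) ∧ (w - k)⁻¹ ∈ closure D} ⊆ slice I ⁻¹' regDomain f := by
  rintro w ⟨hne, hw⟩
  have := hD.closure_subset hw (inv_ne_zero (sub_ne_zero.2 hne))
  rw [inv_inv, sub_add_cancel] at this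
  exact hS this I hI

/-- The Cauchy integral of the unbounded operator over the boundary of a neighbourhood of `∞`. -/
theorem sliceIntegral_sResolvent_chain_eq (hA : IsShiftInverse T k A)
    (hd : Dense (T.domain : Set V)) (hf : RegularAtInfty f c) (hI : I ∈ imUnits) {γ d : Chain}
    {D S W C : Set ℂ} (hD : IsCalculusDomain A k S D) (hS : S ⊆ sphericalPreimage (regDomain f))
    (hγ : γ.Encloses 0 D (closure D)) (hd' : d.Encloses (-1) W C)
    (hW : slice I ⁻¹' spectrum T ⊆ W) (hC : C ⊆ slice I ⁻¹' regDomain f)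
    (hb : W ∈ Bornology.cobounded ℂ) :
    sliceIntegral (sResolvent T) f I d =
      sliceIntegral (bddResolvent A) (transport f c k) I γ - (2 * Real.pi) • lmulAlg V c := by
  rw [← sliceIntegral_invAdd hA hd hf hI hD hS hγ]
  exact sliceIntegral_sResolvent_eq hA hd hI hd'
    (hγ.invAdd hD.isBounded.closure hD.zero_mem k) hW (hA.spectrum_subset_invAdd hI hD) hC
    (hD.invAdd_subset hS hI) hb (invAdd_mem_cobounded hD.isOpen hD.zero_mem k)

/-- The integrals for two different shifts agree. -/
theorem sliceIntegral_bddResolvent_shift_eq (hA : IsShiftInverse T k A)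
    (hd : Dense (T.domain : Set V)) (hf : RegularAtInfty f c) (hI : I ∈ imUnits) {γ γ' : Chain}
    {k' : ℝ} {A' : V →L[ℍ[ℝ]ᵐᵒᵖ] V} (hA' : IsShiftInverse T k' A') {D S D' : Set ℂ}
    (hD : IsCalculusDomain A k S D) (hD' : IsCalculusDomain A' k' S D')
    (hS : S ⊆ sphericalPreimage (regDomain f))
    (hγ : γ.Encloses 0 D (closure D)) (hγ' : γ'.Encloses 0 D' (closure D')) :
    sliceIntegral (bddResolvent A) (transport f c k) I γ =
      sliceIntegral (bddResolvent A') (transport f c k') I γ' := by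
  -- The image in the `s`-plane of the contour for `k'` is an admissible contour for `T`. Its
  -- integral is thus computed once with `k` and once with `k'`.
  have h := sliceIntegral_sResolvent_chain_eq hA hd hf hI hD hS hγ
    (hγ'.invAdd hD'.isBounded.closure hD'.zero_mem k') (hA'.spectrum_subset_invAdd hI hD')
    (hD'.invAdd_subset hS hI) (invAdd_mem_cobounded hD'.isOpen hD'.zero_mem k')
  rw [sliceIntegral_invAdd hA' hd hf hI hD' hS hγ'] at h
  exact (sub_left_injective h).symm

/-- An admissible `U` need not contain `0`: the integrand is singular only on the spectrum of `A`,
so Cauchy's theorem still compares `U` with `D`. -/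
theorem IsCalculusDomain.sliceIntegral_eq {S D : Set ℂ} (hD : IsCalculusDomain A k S D)
    (hf : RegularAtInfty f c) (hS : S ⊆ sphericalPreimage (regDomain f)) (hI : I ∈ imUnits)
    {γ : Chain} (hγ : γ.Encloses 0 D (closure D)) {U : Set ℍ[ℝ]} (hU : IsOpen U)
    (hb : Bornology.IsBounded U) (hAU : bddSpectrum A ⊆ U)
    (hφ : SliceRegularOnClosure (transport f c k) U) (Γ : PositiveBoundary (slice I ⁻¹' U)) :
    sliceIntegral (bddResolvent A) (transport f c k) I γ =
      sliceIntegral (bddResolvent A) (transport f c k) I Γ.chain := by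
  have hb' := isBounded_slice_preimage hb hI
  refine sliceIntegral_bddResolvent_eq hI hγ
    (Γ.encloses_of_isBounded (hU.preimage (continuous_slice I)) hb') ?_ (Set.preimage_mono hAU)
    (fun z hz => invPreimage_subset hf k hS (hD.closure_subset hz) I hI)
    (hφ.closure_slice_subset I) hD.isBounded.closure hb'.closure
  rw [slice_preimage_bddSpectrum A hI]
  exact hD.subset

/-- If `f` is affine on spheres along the path of integration, the value does not depend on the
slice. -/
theorem IsCalculusDomain.sliceIntegral_eq_of_affine {S D : Set ℂ} (hD : IsCalculusDomain A k S D)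
    (hf : RegularAtInfty f c) (hS : S ⊆ sphericalPreimage (regDomain f)) (hSa : S ⊆ affineSet f)
    {J : ℍ[ℝ]} (hI : I ∈ imUnits) (hJ : J ∈ imUnits) {γ : Chain}
    (hγ : γ.Encloses 0 D (closure D)) :
    sliceIntegral (bddResolvent A) (transport f c k) I γ =
      sliceIntegral (bddResolvent A) (transport f c k) J γ := by
  set φ := transport f c k
  have hcC : ∀ z ∈ closure D, (starRingEnd ℂ) z ∈ closure D := fun z hz =>
    map_mem_closure Complex.continuous_conj hz hD.conj_mem
  have hreg : closure D ⊆ sphericalPreimage (regDomain φ) := fun z hz =>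
    invPreimage_subset hf k hS (hD.closure_subset hz)
  -- Passing from `K` to `-K` conjugates and reverses the contour. As `D` is symmetric, the new
  -- contour encloses the same region.
  have hneg : ∀ K ∈ imUnits, sliceIntegral (bddResolvent A) φ (-K) γ =
      sliceIntegral (bddResolvent A) φ K γ := fun K hK => by
    have h1 : sliceIntegral (bddResolvent A) φ K γ.conjNeg =
        sliceIntegral (bddResolvent A) φ (-K) γ := by
      rw [sliceIntegral, opIntegral_conjNeg]
      simp only [slice_conj]
      rfl
    have hsub : slice K ⁻¹' bddSpectrum A ⊆ D := by
      rw [slice_preimage_bddSpectrum A hK]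
      exact hD.subset
    have hr : closure D ⊆ slice K ⁻¹' regDomain φ := fun z hz => hreg hz K hK
    rw [← h1]
    exact sliceIntegral_bddResolvent_eq hK (hγ.conjNeg hD.conj_mem hcC) hγ hsub hsub hr hr
      hD.isBounded.closure hD.isBounded.closure
  have hun : ∀ ζ ∈ γ.trace, IsUnit (quadForm 1 (toReal V A) ζ) := fun ζ hζ => by
    by_contra h
    exact (hγ.trace_subset hζ).2 (hD.subset h)
  have h := opIntegral_add_neg_eq (ρ := lmulAlg V) (c := γ) (f := φ) (A := toReal V A)
    (fun z hz => mem_affineSet_transport fun h0 =>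
      hSa (hD.closure_subset (hγ.trace_subset hz).1 h0)) hI hJ
    (fun K hK => (rightHol_resolventForm (lmulAlg V) hK (by simp)).continuousOn.mono hun)
    (fun K hK => (leftHol_regDomain φ hK).continuousOn.mono fun z hz =>
      hreg (hγ.trace_subset hz).1 K hK)
  have e : ∀ K ∈ imUnits, opIntegral (lmulAlg V) γ K (resolventForm (lmulAlg V) K 1 (toReal V A))
      (fun z => φ (slice K z)) = sliceIntegral (bddResolvent A) φ K γ := fun K hK => by
    simp only [sliceIntegral, toReal_bddResolvent A hK]
  rw [e I hI, e _ (imUnits.neg_mem hI), e J hJ, e _ (imUnits.neg_mem hJ), hneg I hI, hneg J hJ,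
    ← two_smul ℝ, ← two_smul ℝ] at h
  exact smul_right_injective _ (two_ne_zero' ℝ) h

end unbounded

end SCalc

/-! ### The functional calculus and its three properties -/

open SCalc in
theorem mainTheorem1 {V : Type*} [NormedAddCommGroup V] [NormedSpace ℝ V] [CompleteSpace V]
    [Module ℍ[ℝ] V] [Module ℍ[ℝ]ᵐᵒᵖ V] [SMulCommClass ℍ[ℝ] ℍ[ℝ]ᵐᵒᵖ V]
    [IsScalarTower ℝ ℍ[ℝ] V] [IsScalarTower ℝ ℍ[ℝ]ᵐᵒᵖ V]
    [IsBoundedSMul ℍ[ℝ] V] [IsBoundedSMul ℍ[ℝ]ᵐᵒᵖ V]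
    (T : V →ₗ.[ℍ[ℝ]ᵐᵒᵖ] V) (hT : SCalc.IsAdmissible T)
    (hk : ∃ k : ℝ, (k : ℍ[ℝ]) ∈ SCalc.resolventSet T)
    (f : ℍ[ℝ] → ℍ[ℝ]) (U : Set ℍ[ℝ]) (hU : IsOpen U) (hσU : SCalc.spectrum T ⊆ U)
    (hf : SCalc.SliceRegularOn f U)
    (c : ℍ[ℝ]) (hf_infty : SCalc.RegularAtInfty f c) :
    ∃ F : SCalc.imUnits → (V →L[ℍ[ℝ]ᵐᵒᵖ] V),
      -- `F I` is `φ((T - k)⁻¹)`, computed on `L_I`, for every real `k` in the S-resolvent set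
      (∀ (I : SCalc.imUnits) (k : ℝ), (k : ℍ[ℝ]) ∈ SCalc.resolventSet T →
        ∃ A : V →L[ℍ[ℝ]ᵐᵒᵖ] V, SCalc.IsShiftInverse T k A ∧
          SCalc.HasCalculus I A (SCalc.transport f c k) (F I)) ∧
      -- the Cauchy formula
      (∀ (I : SCalc.imUnits) (W : Set ℍ[ℝ]), IsOpen W → SCalc.spectrum T ⊆ W →
        (∃ r : ℝ, {q : ℍ[ℝ] | r < ‖q‖} ⊆ W) → SCalc.SliceRegularOnClosure f W →
        ∀ Γ : SCalc.PositiveBoundary (SCalc.slice I ⁻¹' W),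
          (F I).restrictScalars ℝ = (SCalc.lmul c : V →L[ℍ[ℝ]ᵐᵒᵖ] V).restrictScalars ℝ +
            (2 * Real.pi)⁻¹ • SCalc.contourIntegral I Γ (SCalc.sResolvent T) f) ∧
      -- all slices give the same operator `f(T)` if `U` contains the circularized spectrum
      (SCalc.circ (SCalc.spectrum T) ⊆ U → ∀ I J : SCalc.imUnits, F I = F J) := by
  have hd : Dense (T.domain : Set V) := hT.dense
  set S := sphericalPreimage (regDomain f) with hSdef
  have hS : IsOpen S := isOpen_sphericalPreimage (isOpen_regDomain f)
  obtain ⟨r, hr⟩ := sphericalPreimage_mem_cobounded hf_infty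
  have hSc : S ∈ Bornology.cobounded ℂ :=
    Filter.mem_of_superset (setOf_lt_norm_mem_cobounded r) hr
  have hUf : U ⊆ regDomain f := subset_regDomain hU hf
  -- Whether `x + yI` is in the spectrum does not depend on `I`, so the sphere of every spectral
  -- point is in the regularity domain.
  have hσ : ∀ (k : ℝ) A, IsShiftInverse T k A → ∀ z : ℂ,
      ¬ IsUnit (quadForm (toReal V A) 1 (z - k)) → z ∈ S := fun k A hA z hz I hI =>
    hUf (hσU ((hA.mem_spectrum_slice hI z).2 hz))
  obtain ⟨k₀, hk₀⟩ := hk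
  obtain ⟨A₀, hA₀⟩ := exists_isShiftInverse hT hk₀
  obtain ⟨D₀, hD₀, ⟨Γ₀⟩⟩ := exists_isCalculusDomain A₀ k₀ hS hSc (hσ k₀ A₀ hA₀)
  have hΓ₀ := Γ₀.encloses_of_isBounded hD₀.isOpen hD₀.isBounded
  -- The operators are defined with one fixed shift `k₀` and one fixed contour, and all other
  -- choices are compared with these.
  have hex : ∀ I : imUnits, ∃ F : V →L[ℍ[ℝ]ᵐᵒᵖ] V, toReal V F =
      (2 * Real.pi)⁻¹ • sliceIntegral (bddResolvent A₀) (transport f c k₀) I Γ₀.chain := by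
    rintro ⟨I, hI⟩
    refine exists_toReal_eq_sliceIntegral
      ((rightHol_bddResolvent A₀ hI).continuousOn.mono fun z hz h => ?_)
      ((leftHol_regDomain _ hI).continuousOn.mono fun z hz => ?_) _
    · rw [slice_preimage_bddSpectrum A₀ hI] at h
      exact (hΓ₀.trace_subset hz).2 (hD₀.subset h)
    · exact invPreimage_subset hf_infty k₀ subset_rfl
        (hD₀.closure_subset (hΓ₀.trace_subset hz).1) I hI
  choose F hF using hex
  refine ⟨F, ?_, ?_, ?_⟩
  · rintro ⟨I, hI⟩ k hk
    obtain ⟨A, hA⟩ := exists_isShiftInverse hT hk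
    obtain ⟨D, hD, ⟨Γ⟩⟩ := exists_isCalculusDomain A k hS hSc (hσ k A hA)
    have hΓ := Γ.encloses_of_isBounded hD.isOpen hD.isBounded
    obtain ⟨h1, h2⟩ := hD.axialSet hf_infty subset_rfl
    refine ⟨A, hA, ⟨axialSet D, hD.isOpen.preimage continuous_axial,
      isBounded_axialSet hD.isBounded, h1, h2, fun J hJ => ?_⟩, fun U' hU' hb hAU hφ Γ' => ?_⟩
    · rw [slice_preimage_axialSet hD.conj_mem hJ]
      exact ⟨Γ⟩
    · refine (hF ⟨I, hI⟩).trans ?_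
      rw [contourIntegral_eq,
        ← hD.sliceIntegral_eq hf_infty subset_rfl hI hΓ hU' hb hAU hφ Γ',
        sliceIntegral_bddResolvent_shift_eq hA₀ hd hf_infty hI hA hD₀ hD subset_rfl hΓ₀ hΓ]
  · rintro ⟨I, hI⟩ W hW hσW ⟨R, hR⟩ hfW Γ
    have hc := slice_preimage_mem_cobounded hR hI
    refine (hF ⟨I, hI⟩).trans ?_
    rw [contourIntegral_eq, sliceIntegral_sResolvent_chain_eq hA₀ hd hf_infty hI hD₀ subset_rfl hΓ₀
      (Γ.encloses_of_cobounded (hW.preimage (continuous_slice I)) hc) (Set.preimage_mono hσW)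
      (hfW.closure_slice_subset I) hc, smul_sub, smul_smul,
      inv_mul_cancel₀ (by positivity : (2 * Real.pi) ≠ 0), one_smul]
    exact (add_sub_cancel _ _).symm
  · rintro hcirc ⟨I, hI⟩ ⟨J, hJ⟩
    -- The region is shrunk to where `f` is also affine in the imaginary unit. It still contains a
    -- neighbourhood of infinity, because large circles about `0` stay in the regularity domain.
    set S' := S ∩ interior (affineSet f)
    have hS'c : S' ∈ Bornology.cobounded ℂ := by
      refine Filter.mem_of_superset (setOf_lt_norm_mem_cobounded r) fun z hz => ⟨hr hz, ?_⟩
      refine mem_interior_affineSet (x := 0) fun w hw => hr ?_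
      rw [Complex.ofReal_zero, sub_zero, sub_zero] at hw
      rw [Set.mem_ofPred_eq, hw]
      exact hz
    have hσ' : ∀ z : ℂ, ¬ IsUnit (quadForm (toReal V A₀) 1 (z - k₀)) → z ∈ S' := fun z hz => by
      -- The circle about `Re z` through `z` is contained, in each slice, in the sphere `x + yu`
      -- over all unit quaternions `u`. This is where the full circularization is used.
      refine ⟨hσ k₀ A₀ hA₀ z hz, mem_interior_affineSet (x := z.re) fun w hw K hK => hUf (hcirc ?_)⟩
      have hzσ := (hA₀.mem_spectrum_slice hK z).2 hz
      refine ⟨z.re, z.im, K, hK, hzσ, ?_⟩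
      have e : z - z.re = z.im * Complex.I := by
        apply Complex.ext <;> simp
      rw [e, norm_mul, Complex.norm_I, mul_one, Complex.norm_real, Real.norm_eq_abs] at hw
      -- At a real spectral point the circle degenerates to the point itself and `u = 1` serves.
      rcases eq_or_ne z.im 0 with h0 | h0
      · rw [h0, abs_zero, norm_eq_zero, sub_eq_zero] at hw
        refine ⟨1, norm_one, ?_⟩
        rw [hw, slice_ofReal, h0, zero_smul, add_zero]
      · refine ⟨z.im⁻¹ • slice K (w - z.re), ?_, ?_⟩
        · rw [norm_smul, norm_slice hK, hw, norm_inv, Real.norm_eq_abs,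
            inv_mul_cancel₀ (abs_ne_zero.2 h0)]
        · rw [smul_smul, mul_inv_cancel₀ h0, one_smul, slice_sub, slice_ofReal]
          abel
    obtain ⟨D, hD, ⟨Γ⟩⟩ := exists_isCalculusDomain A₀ k₀ (hS.inter isOpen_interior) hS'c hσ'
    have hΓ := Γ.encloses_of_isBounded hD.isOpen hD.isBounded
    have h := hD.sliceIntegral_eq_of_affine hf_infty Set.inter_subset_left
      (Set.inter_subset_right.trans interior_subset) hI hJ hΓ
    -- The contour in the smaller region is also admissible for `S`, so the integrals that define
    -- `F` may be moved to it on both slices.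
    have hD' : IsCalculusDomain A₀ k₀ S D :=
      { hD with closure_subset := fun z hz h0 => (hD.closure_subset hz h0).1 }
    refine toReal_injective ?_
    rw [hF, hF, sliceIntegral_bddResolvent_shift_eq hA₀ hd hf_infty hI hA₀ hD₀ hD' subset_rfl hΓ₀ hΓ,
      sliceIntegral_bddResolvent_shift_eq hA₀ hd hf_infty hJ hA₀ hD₀ hD' subset_rfl hΓ₀ hΓ, h]

end
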